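/- Let $M$ be an oriented smooth manifold of dimension $n\ge 2$. Consider symmetric teleparallel gravity in vacuum: the fields are a Lorentzian metric $g_{ab}$, an independent affine connection $\Gamma^a{}_{bc}$ (with $\nabla_bV^a=\partial_bV^a+\Gamma^a{}_{bc}V^c$), and multipliers $\lambda_{Ra}{}^{bcd}=-\lambda_{Ra}{}^{bdc}$, $\lambda_{Ta}{}^{bc}=-\lambda_{Ta}{}^{cb}$ (tensor densities of the weight of $\sqrt{-g}$), and $$\mathcal L=\sqrt{-g}\,f(g_{ab},Q_{abc})+\lambda_{Ra}{}^{bcd}R^a{}_{bcd}+\lambda_{Ta}{}^{bc}T^a{}_{bc},\qquad Q_{abc}=\nabla_ag_{bc},$$ where $f$ is a smooth scalar function, $T$ and $R$ are the torsion and curvature of $\Gamma$. Put $\sqrt{-g}P^{abc}=\partial(\sqrt{-g}f)/\partial Q_{abc}$. Fields are on shell if the equations of motion of $g,\Gamma,\lambda_R,\lambda_T$ hold (in particular $R=0$, $T=0$). Let $\varepsilon$ be the antisymmetric symbol. 1. (Boundary term.) For every smooth one-parameter family of fields with variation $\delta\phi$, $$\delta\mathcal L=E(\phi)\,\delta\phi+\partial_a\big(\Theta^a+\sqrt{-g}P^{abc}\delta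 g_{bc}\big),\qquad \Theta^a=2\lambda_{Rd}{}^{cab}\,\delta\Gamma^d{}_{bc},$$ where $E(\phi)\delta\phi$ is linear in the undifferentiated variations and its coefficients are the field equations. 2. (Entropy.) Let $\phi$ be on shell. For a vector field $V$ let $\mathbf J[V]$ be the Noether current, the $(n-1)$-form $\varepsilon_{aa_2\dots a_n}J^a$ with $J^a=2\lambda_{Rd}{}^{cab}(\mathcal L_V\Gamma)^d{}_{bc}+\sqrt{-g}P^{abc}(\mathcal L_Vg)_{bc}-V^a\mathcal L$. A Noether charge is an $(n-2)$-form $\mathbf Q_N[V]$ on $M$, depending on $V$ through a linear differential operator of order at most one with smooth coefficients, such that $d\mathbf Q_N[V]=\mathbf J[V]$ for all (local) $V$. A Noether charge exists. Let $\Sigma\subset M$ be a closed oriented embedded surface of codimension two with binormal $b_{ab}$ ($b_{ab}$ is normal to $\Sigma$, $b_{ab}b^{ab}=-2$), and let $V$ be a Killing field of $g$ that vanishes on $\Sigma$, with constant surface gravity $\kappa=-\tfrac12b^{cd}\nabla_cV_d\neq0$ on $\Sigma$. Then for every Noether charge $$\int_\Sigma\mathbf Q_N[V]=\frac{\kappa}{2\pi}S,\qquad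 S=2\pi\int_\Sigma\mathbf X^{cd}b_{cd},\qquad(\mathbf X^{cd})_{a_3\dots a_n}=\varepsilon_{aba_3\dots a_n}\lambda_R{}^{dcab}.$$ 3. (Invariance.) Let $\phi$ be on shell and let $\kappa_a{}^{bcde}$, $\kappa_a{}^{bcd}$ be smooth tensor densities of the same weight, totally antisymmetric in their last three indices. Consider $$\lambda_{Ra}{}^{bcd}\to\lambda_{Ra}'{}^{bcd}=\lambda_{Ra}{}^{bcd}+\nabla_e\kappa_a{}^{bcde}+\kappa_a{}^{bcd},\qquad\lambda_{Ta}{}^{bc}\to\lambda_{Ta}{}^{bc}+\nabla_d\kappa_a{}^{bcd}.$$ (a) The transformed fields are on shell. (b) For families of fields through $\phi$ with torsion-free connections, the variation of the transformed Lagrangian is $\partial_a(\Theta^a+\sqrt{-g}P^{abc}\delta g_{bc}+\delta\mu^a)$ with the original $\Theta$ and $\mu^a=\kappa_d{}^{bcea}R^d{}_{bce}$, which vanishes on shell; the Noether current of the transformed Lagrangian formed with this boundary term equals the original $\mathbf J[V]$ for every $V$, so that it defines the same Noether charges and the same entropy. (c) If instead the boundary term $2\lambda'_{Rd}{}^{cab}\delta\Gamma^d{}_{bc}$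 is used, it differs from $\Theta$ by the exact form $d\mathbf Y$, $\mathbf Y_{a_3\dots a_n}=\varepsilon_{aba_3\dots a_n}\kappa_d{}^{caeb}\delta\Gamma^d{}_{ec}$, for all $\delta\Gamma$ with $\delta T=0$, $\delta R=0$. Correspondingly, for $\Sigma,V,b,\kappa$ as in 2, $$\frac{\kappa}{2\pi}\big(S[\lambda_R']-S[\lambda_R]\big)=\int_\Sigma\mathbf Y(\mathcal L_V\Gamma),$$ and in particular $S[\lambda_R']=S[\lambda_R]$ if $\mathcal L_V\Gamma=0$ on $\Sigma$ (for instance if $V$ is a symmetry of the dynamical fields). -/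

import Mathlib

open scoped Manifold ContDiff BigOperators

noncomputable section

namespace STG

/-! ### Charts, partial derivatives, coordinate changes

All fields are given by their components in the charts of the atlas of the spacetime `M`
(index notation), together with the transformation law that relates the components in two
overlapping charts. -/

/-- Coordinate space. -/
abbrev E (n : ℕ) := EuclideanSpace ℝ (Fin n)

/-- The type of charts of an `n`-dimensional manifold. -/
abbrev Chart (n : ℕ) (M : Type*) [TopologicalSpace M] := OpenPartialHomeomorph M (E n)

/-- Components, with values in `T`, of a field in every chart. -/
abbrev Comp (n : ℕ) (M : Type*) [TopologicalSpace M] (T : Type*) := Chart n M → E n → T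

/-- One-, two-, ... index arrays. -/
abbrev Ix1 (n : ℕ) := Fin n → ℝ
abbrev Ix2 (n : ℕ) := Fin n → Fin n → ℝ
abbrev Ix3 (n : ℕ) := Fin n → Fin n → Fin n → ℝ
abbrev Ix4 (n : ℕ) := Fin n → Fin n → Fin n → Fin n → ℝ
abbrev Ix5 (n : ℕ) := Fin n → Fin n → Fin n → Fin n → Fin n → ℝ

/-- The coordinate vector `∂_a`. -/
abbrev basisVec {n : ℕ} (a : Fin n) : E n := EuclideanSpace.single a (1 : ℝ)

/-- Partial derivative `∂_a F`. -/
def pd {n : ℕ} (a : Fin n) (F : E n → ℝ) (x : E n) : ℝ := fderiv ℝ F x (basisVec a)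

section Fields

variable {n : ℕ} {M : Type*} [TopologicalSpace M]

/-- The coordinate change from the chart `e` to the chart `e'`. -/
def trans (e e' : Chart n M) (x : E n) : E n := e' (e.symm x)

/-- The set of coordinates, in the chart `e`, of the points in the domain of both charts. -/
def overlap (e e' : Chart n M) : Set (E n) := e.target ∩ e.symm ⁻¹' e'.source

/-- The Jacobian `J^A_a = ∂x'^A / ∂x^a` of the coordinate change from `e` to `e'`. -/
def jac (e e' : Chart n M) (x : E n) : Ix2 n := fun A a => pd a (fun y => trans e e' y A) x

def jacDet (e e' : Chart n M) (x : E n) : ℝ := (Matrix.of (jac e e' x)).det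

/-- The atlas of the manifold is oriented. -/
def OrientedAtlas (n : ℕ) (M : Type*) [TopologicalSpace M] [ChartedSpace (E n) M] : Prop :=
  ∀ e ∈ atlas (E n) M, ∀ e' ∈ atlas (E n) M, ∀ x ∈ overlap e e', 0 < jacDet e e' x

/-- A symmetric matrix of signature `(-,+,...,+)`. -/
def IsLorentzian (g : Ix2 n) : Prop :=
  (∀ a b, g a b = g b a) ∧
    ∃ P : Matrix (Fin n) (Fin n) ℝ, P.det ≠ 0 ∧
      P.transpose * Matrix.of g * P =
        Matrix.diagonal (fun i : Fin n => if i.val = 0 then (-1 : ℝ) else 1)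

/-- The inverse metric `g^{ab}`. -/
def invMetric (g : Ix2 n) : Ix2 n := fun a b => (Matrix.of g)⁻¹ a b

/-- `√(-g)`. -/
def sqrtNegDet (g : Ix2 n) : ℝ := Real.sqrt (-(Matrix.of g).det)

/-! ### Fields -/

variable [ChartedSpace (E n) M]

/-- Smooth vector fields `V^a`. -/
structure IsVectorField (V : Comp n M (Ix1 n)) : Prop where
  smooth : ∀ e ∈ atlas (E n) M, ∀ a, ContDiffOn ℝ ∞ (fun x => V e x a) e.target
  law : ∀ e ∈ atlas (E n) M, ∀ e' ∈ atlas (E n) M, ∀ x ∈ overlap e e', ∀ A,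
    V e' (trans e e' x) A = ∑ a, jac e e' x A a * V e x a

/-- Smooth Lorentzian metrics `g_{ab}`. -/
structure IsMetricField (g : Comp n M (Ix2 n)) : Prop where
  smooth : ∀ e ∈ atlas (E n) M, ∀ a b, ContDiffOn ℝ ∞ (fun x => g e x a b) e.target
  lorentzian : ∀ e ∈ atlas (E n) M, ∀ x ∈ e.target, IsLorentzian (g e x)
  law : ∀ e ∈ atlas (E n) M, ∀ e' ∈ atlas (E n) M, ∀ x ∈ overlap e e', ∀ a b,
    g e x a b = ∑ A, ∑ B, jac e e' x A a * jac e e' x B b * g e' (trans e e' x) A B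

/-- Smooth affine connections; `Γ e x a b c` is `Γ^a_{bc}`, and
`∇_b V^a = ∂_b V^a + Γ^a_{bc} V^c`. -/
structure IsConnection (Γ : Comp n M (Ix3 n)) : Prop where
  smooth : ∀ e ∈ atlas (E n) M, ∀ a b c, ContDiffOn ℝ ∞ (fun x => Γ e x a b c) e.target
  law : ∀ e ∈ atlas (E n) M, ∀ e' ∈ atlas (E n) M, ∀ x ∈ overlap e e', ∀ A b c,
    ∑ B, ∑ C, Γ e' (trans e e' x) A B C * jac e e' x B b * jac e e' x C c =
      ∑ a, jac e e' x A a * Γ e x a b c - pd b (fun y => jac e e' y A c) x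

/-- Smooth tensor densities `D_a^{bc}` of the weight of `√(-g)`. -/
structure IsDensity2 (D : Comp n M (Ix3 n)) : Prop where
  smooth : ∀ e ∈ atlas (E n) M, ∀ a b c, ContDiffOn ℝ ∞ (fun x => D e x a b c) e.target
  law : ∀ e ∈ atlas (E n) M, ∀ e' ∈ atlas (E n) M, ∀ x ∈ overlap e e', ∀ a B C,
    |jacDet e e' x| * ∑ A, jac e e' x A a * D e' (trans e e' x) A B C =
      ∑ b, ∑ c, jac e e' x B b * jac e e' x C c * D e x a b c

/-- Smooth tensor densities `D_a^{bcd}` of the weight of `√(-g)`. -/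
structure IsDensity3 (D : Comp n M (Ix4 n)) : Prop where
  smooth : ∀ e ∈ atlas (E n) M, ∀ a b c d, ContDiffOn ℝ ∞ (fun x => D e x a b c d) e.target
  law : ∀ e ∈ atlas (E n) M, ∀ e' ∈ atlas (E n) M, ∀ x ∈ overlap e e', ∀ a B C D',
    |jacDet e e' x| * ∑ A, jac e e' x A a * D e' (trans e e' x) A B C D' =
      ∑ b, ∑ c, ∑ d, jac e e' x B b * jac e e' x C c * jac e e' x D' d * D e x a b c d

/-- Smooth tensor densities `D_a^{bcdf}` of the weight of `√(-g)`. -/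
structure IsDensity4 (D : Comp n M (Ix5 n)) : Prop where
  smooth : ∀ e ∈ atlas (E n) M, ∀ a b c d f,
    ContDiffOn ℝ ∞ (fun x => D e x a b c d f) e.target
  law : ∀ e ∈ atlas (E n) M, ∀ e' ∈ atlas (E n) M, ∀ x ∈ overlap e e', ∀ a B C D' F,
    |jacDet e e' x| * ∑ A, jac e e' x A a * D e' (trans e e' x) A B C D' F =
      ∑ b, ∑ c, ∑ d, ∑ f, jac e e' x B b * jac e e' x C c * jac e e' x D' d *
        jac e e' x F f * D e x a b c d f

/-- Total antisymmetry in the last three indices, for `κ_a^{bcd}`. -/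
def TotallyAntisymm3 (κ : Comp n M (Ix4 n)) : Prop :=
  ∀ e ∈ atlas (E n) M, ∀ x ∈ e.target, ∀ a b c d,
    κ e x a b c d = -κ e x a c b d ∧ κ e x a b c d = -κ e x a b d c

/-- Total antisymmetry in the last three indices, for `κ_a^{bcdf}`. -/
def TotallyAntisymm4 (κ : Comp n M (Ix5 n)) : Prop :=
  ∀ e ∈ atlas (E n) M, ∀ x ∈ e.target, ∀ a b c d f,
    κ e x a b c d f = -κ e x a b d c f ∧ κ e x a b c d f = -κ e x a b c f d

/-! ### Geometry of an affine connection -/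

/-- Torsion `T^a_{bc} = Γ^a_{bc} - Γ^a_{cb}`. -/
def torsion (Γ : Ix3 n) : Ix3 n := fun a b c => Γ a b c - Γ a c b

/-- Curvature `R^a_{bcd} = ∂_c Γ^a_{db} - ∂_d Γ^a_{cb} + Γ^a_{ce} Γ^e_{db} - Γ^a_{de} Γ^e_{cb}`. -/
def curvature (Γ : E n → Ix3 n) (x : E n) : Ix4 n := fun a b c d =>
  pd c (fun y => Γ y a d b) x - pd d (fun y => Γ y a c b) x
    + ∑ h, (Γ x a c h * Γ x h d b - Γ x a d h * Γ x h c b)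

/-- The first variation of the curvature in the direction `γ = δΓ`. -/
def linCurvature (Γ γ : E n → Ix3 n) (x : E n) : Ix4 n := fun a b c d =>
  pd c (fun y => γ y a d b) x - pd d (fun y => γ y a c b) x
    + ∑ h, (γ x a c h * Γ x h d b + Γ x a c h * γ x h d b
        - γ x a d h * Γ x h c b - Γ x a d h * γ x h c b)

/-- Non-metricity `Q_{abc} = ∇_a g_{bc}`. -/
def nonmetricity (g : E n → Ix2 n) (Γ : E n → Ix3 n) (x : E n) : Ix3 n := fun a b c =>
  pd a (fun y => g y b c) x - ∑ h, Γ x h a b * g x h c - ∑ h, Γ x h a c * g x b h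

/-- `nablaVec Γ V x b a` is `∇_b V^a`. -/
def nablaVec (Γ : E n → Ix3 n) (V : E n → Ix1 n) (x : E n) : Ix2 n := fun b a =>
  pd b (fun y => V y a) x + ∑ c, Γ x a b c * V x c

/-- `nablaUpper3 Γ P x f a b c` is `∇_f P^{abc}`, for a density `P` of the weight of `√(-g)`. -/
def nablaUpper3 (Γ : E n → Ix3 n) (P : E n → Ix3 n) (x : E n) : Ix4 n := fun f a b c =>
  pd f (fun y => P y a b c) x
    + ∑ h, Γ x a f h * P x h b c + ∑ h, Γ x b f h * P x a h c + ∑ h, Γ x c f h * P x a b h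
    - (∑ h, Γ x h f h) * P x a b c

/-- `nablaDensity3 Γ D x f a b c d` is `∇_f D_a^{bcd}`, for a density `D` of the weight of
`√(-g)`. -/
def nablaDensity3 (Γ : E n → Ix3 n) (D : E n → Ix4 n) (x : E n) : Ix5 n := fun f a b c d =>
  pd f (fun y => D y a b c d) x
    - ∑ h, Γ x h f a * D x h b c d
    + ∑ h, Γ x b f h * D x a h c d + ∑ h, Γ x c f h * D x a b h d + ∑ h, Γ x d f h * D x a b c h
    - (∑ h, Γ x h f h) * D x a b c d

/-- `divDensity4 Γ D x a b c d` is `∇_e D_a^{bcde}`, for a density `D` of the weight of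
`√(-g)`. -/
def divDensity4 (Γ : E n → Ix3 n) (D : E n → Ix5 n) (x : E n) : Ix4 n := fun a b c d =>
  ∑ e, (pd e (fun y => D y a b c d e) x
    - ∑ h, Γ x h e a * D x h b c d e
    + ∑ h, Γ x b e h * D x a h c d e + ∑ h, Γ x c e h * D x a b h d e
    + ∑ h, Γ x d e h * D x a b c h e + ∑ h, Γ x e e h * D x a b c d h
    - (∑ h, Γ x h e h) * D x a b c d e)

/-- Lie derivative `(L_V g)_{ab}`. -/
def lieMetric (V : E n → Ix1 n) (g : E n → Ix2 n) (x : E n) : Ix2 n := fun a b =>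
  ∑ c, (V x c * pd c (fun y => g y a b) x
    + g x c b * pd a (fun y => V y c) x + g x a c * pd b (fun y => V y c) x)

/-- Lie derivative `(L_V Γ)^a_{bc}` of a connection. -/
def lieConnection (V : E n → Ix1 n) (Γ : E n → Ix3 n) (x : E n) : Ix3 n := fun a b c =>
  pd b (fun y => pd c (fun z => V z a) y) x
    + ∑ h, (V x h * pd h (fun y => Γ y a b c) x - Γ x h b c * pd h (fun y => V y a) x
        + Γ x a h c * pd b (fun y => V y h) x + Γ x a b h * pd c (fun y => V y h) x)

end Fields

/-! ### The theory -/

section Theory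

variable {n : ℕ}

/-- Arguments `(g_{ab}, Q_{abc})` of the Lagrangian function. -/
abbrev Arg (n : ℕ) := Ix2 n × Ix3 n

/-- `f` evaluated after symmetrizing `g_{ab}` in `a, b` and `Q_{abc}` in `b, c`; only the values of
`f` on symmetric arguments matter. -/
def symEval (f : Ix2 n → Ix3 n → ℝ) (p : Arg n) : ℝ :=
  f (fun a b => (p.1 a b + p.1 b a) / 2) (fun a b c => (p.2 a b c + p.2 a c b) / 2)

/-- `f(g, Q)` is a smooth scalar function (weight `0`) of a Lorentzian metric and a non-metricity
tensor: its value does not change under (orientation preserving) linear changes of frame. -/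
structure IsScalarFunction (f : Ix2 n → Ix3 n → ℝ) : Prop where
  smooth : ∀ g Q, IsLorentzian g → (∀ a b c, Q a b c = Q a c b) →
    ContDiffAt ℝ ∞ (symEval f) (g, Q)
  invariant : ∀ g Q, IsLorentzian g → (∀ a b c, Q a b c = Q a c b) →
    ∀ A : Matrix (Fin n) (Fin n) ℝ, 0 < A.det →
      f (fun a b => ∑ c, ∑ d, A c a * A d b * g c d)
        (fun a b c => ∑ d, ∑ h, ∑ k, A d a * A h b * A k c * Q d h k) = f g Q

/-- The density `√(-g) f(g, Q)`, as a function of the (symmetrized) components. -/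
def mainDensity (f : Ix2 n → Ix3 n → ℝ) (p : Arg n) : ℝ :=
  symEval (fun g Q => sqrtNegDet g * f g Q) p

/-- `∂(√(-g) f)/∂g_{ab}` at fixed `Q_{abc}`. -/
def dMetric (f : Ix2 n → Ix3 n → ℝ) (p : Arg n) : Ix2 n := fun a b =>
  fderiv ℝ (mainDensity f) p (Pi.single a (Pi.single b 1), 0)

/-- `∂(√(-g) f)/∂Q_{abc}` at fixed `g_{ab}`. -/
def dNonmet (f : Ix2 n → Ix3 n → ℝ) (p : Arg n) : Ix3 n := fun a b c =>
  fderiv ℝ (mainDensity f) p (0, Pi.single a (Pi.single b (Pi.single c 1)))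

variable {M : Type*} [TopologicalSpace M]

variable (n M) in
/-- The fields of the theory: metric `g_{ab}`, connection `Γ^a_{bc}`, and the Lagrange multipliers
`lamR e x a b c d = λ_{Ra}^{bcd}` and `lamT e x a b c = λ_{Ta}^{bc}`. -/
structure Config where
  g : Comp n M (Ix2 n)
  Γ : Comp n M (Ix3 n)
  lamR : Comp n M (Ix4 n)
  lamT : Comp n M (Ix3 n)

/-- The multipliers are tensor densities, antisymmetric in their last two indices. -/
structure Config.IsField [ChartedSpace (E n) M] (φ : Config n M) : Prop where
  metric : IsMetricField φ.g
  connection : IsConnection φ.Γ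
  densityR : IsDensity3 φ.lamR
  densityT : IsDensity2 φ.lamT
  antisymmR : ∀ e ∈ atlas (E n) M, ∀ x ∈ e.target, ∀ a b c d,
    φ.lamR e x a b c d = -φ.lamR e x a b d c
  antisymmT : ∀ e ∈ atlas (E n) M, ∀ x ∈ e.target, ∀ a b c,
    φ.lamT e x a b c = -φ.lamT e x a c b

/-- `(g_{ab}, Q_{abc})` at the point with coordinates `x`. -/
def Config.arg (φ : Config n M) (e : Chart n M) (x : E n) : Arg n :=
  (φ.g e x, nonmetricity (φ.g e) (φ.Γ e) x)

/-- `∂(√(-g) f)/∂Q_{abc}`, i.e. `√(-g) P^{abc}`. -/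
def Config.conj (φ : Config n M) (f : Ix2 n → Ix3 n → ℝ) (e : Chart n M) (x : E n) : Ix3 n :=
  dNonmet f (φ.arg e x)

/-- The Lagrangian density `√(-g) f(g, Q) + λ_{Ra}^{bcd} R^a_{bcd} + λ_{Ta}^{bc} T^a_{bc}`. -/
def Config.lagrangian (φ : Config n M) (f : Ix2 n → Ix3 n → ℝ) (e : Chart n M) (x : E n) : ℝ :=
  sqrtNegDet (φ.g e x) * f (φ.g e x) (nonmetricity (φ.g e) (φ.Γ e) x)
    + ∑ a, ∑ b, ∑ c, ∑ d, φ.lamR e x a b c d * curvature (φ.Γ e) x a b c d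
    + ∑ a, ∑ b, ∑ c, φ.lamT e x a b c * torsion (φ.Γ e x) a b c

/-- The metric field equation, the coefficient of `δg_{ab}`:
`∂(√(-g) f)/∂g_{ab} + (T^d_{dc} - ∇_c) (√(-g) P^{cab})`. -/
def Config.eomMetric (φ : Config n M) (f : Ix2 n → Ix3 n → ℝ) (e : Chart n M) (x : E n) : Ix2 n :=
  fun a b => dMetric f (φ.arg e x) a b
    + ∑ c, ((∑ d, torsion (φ.Γ e x) d d c) * φ.conj f e x c a b
        - nablaUpper3 (φ.Γ e) (φ.conj f e) x c c a b)

/-- The connection field equation, the coefficient of `δΓ^a_{bc}`: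
`2 (T^h_{hd} - ∇_d) λ_{Ra}^{cdb} + λ_{Ra}^{cdh} T^b_{dh} + 2 λ_{Ta}^{bc} - 2 √(-g) P^{bc}_a`.
When the torsion vanishes, it is `2 (∇_d λ_{Ra}^{cbd} + λ_{Ta}^{bc} - √(-g) P^{bc}_a)`. -/
def Config.eomConnection (φ : Config n M) (f : Ix2 n → Ix3 n → ℝ) (e : Chart n M) (x : E n) :
    Ix3 n :=
  fun a b c => 2 * ∑ d, ((∑ h, torsion (φ.Γ e x) h h d) * φ.lamR e x a c d b
        - nablaDensity3 (φ.Γ e) (φ.lamR e) x d a c d b)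
    + ∑ d, ∑ h, φ.lamR e x a c d h * torsion (φ.Γ e x) b d h
    + 2 * φ.lamT e x a b c
    - 2 * ∑ d, φ.conj f e x b c d * φ.g e x d a

/-- All equations of motion hold: those of the metric, of the connection and of the two
multipliers (vanishing curvature, vanishing torsion). -/
structure Config.OnShell [ChartedSpace (E n) M] (φ : Config n M) (f : Ix2 n → Ix3 n → ℝ) :
    Prop where
  metric : ∀ e ∈ atlas (E n) M, ∀ x ∈ e.target, φ.eomMetric f e x = 0
  connection : ∀ e ∈ atlas (E n) M, ∀ x ∈ e.target, φ.eomConnection f e x = 0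
  flat : ∀ e ∈ atlas (E n) M, ∀ x ∈ e.target, curvature (φ.Γ e) x = 0
  torsionFree : ∀ e ∈ atlas (E n) M, ∀ x ∈ e.target, torsion (φ.Γ e x) = 0

/-- A smooth one-parameter family of fields. -/
structure IsSmoothFamily [ChartedSpace (E n) M] (Φ : ℝ → Config n M) : Prop where
  isField : ∀ s, (Φ s).IsField
  g : ∀ e ∈ atlas (E n) M, ∀ a b,
    ContDiffOn ℝ ∞ (fun p : ℝ × E n => (Φ p.1).g e p.2 a b) (Set.univ ×ˢ e.target)
  Γ : ∀ e ∈ atlas (E n) M, ∀ a b c,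
    ContDiffOn ℝ ∞ (fun p : ℝ × E n => (Φ p.1).Γ e p.2 a b c) (Set.univ ×ˢ e.target)
  lamR : ∀ e ∈ atlas (E n) M, ∀ a b c d,
    ContDiffOn ℝ ∞ (fun p : ℝ × E n => (Φ p.1).lamR e p.2 a b c d) (Set.univ ×ˢ e.target)
  lamT : ∀ e ∈ atlas (E n) M, ∀ a b c,
    ContDiffOn ℝ ∞ (fun p : ℝ × E n => (Φ p.1).lamT e p.2 a b c) (Set.univ ×ˢ e.target)

/-- The variation `δφ = dφ/ds` at `s = 0` of a one-parameter family. -/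
def variation (Φ : ℝ → Config n M) : Config n M where
  g e x a b := deriv (fun s => (Φ s).g e x a b) 0
  Γ e x a b c := deriv (fun s => (Φ s).Γ e x a b c) 0
  lamR e x a b c d := deriv (fun s => (Φ s).lamR e x a b c d) 0
  lamT e x a b c := deriv (fun s => (Φ s).lamT e x a b c) 0

/-- The term `E(φ) δφ` in the first variation of the Lagrangian density. -/
def Config.eomTerm (φ : Config n M) (f : Ix2 n → Ix3 n → ℝ) (δφ : Config n M)
    (e : Chart n M) (x : E n) : ℝ :=
  ∑ a, ∑ b, φ.eomMetric f e x a b * δφ.g e x a b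
    + ∑ a, ∑ b, ∑ c, φ.eomConnection f e x a b c * δφ.Γ e x a b c
    + ∑ a, ∑ b, ∑ c, ∑ d, curvature (φ.Γ e) x a b c d * δφ.lamR e x a b c d
    + ∑ a, ∑ b, ∑ c, torsion (φ.Γ e x) a b c * δφ.lamT e x a b c

/-- The boundary term `Θ^a = 2 λ_{Rd}^{cab} δΓ^d_{bc}`. -/
def theta (lam : Ix4 n) (δΓ : Ix3 n) : Ix1 n := fun a =>
  ∑ d, ∑ c, ∑ b, 2 * lam d c a b * δΓ d b c

/-- The remaining boundary term `√(-g) P^{abc} δg_{bc}`, which only involves `δg`. -/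
def thetaMetric (P : Ix3 n) (δg : Ix2 n) : Ix1 n := fun a => ∑ b, ∑ c, P a b c * δg b c

/-- The Noether current `J = Θ(φ, L_V φ) - i_V L` of a vector field `V`, as a vector density; the
complete boundary term is used. -/
def Config.noetherCurrent (φ : Config n M) (f : Ix2 n → Ix3 n → ℝ) (e : Chart n M)
    (V : E n → Ix1 n) (x : E n) : Ix1 n := fun a =>
  theta (φ.lamR e x) (lieConnection V (φ.Γ e) x) a
    + thetaMetric (φ.conj f e x) (lieMetric V (φ.g e) x) a
    - V x a * φ.lagrangian f e x

/-- The transformation `λ_{Ra}^{bcd} → λ_{Ra}^{bcd} + ∇_e κ_a^{bcde} + κ_a^{bcd}`, which comes with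
`λ_{Ta}^{bc} → λ_{Ta}^{bc} + ∇_d κ_a^{bcd}` (on-shell form, zero torsion). -/
def Config.gauge (φ : Config n M) (κ4 : Comp n M (Ix5 n)) (κ3 : Comp n M (Ix4 n)) :
    Config n M where
  g := φ.g
  Γ := φ.Γ
  lamR e x a b c d := φ.lamR e x a b c d + divDensity4 (φ.Γ e) (κ4 e) x a b c d + κ3 e x a b c d
  lamT e x a b c := φ.lamT e x a b c + ∑ d, nablaDensity3 (φ.Γ e) (κ3 e) x d a b c d

/-- The variation `δμ^a = κ_d^{bcha} δR^d_{bch}` of `μ^a = κ_d^{bcha} R^d_{bch}` under `δΓ`. -/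
def deltaMu (κ4 : Ix5 n) (Γ δΓ : E n → Ix3 n) (x : E n) : Ix1 n := fun a =>
  ∑ d, ∑ b, ∑ c, ∑ h, κ4 d b c h a * linCurvature Γ δΓ x d b c h

end Theory

/-! ### Differential forms built from the antisymmetric symbol -/

section Forms

/-- The totally antisymmetric symbol `ε_{a_1 ... a_n}`, with `ε_{1 ... n} = 1`. -/
def eps (n : ℕ) : E n [⋀^Fin n]→L[ℝ] ℝ :=
  { (EuclideanSpace.basisFun (Fin n) ℝ).toBasis.det with
    cont := by
      have h : Continuous (fun v : Fin n → E n =>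
          ((EuclideanSpace.basisFun (Fin n) ℝ).toBasis.toMatrix v).det) := by
        refine Continuous.matrix_det (continuous_pi fun i => continuous_pi fun j => ?_)
        simp only [Module.Basis.toMatrix_apply, OrthonormalBasis.coe_toBasis_repr_apply,
          EuclideanSpace.basisFun_repr]
        fun_prop
      exact h }

variable {m : ℕ}

/-- The `(n-1)`-form `ε_{a a_2 ... a_n} J^a`, for `n = m + 2`. -/
def epsForm1 (J : Ix1 (m + 2)) : E (m + 2) [⋀^Fin (m + 1)]→L[ℝ] ℝ :=
  ∑ a, J a • (eps (m + 2)).curryLeft (basisVec a)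

/-- The `(n-2)`-form `ε_{ab a_3 ... a_n} X^{ab}`, for `n = m + 2`. -/
def epsForm2 (X : Ix2 (m + 2)) : E (m + 2) [⋀^Fin m]→L[ℝ] ℝ :=
  ∑ a, ∑ b, X a b • ((eps (m + 2)).curryLeft (basisVec a)).curryLeft (basisVec b)

end Forms

/-! ### Noether charge -/

section Charge

variable {m : ℕ} {M : Type*} [TopologicalSpace M]

variable (m M) in
/-- A linear first-order differential operator from vector fields to `(n-2)`-forms, `n = m + 2`,
`Q[V] = W_d V^d + B^c_d ∂_c V^d`, in every chart. -/
structure ChargeOperator where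
  W : Comp (m + 2) M (Fin (m + 2) → E (m + 2) [⋀^Fin m]→L[ℝ] ℝ)
  B : Comp (m + 2) M (Fin (m + 2) → Fin (m + 2) → E (m + 2) [⋀^Fin m]→L[ℝ] ℝ)

/-- The form `Q[V]` in the chart `e`. -/
def ChargeOperator.eval (Q : ChargeOperator m M) (e : Chart (m + 2) M)
    (V : E (m + 2) → Ix1 (m + 2)) (x : E (m + 2)) : E (m + 2) [⋀^Fin m]→L[ℝ] ℝ :=
  ∑ d, V x d • Q.W e x d + ∑ c, ∑ d, pd c (fun y => V y d) x • Q.B e x c d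

/-- `Q` is a Noether charge of the field configuration `φ`: a local `(n-2)`-form valued expression
`Q[V]` on `M` with `d Q[V] = J[V]` for all (local) vector fields `V`. -/
structure IsNoetherCharge [ChartedSpace (E (m + 2)) M] (f : Ix2 (m + 2) → Ix3 (m + 2) → ℝ)
    (φ : Config (m + 2) M) (Q : ChargeOperator m M) : Prop where
  smoothW : ∀ e ∈ atlas (E (m + 2)) M, ∀ d, ContDiffOn ℝ ∞ (fun x => Q.W e x d) e.target
  smoothB : ∀ e ∈ atlas (E (m + 2)) M, ∀ c d, ContDiffOn ℝ ∞ (fun x => Q.B e x c d) e.target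
  law : ∀ e ∈ atlas (E (m + 2)) M, ∀ e' ∈ atlas (E (m + 2)) M,
    ∀ V V' : E (m + 2) → Ix1 (m + 2),
      (∀ a, ContDiffOn ℝ ∞ (fun x => V x a) e.target) →
      (∀ a, ContDiffOn ℝ ∞ (fun x => V' x a) e'.target) →
      (∀ x ∈ overlap e e', ∀ A, V' (trans e e' x) A = ∑ a, jac e e' x A a * V x a) →
      ∀ x ∈ overlap e e',
        (Q.eval e' V' (trans e e' x)).compContinuousLinearMap (fderiv ℝ (trans e e') x) =
          Q.eval e V x
  extDeriv_eq : ∀ e ∈ atlas (E (m + 2)) M, ∀ V : E (m + 2) → Ix1 (m + 2),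
    (∀ a, ContDiffOn ℝ ∞ (fun x => V x a) e.target) → ∀ x ∈ e.target,
      extDeriv (Q.eval e V) x = epsForm1 (φ.noetherCurrent f e V x)

end Charge

/-! ### Closed surfaces of codimension two, integration, entropy -/

section Surface

/-- A closed embedded surface `Σ` of codimension two in `M`, together with what is needed to write
integrals over it: finitely many charts of the (compact, oriented) manifold `N`, charts of `M`
around the corresponding pieces, and a subordinate smooth partition of unity. -/
structure ClosedSurface (m : ℕ) (M N : Type*)
    [TopologicalSpace M] [ChartedSpace (E (m + 2)) M]
    [TopologicalSpace N] [ChartedSpace (E m) N] where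
  ι : N → M
  smooth : ContMDiff (𝓡 m) (𝓡 (m + 2)) ∞ ι
  injective : Function.Injective ι
  immersion : ∀ p, Function.Injective (mfderiv (𝓡 m) (𝓡 (m + 2)) ι p)
  k : ℕ
  chartN : Fin k → OpenPartialHomeomorph N (E m)
  chartN_mem : ∀ i, chartN i ∈ atlas (E m) N
  chartM : Fin k → OpenPartialHomeomorph M (E (m + 2))
  chartM_mem : ∀ i, chartM i ∈ atlas (E (m + 2)) M
  ρ : Fin k → N → ℝ
  ρ_smooth : ∀ i, ContMDiff (𝓡 m) 𝓘(ℝ) ∞ (ρ i)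
  ρ_nonneg : ∀ i p, 0 ≤ ρ i p
  ρ_supp : ∀ i, tsupport (ρ i) ⊆ (chartN i).source ∩ ι ⁻¹' (chartM i).source
  ρ_sum : ∀ p, ∑ i, ρ i p = 1

variable {m : ℕ} {M N : Type*} [TopologicalSpace M] [ChartedSpace (E (m + 2)) M]
  [TopologicalSpace N] [ChartedSpace (E m) N]

/-- The embedding in a chart `c` of `N` and a chart `e` of `M`. -/
def ClosedSurface.param (S : ClosedSurface m M N) (c : OpenPartialHomeomorph N (E m))
    (e : Chart (m + 2) M) (y : E m) : E (m + 2) := e (S.ι (c.symm y))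

/-- The tangent vector `∂_k` of the surface at the point with coordinates `y`. -/
def ClosedSurface.tangent (S : ClosedSurface m M N) (c : OpenPartialHomeomorph N (E m))
    (e : Chart (m + 2) M) (y : E m) (k : Fin m) : E (m + 2) :=
  fderiv ℝ (S.param c e) y (basisVec k)

/-- The integral over the surface of (the pullback of) an `(n-2)`-form given along the surface. -/
def ClosedSurface.integral (S : ClosedSurface m M N)
    (α : Chart (m + 2) M → N → E (m + 2) [⋀^Fin m]→L[ℝ] ℝ) : ℝ :=
  ∑ i, ∫ y in (S.chartN i).target,
    S.ρ i ((S.chartN i).symm y) *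
      α (S.chartM i) ((S.chartN i).symm y) (S.tangent (S.chartN i) (S.chartM i) y)

/-- `b e p a b` are the components of the binormal `b_{ab}` of the surface: a `2`-form along the
surface that is normal to it and satisfies `b_{ab} b^{ab} = -2`. -/
structure IsBinormal (S : ClosedSurface m M N) (g : Comp (m + 2) M (Ix2 (m + 2)))
    (b : Chart (m + 2) M → N → Ix2 (m + 2)) : Prop where
  law : ∀ e ∈ atlas (E (m + 2)) M, ∀ e' ∈ atlas (E (m + 2)) M,
    ∀ p, S.ι p ∈ e.source → S.ι p ∈ e'.source → ∀ c d,
      b e p c d = ∑ C, ∑ D, jac e e' (e (S.ι p)) C c * jac e e' (e (S.ι p)) D d * b e' p C D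
  antisymm : ∀ e ∈ atlas (E (m + 2)) M, ∀ p, S.ι p ∈ e.source → ∀ c d, b e p c d = -b e p d c
  normal : ∀ e ∈ atlas (E (m + 2)) M, ∀ c ∈ atlas (E m) N,
    ∀ p ∈ c.source, S.ι p ∈ e.source → ∀ a k, ∑ d, b e p a d * S.tangent c e (c p) k d = 0
  normalized : ∀ e ∈ atlas (E (m + 2)) M, ∀ p, S.ι p ∈ e.source →
    ∑ a, ∑ c, ∑ d, ∑ h, invMetric (g e (e (S.ι p))) a c * invMetric (g e (e (S.ι p))) d h *
      b e p a d * b e p c h = -2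

/-- `V` is a Killing vector field that vanishes on the surface, `b` is the binormal of the
surface, and `κ ≠ 0` is the surface gravity, `κ = -(1/2) b^{cd} ∇_c V_d` on the surface. (As `V`
vanishes there, `∇_c V^d` is the same for all connections.) -/
structure IsBifurcationSurface (S : ClosedSurface m M N) (φ : Config (m + 2) M)
    (V : Comp (m + 2) M (Ix1 (m + 2))) (b : Chart (m + 2) M → N → Ix2 (m + 2)) (κ : ℝ) :
    Prop where
  vectorField : IsVectorField V
  killing : ∀ e ∈ atlas (E (m + 2)) M, ∀ x ∈ e.target, lieMetric (V e) (φ.g e) x = 0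
  vanish : ∀ e ∈ atlas (E (m + 2)) M, ∀ p, S.ι p ∈ e.source → V e (e (S.ι p)) = 0
  binormal : IsBinormal S φ.g b
  surfaceGravity : ∀ e ∈ atlas (E (m + 2)) M, ∀ p, S.ι p ∈ e.source →
    ∑ a, ∑ c, ∑ d, invMetric (φ.g e (e (S.ι p))) a c * b e p a d *
      nablaVec (φ.Γ e) (V e) (e (S.ι p)) c d = -2 * κ
  ne_zero : κ ≠ 0

/-- The `(n-2)`-form `X^{cd} b_{cd}` along the surface, where
`(X^{cd})_{a_3 ... a_n} = ε_{ab a_3 ... a_n} λ_R^{dcab}`. -/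
def entropyForm (S : ClosedSurface m M N) (φ : Config (m + 2) M)
    (b : Chart (m + 2) M → N → Ix2 (m + 2)) (e : Chart (m + 2) M) (p : N) :
    E (m + 2) [⋀^Fin m]→L[ℝ] ℝ :=
  ∑ c, ∑ d, b e p c d •
    epsForm2 (fun a b => ∑ h, invMetric (φ.g e (e (S.ι p))) d h * φ.lamR e (e (S.ι p)) h c a b)

/-- The entropy `S = 2π ∫_Σ X^{cd} b_{cd}`. -/
def entropy (S : ClosedSurface m M N) (φ : Config (m + 2) M)
    (b : Chart (m + 2) M → N → Ix2 (m + 2)) : ℝ :=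
  2 * Real.pi * S.integral (entropyForm S φ b)

/-- The `(n-2)`-form `Y = ε_{ab a_3 ... a_n} κ_d^{caeb} δΓ^d_{ec}`, linear in `δΓ`. -/
def yForm (κ4 : Ix5 (m + 2)) (δΓ : Ix3 (m + 2)) : E (m + 2) [⋀^Fin m]→L[ℝ] ℝ :=
  epsForm2 (fun a b => ∑ d, ∑ c, ∑ h, κ4 d c a h b * δΓ d h c)

end Surface

end STG

end

open STG

open scoped Manifold ContDiff BigOperators

noncomputable section

namespace STG

/-! ### Partial derivatives -/

section PartialDerivatives

variable {n : ℕ} {F G : E n → ℝ} {x : E n} {U : Set (E n)}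

/-! The multiplier sector is a gauge theory in disguise. Put `Γ^a_{dc}` into matrices `A_d`; then
the curvature is the field strength of `A`, `δR_{cd} = D_c δA_d - D_d δA_c` with `D = ∂ + [A, ·]`,
and `λ_R^{cd}` is a matrix-valued antisymmetric density. For antisymmetric densities a torsion-free
connection drops out of the divergence indices, so only `D` survives, with two rules: `∂ tr(XY) =
tr(DX Y) + tr(X DY)`, and commuting `D`'s when `R = 0`.

Boundary term: the Leibniz rule gives `∂_a Θ^a = λ_R δR + 2 tr(D_d λ_R^{db} δA_b)` (`div_theta`),
and the analogous computation for `P δQ` is `div_thetaMetric`.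

Noether charge: for a flat torsion-free connection `L_V Γ = D(∇V)` (`lieConnection_eq`). Integrating
by parts with the connection equation writes `J^a` as `2 ∂_b X^{ab}`, `X^{ab} = tr(λ_R^{ab} ∇V) +
λ_{Td}^{ab} V^d`, plus a remainder algebraic in `V`. The remainder vanishes because the divergence
of the connection equation and the metric equation turn it into the identity expressing that `√(-g)
f` is a density under linear frame changes (`infinitesimal_invariance`, `noetherCurrent_eq`).

Entropy: a charge operator is tested on vector fields vanishing to second order at a point. This
fixes its first-order part enough to determine the charge pointwise along a surface where `V = 0`
(`IsNoetherCharge.eval_eq`), whichever charge is chosen. There the Killing equation makes `∇_c V_d`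
a two-form annihilating the tangent space; such forms are a line, so it equals `κ b_{cd}`
(`IsBifurcationSurface.nablaMat_eq`).

Invariance: `D D κ4 = 0` by flatness, the two `κ3` shifts cancel, and the linearized Bianchi
identities handle the Lagrangian. Writing `tr(D_c κ4^{abc} ∇V)` as a divergence minus `tr(κ4^{abc}
D_c ∇V)` changes the entropy integrand by `Y(L_V Γ)` plus an exact form. Stokes' theorem removes the
latter, and the `κ3` term is proportional to `b ∧ b`, which vanishes because a normal two-form in
codimension two is simple. -/

theorem pd_add (a : Fin n) (hF : DifferentiableAt ℝ F x) (hG : DifferentiableAt ℝ G x) :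
    pd a (fun y => F y + G y) x = pd a F x + pd a G x := by
  simp [pd, fderiv_fun_add hF hG]

theorem pd_sub (a : Fin n) (hF : DifferentiableAt ℝ F x) (hG : DifferentiableAt ℝ G x) :
    pd a (fun y => F y - G y) x = pd a F x - pd a G x := by
  simp [pd, fderiv_fun_sub hF hG]

theorem pd_neg (a : Fin n) : pd a (fun y => -F y) x = -pd a F x := by
  simp [pd, fderiv_fun_neg]

theorem pd_mul (a : Fin n) (hF : DifferentiableAt ℝ F x) (hG : DifferentiableAt ℝ G x) :
    pd a (fun y => F y * G y) x = pd a F x * G x + F x * pd a G x := by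
  simp [pd, fderiv_fun_mul hF hG]; ring

theorem pd_const (a : Fin n) (r : ℝ) : pd a (fun _ => r) x = 0 := by
  simp [pd]

theorem pd_const_mul (a : Fin n) (r : ℝ) (hF : DifferentiableAt ℝ F x) :
    pd a (fun y => r * F y) x = r * pd a F x := by
  rw [pd_mul a (differentiableAt_const r) hF, pd_const]; ring

theorem pd_sum {ι : Type*} (s : Finset ι) (a : Fin n) {H : ι → E n → ℝ}
    (hH : ∀ i ∈ s, DifferentiableAt ℝ (H i) x) :
    pd a (fun y => ∑ i ∈ s, H i y) x = ∑ i ∈ s, pd a (H i) x := by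
  simp [pd, fderiv_fun_sum hH]

theorem pd_congr (hU : IsOpen U) (hx : x ∈ U) (a : Fin n) (h : ∀ y ∈ U, F y = G y) :
    pd a F x = pd a G x := by
  have : F =ᶠ[nhds x] G := Filter.eventuallyEq_of_mem (hU.mem_nhds hx) h
  rw [pd, pd, this.fderiv_eq]

theorem differentiableAt_of_contDiffOn {W : Type*} [NormedAddCommGroup W] [NormedSpace ℝ W]
    {V : Type*} [NormedAddCommGroup V] [NormedSpace ℝ V] {U : Set V} {H : V → W} {x : V}
    (hU : IsOpen U) (hx : x ∈ U) (hH : ContDiffOn ℝ ∞ H U) : DifferentiableAt ℝ H x :=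
  (hH.contDiffAt (hU.mem_nhds hx)).differentiableAt (by simp)

theorem contDiffOn_pd (hU : IsOpen U) (hF : ContDiffOn ℝ ∞ F U) (a : Fin n) :
    ContDiffOn ℝ ∞ (fun x => pd a F x) U :=
  (hF.fderiv_of_isOpen hU (by simp)).clm_apply contDiffOn_const

theorem pd_comm (hU : IsOpen U) (hF : ContDiffOn ℝ ∞ F U) (hx : x ∈ U) (a b : Fin n) :
    pd a (fun y => pd b F y) x = pd b (fun y => pd a F y) x := by
  have h2 : ContDiffAt ℝ ∞ F x := hF.contDiffAt (hU.mem_nhds hx)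
  have hs : IsSymmSndFDerivAt ℝ F x := h2.isSymmSndFDerivAt (by
    simpa using ENat.LEInfty.out)
  have hd : DifferentiableAt ℝ (fderiv ℝ F) x :=
    (h2.fderiv_right (m := ∞) (by simp)).differentiableAt (by simp)
  have key : ∀ a b : Fin n,
      pd a (fun y => pd b F y) x = fderiv ℝ (fderiv ℝ F) x (basisVec a) (basisVec b) := by
    intro a b
    simp only [pd]
    rw [fderiv_clm_apply hd (differentiableAt_const _)]
    simp
  rw [key, key, hs.eq]

theorem fderiv_apply_eq_sum_pd (v : E n) : fderiv ℝ F x v = ∑ a, v a * pd a F x := by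
  have hv : v = ∑ a, v a • (basisVec a : E n) := by
    ext i
    simp [Pi.single_apply]
  conv_lhs => rw [hv]
  simp [pd]

end PartialDerivatives

/-! ### Matrix-valued fields and the covariant derivative of endomorphisms -/

section MatrixFields

variable {n : ℕ} {U : Set (E n)} {x : E n}

/-- Square matrices of size `n`. -/
abbrev Mat (n : ℕ) := Matrix (Fin n) (Fin n) ℝ

/-- Smoothness of a matrix-valued function, entry by entry. -/
def MSmooth (U : Set (E n)) (X : E n → Mat n) : Prop :=
  ∀ i j, ContDiffOn ℝ ∞ (fun y => X y i j) U

/-- Entrywise partial derivative of a matrix-valued function. -/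
def pdM (d : Fin n) (X : E n → Mat n) (x : E n) : Mat n :=
  Matrix.of fun i j => pd d (fun y => X y i j) x

@[simp] theorem pdM_apply (d : Fin n) (X : E n → Mat n) (x : E n) (i j : Fin n) :
    pdM d X x i j = pd d (fun y => X y i j) x := rfl

variable {X Y : E n → Mat n}

theorem MSmooth.diff (hX : MSmooth U X) (hU : IsOpen U) (hx : x ∈ U) (i j : Fin n) :
    DifferentiableAt ℝ (fun y => X y i j) x :=
  differentiableAt_of_contDiffOn hU hx (hX i j)

theorem MSmooth.add (hX : MSmooth U X) (hY : MSmooth U Y) : MSmooth U (fun y => X y + Y y) :=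
  fun i j => (hX i j).add (hY i j)

theorem MSmooth.sub (hX : MSmooth U X) (hY : MSmooth U Y) : MSmooth U (fun y => X y - Y y) :=
  fun i j => (hX i j).sub (hY i j)

theorem MSmooth.mul (hX : MSmooth U X) (hY : MSmooth U Y) : MSmooth U (fun y => X y * Y y) := by
  intro i j
  simp only [Matrix.mul_apply]
  exact ContDiffOn.sum fun k _ => (hX i k).mul (hY k j)

theorem MSmooth.sum {ι : Type*} (s : Finset ι) {H : ι → E n → Mat n}
    (hH : ∀ i ∈ s, MSmooth U (H i)) : MSmooth U (fun y => ∑ i ∈ s, H i y) := by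
  intro i j
  simp only [Matrix.sum_apply]
  exact ContDiffOn.sum fun k hk => hH k hk i j

theorem MSmooth.pdM (hX : MSmooth U X) (hU : IsOpen U) (d : Fin n) :
    MSmooth U (fun y => pdM d X y) :=
  fun i j => contDiffOn_pd hU (hX i j) d

theorem MSmooth.trace (hX : MSmooth U X) : ContDiffOn ℝ ∞ (fun y => (X y).trace) U := by
  simp only [Matrix.trace, Matrix.diag]
  exact ContDiffOn.sum fun k _ => hX k k

theorem pdM_add (hU : IsOpen U) (hx : x ∈ U) (hX : MSmooth U X) (hY : MSmooth U Y) (d : Fin n) :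
    pdM d (fun y => X y + Y y) x = pdM d X x + pdM d Y x := by
  ext i j
  exact pd_add d (hX.diff hU hx i j) (hY.diff hU hx i j)

theorem pdM_sub (hU : IsOpen U) (hx : x ∈ U) (hX : MSmooth U X) (hY : MSmooth U Y) (d : Fin n) :
    pdM d (fun y => X y - Y y) x = pdM d X x - pdM d Y x := by
  ext i j
  exact pd_sub d (hX.diff hU hx i j) (hY.diff hU hx i j)

theorem pdM_neg (d : Fin n) : pdM d (fun y => -X y) x = -pdM d X x := by
  ext i j
  exact pd_neg d

theorem pdM_sum (hU : IsOpen U) (hx : x ∈ U) {ι : Type*} (s : Finset ι) {H : ι → E n → Mat n}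
    (hH : ∀ i ∈ s, MSmooth U (H i)) (d : Fin n) :
    pdM d (fun y => ∑ i ∈ s, H i y) x = ∑ i ∈ s, pdM d (H i) x := by
  ext i j
  simp only [pdM_apply, Matrix.sum_apply]
  exact pd_sum s d fun k hk => (hH k hk).diff hU hx i j

theorem pdM_mul (hU : IsOpen U) (hx : x ∈ U) (hX : MSmooth U X) (hY : MSmooth U Y) (d : Fin n) :
    pdM d (fun y => X y * Y y) x = pdM d X x * Y x + X x * pdM d Y x := by
  ext i j
  simp only [pdM_apply, Matrix.mul_apply, Matrix.add_apply, ← Finset.sum_add_distrib]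
  refine (pd_sum (H := fun k y => X y i k * Y y k j) _ _ fun k _ =>
    (hX.diff hU hx i k).mul (hY.diff hU hx k j)).trans ?_
  exact Finset.sum_congr rfl fun k _ => pd_mul d (hX.diff hU hx i k) (hY.diff hU hx k j)

theorem pdM_comm (hU : IsOpen U) (hx : x ∈ U) (hX : MSmooth U X) (c d : Fin n) :
    pdM c (fun y => pdM d X y) x = pdM d (fun y => pdM c X y) x := by
  ext i j
  exact pd_comm hU (hX i j) hx c d

theorem pdM_congr (hU : IsOpen U) (hx : x ∈ U) (d : Fin n) (h : ∀ y ∈ U, X y = Y y) :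
    pdM d X x = pdM d Y x := by
  ext i j
  exact pd_congr hU hx d fun y hy => by rw [h y hy]

/-- The covariant derivative `∂_d X + [A_d, X]` of an endomorphism-valued function. -/
def covD (A : Fin n → E n → Mat n) (d : Fin n) (X : E n → Mat n) (x : E n) : Mat n :=
  pdM d X x + A d x * X x - X x * A d x

/-- The field strength `∂_c A_d - ∂_d A_c + [A_c, A_d]`. -/
def fieldStrength (A : Fin n → E n → Mat n) (c d : Fin n) (x : E n) : Mat n :=
  pdM c (A d) x - pdM d (A c) x + A c x * A d x - A d x * A c x

variable {A : Fin n → E n → Mat n}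

theorem MSmooth.covD (hU : IsOpen U) (hA : ∀ d, MSmooth U (A d)) (hX : MSmooth U X) (d : Fin n) :
    MSmooth U (fun y => covD A d X y) :=
  ((hX.pdM hU d).add ((hA d).mul hX)).sub (hX.mul (hA d))

theorem covD_congr (hU : IsOpen U) (hx : x ∈ U) (d : Fin n) (h : ∀ y ∈ U, X y = Y y) :
    covD A d X x = covD A d Y x := by
  rw [covD, covD, pdM_congr hU hx d h, h x hx]

theorem covD_add (hU : IsOpen U) (hx : x ∈ U) (hX : MSmooth U X) (hY : MSmooth U Y) (d : Fin n) :
    covD A d (fun y => X y + Y y) x = covD A d X x + covD A d Y x := by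
  simp only [covD, pdM_add hU hx hX hY]
  noncomm_ring

theorem covD_neg (d : Fin n) : covD A d (fun y => -X y) x = -covD A d X x := by
  simp only [covD, pdM_neg]
  noncomm_ring

theorem covD_sum (hU : IsOpen U) (hx : x ∈ U) {ι : Type*} (s : Finset ι) {H : ι → E n → Mat n}
    (hH : ∀ i ∈ s, MSmooth U (H i)) (d : Fin n) :
    covD A d (fun y => ∑ i ∈ s, H i y) x = ∑ i ∈ s, covD A d (H i) x := by
  simp only [covD, pdM_sum hU hx s hH, Finset.mul_sum, Finset.sum_mul, ← Finset.sum_add_distrib,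
    ← Finset.sum_sub_distrib]

/-- The second partial derivatives cancel by symmetry and the rest is noncommutative algebra. There
is no correction for the index of the outer derivative, so no torsion term appears and flatness
alone makes the derivatives commute. -/
theorem covD_commutator (hU : IsOpen U) (hx : x ∈ U) (hA : ∀ d, MSmooth U (A d))
    (hX : MSmooth U X) (c d : Fin n) :
    covD A c (fun y => covD A d X y) x - covD A d (fun y => covD A c X y) x =
      fieldStrength A c d x * X x - X x * fieldStrength A c d x := by
  have h : ∀ c d, pdM c (fun y => covD A d X y) x =
      pdM c (fun y => pdM d X y) x + (pdM c (A d) x * X x + A d x * pdM c X x)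
        - (pdM c X x * A d x + X x * pdM c (A d) x) := by
    intro c d
    simp only [covD]
    rw [pdM_sub hU hx ((hX.pdM hU d).add ((hA d).mul hX)) (hX.mul (hA d)),
      pdM_add hU hx (hX.pdM hU d) ((hA d).mul hX), pdM_mul hU hx (hA d) hX,
      pdM_mul hU hx hX (hA d)]
  have h' : ∀ c d, covD A c (fun y => covD A d X y) x =
      pdM c (fun y => covD A d X y) x + A c x * covD A d X x - covD A d X x * A c x :=
    fun _ _ => rfl
  rw [h', h', h, h, pdM_comm hU hx hX c d]
  simp only [covD, fieldStrength]
  noncomm_ring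

theorem covD_comm (hU : IsOpen U) (hx : x ∈ U) (hA : ∀ d, MSmooth U (A d))
    (hX : MSmooth U X) (c d : Fin n) (hF : fieldStrength A c d x = 0) :
    covD A c (fun y => covD A d X y) x = covD A d (fun y => covD A c X y) x := by
  have := covD_commutator hU hx hA hX c d
  rw [hF, zero_mul, mul_zero, sub_zero] at this
  exact sub_eq_zero.mp this

theorem pd_trace (hU : IsOpen U) (hx : x ∈ U) (hX : MSmooth U X) (d : Fin n) :
    pd d (fun y => (X y).trace) x = (pdM d X x).trace := by
  simp only [Matrix.trace, Matrix.diag]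
  exact pd_sum _ _ fun k _ => hX.diff hU hx k k

/-- The commutator terms cancel by cyclicity of the trace. This is the integration by parts used
throughout; it holds for arbitrary `A`. -/
theorem pd_trace_mul (hU : IsOpen U) (hx : x ∈ U) (hX : MSmooth U X) (hY : MSmooth U Y)
    (d : Fin n) :
    pd d (fun y => (X y * Y y).trace) x =
      (covD A d X x * Y x).trace + (X x * covD A d Y x).trace := by
  rw [pd_trace hU hx (hX.mul hY), pdM_mul hU hx hX hY]
  simp only [covD, add_mul, sub_mul, mul_add, mul_sub, Matrix.trace_add, Matrix.trace_sub,
    ← mul_assoc]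
  rw [Matrix.trace_mul_comm (X x * Y x) (A d x), ← mul_assoc]
  ring

/-- A double sum of an expression that is antisymmetric in its indices vanishes. -/
theorem sum_sum_eq_zero_of_antisymm {ι W : Type*} [Fintype ι] [AddCommGroup W] [Module ℝ W]
    {H : ι → ι → W} (h : ∀ i j, H i j = -H j i) : ∑ i, ∑ j, H i j = 0 := by
  have h1 : ∑ i, ∑ j, H i j = -∑ i, ∑ j, H i j := by
    conv_lhs => rw [Finset.sum_comm]
    simp only [← Finset.sum_neg_distrib]
    exact Finset.sum_congr rfl fun i _ => Finset.sum_congr rfl fun j _ => h j i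
  have h2 : (2 : ℝ) • ∑ i, ∑ j, H i j = 0 := by
    rw [two_smul]; nth_rewrite 1 [h1]; exact neg_add_cancel _
  exact (smul_eq_zero.mp h2).resolve_left two_ne_zero

end MatrixFields

/-! ### The geometry of a connection in matrix notation -/

section Geometry

variable {n : ℕ} {U : Set (E n)} {x : E n}

/-- The matrices `(A_d)^a_c = Γ^a_{dc}` of a connection or of a variation of a connection. -/
def connMat (Γ : E n → Ix3 n) (d : Fin n) (y : E n) : Mat n := Matrix.of fun a c => Γ y a d c

/-- The matrices with upper row index and lower column index of a density `D_a^{bcd}`. -/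
def densMat3 (D : E n → Ix4 n) (c d : Fin n) (y : E n) : Mat n := Matrix.of fun b a => D y a b c d

/-- The matrices with upper row index and lower column index of a density `D_a^{bcdf}`. -/
def densMat4 (D : E n → Ix5 n) (c d f : Fin n) (y : E n) : Mat n :=
  Matrix.of fun b a => D y a b c d f

/-- The matrices with upper row index and lower column index of a density `D_a^{bc}`. -/
def densMat2 (D : E n → Ix3 n) (b : Fin n) (y : E n) : Mat n := Matrix.of fun c a => D y a b c

/-- The matrix `N^a_c = ∇_c V^a`. -/
def nablaMat (Γ : E n → Ix3 n) (V : E n → Ix1 n) (y : E n) : Mat n :=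
  Matrix.of fun a c => nablaVec Γ V y c a

theorem fieldStrength_connMat (Γ : E n → Ix3 n) (x : E n) (a b c d : Fin n) :
    fieldStrength (connMat Γ) c d x a b = curvature Γ x a b c d := by
  simp only [fieldStrength, Matrix.sub_apply, Matrix.add_apply, Matrix.mul_apply, pdM_apply,
    connMat, Matrix.of_apply, curvature, Finset.sum_sub_distrib]
  ring

theorem fieldStrength_eq_zero {Γ : E n → Ix3 n} (h : curvature Γ x = 0) (c d : Fin n) :
    fieldStrength (connMat Γ) c d x = 0 := by
  ext a b
  rw [fieldStrength_connMat, h]; rfl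

theorem linCurvature_eq (Γ γ : E n → Ix3 n) (x : E n) (a b c d : Fin n) :
    linCurvature Γ γ x a b c d =
      (covD (connMat Γ) c (connMat γ d) x - covD (connMat Γ) d (connMat γ c) x) a b := by
  simp only [covD, Matrix.sub_apply, Matrix.add_apply, Matrix.mul_apply, pdM_apply,
    connMat, Matrix.of_apply, linCurvature, Finset.sum_sub_distrib, Finset.sum_add_distrib]
  ring

/-- Symmetric connection coefficients vanish against the two remaining antisymmetric upper indices,
and the term of the contracted index cancels the weight term. Only the endomorphism indices `a`, `b`
still feel the connection. -/
theorem divDensity4_eq {Γ : E n → Ix3 n} {κ : E n → Ix5 n} (hT : torsion (Γ x) = 0)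
    (h1 : ∀ a b c d f, κ x a b c d f = -κ x a b d c f)
    (h2 : ∀ a b c d f, κ x a b c d f = -κ x a b c f d) (a b c d : Fin n) :
    divDensity4 Γ κ x a b c d =
      (∑ f, covD (connMat Γ) f (densMat4 κ c d f) x) b a := by
  have hΓ : ∀ a b c, Γ x a b c = Γ x a c b := fun a b c =>
    sub_eq_zero.mp (congrFun (congrFun (congrFun hT a) b) c)
  have e1 : ∑ f, ∑ h, Γ x c f h * κ x a b h d f = 0 :=
    sum_sum_eq_zero_of_antisymm fun i j => by
      rw [hΓ c i j, h1 a b j d i, h2 a b d j i, h1 a b d i j]; ring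
  have e2 : ∑ f, ∑ h, Γ x d f h * κ x a b c h f = 0 :=
    sum_sum_eq_zero_of_antisymm fun i j => by
      rw [hΓ d i j, h2 a b c j i]; ring
  have e3 : ∑ f, ∑ h, Γ x f f h * κ x a b c d h =
      ∑ f, ∑ h, Γ x h f h * κ x a b c d f := by
    rw [Finset.sum_comm]
    exact Finset.sum_congr rfl fun i _ => Finset.sum_congr rfl fun j _ => by rw [hΓ j j i]
  simp only [divDensity4, Matrix.sum_apply, covD, Matrix.sub_apply, Matrix.add_apply,
    Matrix.mul_apply, pdM_apply, connMat, densMat4, Matrix.of_apply, Finset.sum_sub_distrib,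
    Finset.sum_add_distrib, Finset.sum_mul, e1, e2, e3]
  simp only [mul_comm (Γ x _ _ a)]
  ring

/-- Torsion is allowed: the explicit torsion terms of the connection equation are exactly those that
remove the connection from the antisymmetric index pair and from the weight. -/
theorem div_nablaDensity3_eq {Γ : E n → Ix3 n} {D : E n → Ix4 n}
    (h2 : ∀ a b c d, D x a b c d = -D x a b d c) (a b c : Fin n) :
    2 * ∑ d, ((∑ h, torsion (Γ x) h h d) * D x a c d b - nablaDensity3 Γ D x d a c d b)
      + ∑ d, ∑ h, D x a c d h * torsion (Γ x) b d h =
      -2 * (∑ d, covD (connMat Γ) d (densMat3 D d b) x) c a := by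
  have e1 : 2 * ∑ d, ∑ h, Γ x b d h * D x a c d h = ∑ d, ∑ h, D x a c d h * torsion (Γ x) b d h := by
    have : ∑ d, ∑ h, (D x a c d h * torsion (Γ x) b d h - 2 * (Γ x b d h * D x a c d h)) = 0 :=
      sum_sum_eq_zero_of_antisymm fun i j => by
        rw [h2 a c j i]; simp only [torsion]; ring
    simp only [Finset.sum_sub_distrib, ← Finset.mul_sum] at this
    linarith
  have e3 : ∑ d, ∑ h, Γ x d d h * D x a c h b = ∑ d, ∑ h, Γ x h h d * D x a c d b :=
    Finset.sum_comm
  rw [← e1]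
  simp only [nablaDensity3, torsion, Matrix.sum_apply, covD, Matrix.sub_apply, Matrix.add_apply,
    Matrix.mul_apply, pdM_apply, connMat, densMat3, Matrix.of_apply, Finset.sum_sub_distrib,
    Finset.sum_add_distrib, Finset.sum_mul, sub_mul, e3]
  simp only [mul_comm (Γ x _ _ a)]
  ring

theorem sum_nablaDensity3_eq {Γ : E n → Ix3 n} {D : E n → Ix4 n} (hT : torsion (Γ x) = 0)
    (h2 : ∀ a b c d, D x a b c d = -D x a b d c) (a b c : Fin n) :
    ∑ d, nablaDensity3 Γ D x d a b c d = (∑ d, covD (connMat Γ) d (densMat3 D c d) x) b a := by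
  have hΓ : ∀ a b c, Γ x a b c = Γ x a c b := fun a b c =>
    sub_eq_zero.mp (congrFun (congrFun (congrFun hT a) b) c)
  have e1 : ∑ d, ∑ h, Γ x c d h * D x a b h d = 0 :=
    sum_sum_eq_zero_of_antisymm fun i j => by
      rw [hΓ c i j, h2 a b j i]; ring
  have e3 : ∑ d, ∑ h, Γ x d d h * D x a b c h = ∑ d, ∑ h, Γ x h d h * D x a b c d := by
    rw [Finset.sum_comm]
    exact Finset.sum_congr rfl fun i _ => Finset.sum_congr rfl fun j _ => by rw [hΓ j j i]
  simp only [nablaDensity3, Matrix.sum_apply, covD, Matrix.sub_apply, Matrix.add_apply,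
    Matrix.mul_apply, pdM_apply, connMat, densMat3, Matrix.of_apply, Finset.sum_sub_distrib,
    Finset.sum_add_distrib, Finset.sum_mul, e1, e3]
  simp only [mul_comm (Γ x _ _ a)]
  ring

/-- In general `L_V Γ` is `∇∇V` plus curvature and torsion terms. With both absent it is pure gauge,
the covariant derivative of the endomorphism `∇V`. -/
theorem lieConnection_eq {Γ : E n → Ix3 n} {V : E n → Ix1 n} (hU : IsOpen U) (hx : x ∈ U)
    (hΓs : ∀ a b c, ContDiffOn ℝ ∞ (fun y => Γ y a b c) U)
    (hV : ∀ a, ContDiffOn ℝ ∞ (fun y => V y a) U)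
    (hT : ∀ y ∈ U, torsion (Γ y) = 0) (hR : curvature Γ x = 0) (a b c : Fin n) :
    lieConnection V Γ x a b c = covD (connMat Γ) b (nablaMat Γ V) x a c := by
  have hΓ : ∀ y ∈ U, ∀ a b c, Γ y a b c = Γ y a c b := fun y hy a b c =>
    sub_eq_zero.mp (congrFun (congrFun (congrFun (hT y hy) a) b) c)
  have hd : ∀ a b c, DifferentiableAt ℝ (fun y => Γ y a b c) x := fun a b c =>
    differentiableAt_of_contDiffOn hU hx (hΓs a b c)
  have hdV : ∀ a, DifferentiableAt ℝ (fun y => V y a) x := fun a =>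
    differentiableAt_of_contDiffOn hU hx (hV a)
  have hN : pd b (fun y => nablaVec Γ V y c a) x =
      pd b (fun y => pd c (fun z => V z a) y) x
        + ∑ h, (pd b (fun y => Γ y a h c) x * V x h + Γ x a h c * pd b (fun y => V y h) x) := by
    rw [pd_congr (G := fun y => pd c (fun z => V z a) y + ∑ h, Γ y a h c * V y h) hU hx b,
      pd_add (G := fun y => ∑ h, Γ y a h c * V y h) _
        (differentiableAt_of_contDiffOn hU hx (contDiffOn_pd hU (hV a) c))
        (DifferentiableAt.fun_sum fun h _ => (hd a h c).mul (hdV h)),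
      pd_sum (H := fun h y => Γ y a h c * V y h) _ _ fun h _ => (hd a h c).mul (hdV h)]
    · congr 1
      exact Finset.sum_congr rfl fun h _ => pd_mul _ (hd a h c) (hdV h)
    · intro y hy
      simp only [nablaVec]
      congr 1
      exact Finset.sum_congr rfl fun h _ => by rw [hΓ y hy]
  -- Vanishing curvature trades the derivative of `Γ` along `V` for the derivative in the direction
  -- `b` that occurs in `D_b(∇V)`.
  have hcurv : ∀ h, pd h (fun y => Γ y a b c) x = pd b (fun y => Γ y a h c) x
      + ∑ k, (Γ x a b k * Γ x k h c - Γ x a h k * Γ x k b c) := by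
    intro h
    have := congrFun (congrFun (congrFun (congrFun hR a) c) b) h
    simp only [curvature, Pi.zero_apply] at this
    linarith
  simp only [covD, Matrix.sub_apply, Matrix.add_apply, pdM_apply, nablaMat, Matrix.of_apply, hN,
    Matrix.mul_apply, connMat, lieConnection, hcurv]
  have e1 : ∑ k, Γ x a b k * nablaVec Γ V x c k =
      ∑ k, Γ x a b k * pd c (fun y => V y k) x + ∑ h, ∑ k, V x h * (Γ x a b k * Γ x k h c) := by
    rw [Finset.sum_comm]
    simp only [nablaVec, mul_add, Finset.sum_add_distrib, Finset.mul_sum]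
    congr 1
    exact Finset.sum_congr rfl fun k _ => Finset.sum_congr rfl fun h _ => by
      rw [hΓ x hx k c h]; ring
  have e2 : ∑ k, nablaVec Γ V x k a * Γ x k b c =
      ∑ k, Γ x k b c * pd k (fun y => V y a) x + ∑ h, ∑ k, V x h * (Γ x a h k * Γ x k b c) := by
    rw [Finset.sum_comm]
    simp only [nablaVec, add_mul, Finset.sum_add_distrib, Finset.sum_mul]
    congr 1
    · exact Finset.sum_congr rfl fun k _ => by ring
    · exact Finset.sum_congr rfl fun k _ => Finset.sum_congr rfl fun h _ => by
        rw [hΓ x hx a k h]; ring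
  rw [e1, e2]
  simp only [Finset.sum_add_distrib, Finset.sum_sub_distrib, mul_add, mul_sub, Finset.mul_sum]
  simp only [mul_comm (V x _) (pd _ _ _)]
  ring

theorem msmooth_connMat {Γ : E n → Ix3 n}
    (hΓ : ∀ a b c, ContDiffOn ℝ ∞ (fun y => Γ y a b c) U) (d : Fin n) :
    MSmooth U (connMat Γ d) := fun a c => hΓ a d c

theorem contDiffOn_nablaVec {Γ : E n → Ix3 n} {V : E n → Ix1 n} (hU : IsOpen U)
    (hΓ : ∀ a b c, ContDiffOn ℝ ∞ (fun y => Γ y a b c) U)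
    (hV : ∀ a, ContDiffOn ℝ ∞ (fun y => V y a) U) (b a : Fin n) :
    ContDiffOn ℝ ∞ (fun y => nablaVec Γ V y b a) U :=
  (contDiffOn_pd hU (hV a) b).add (ContDiffOn.sum fun c _ => (hΓ a b c).mul (hV c))

theorem msmooth_nablaMat {Γ : E n → Ix3 n} {V : E n → Ix1 n} (hU : IsOpen U)
    (hΓ : ∀ a b c, ContDiffOn ℝ ∞ (fun y => Γ y a b c) U)
    (hV : ∀ a, ContDiffOn ℝ ∞ (fun y => V y a) U) : MSmooth U (nablaMat Γ V) :=
  fun a c => contDiffOn_nablaVec hU hΓ hV c a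

/-- The Lie derivative of a flat torsion-free connection does not change the curvature. -/
theorem linCurvature_lieConnection {Γ : E n → Ix3 n} {V : E n → Ix1 n} (hU : IsOpen U)
    (hx : x ∈ U) (hΓ : ∀ a b c, ContDiffOn ℝ ∞ (fun y => Γ y a b c) U)
    (hV : ∀ a, ContDiffOn ℝ ∞ (fun y => V y a) U)
    (hT : ∀ y ∈ U, torsion (Γ y) = 0) (hR : ∀ y ∈ U, curvature Γ y = 0) :
    linCurvature Γ (lieConnection V Γ) x = 0 := by
  have hN := msmooth_nablaMat hU hΓ hV
  have key : ∀ d, ∀ y ∈ U, connMat (lieConnection V Γ) d y =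
      covD (connMat Γ) d (nablaMat Γ V) y := by
    intro d y hy
    ext a c
    exact lieConnection_eq hU hy hΓ hV hT (hR y hy) a d c
  ext a b c d
  rw [linCurvature_eq, covD_congr hU hx c (key d), covD_congr hU hx d (key c),
    covD_comm hU hx (msmooth_connMat hΓ) hN c d (fieldStrength_eq_zero (hR x hx) c d), sub_self]
  rfl

end Geometry

/-! ### The Lagrangian function -/

section LagrangianFunction

variable {n : ℕ}

theorem IsLorentzian.det_neg [NeZero n] {g : Ix2 n} (h : IsLorentzian g) :
    (Matrix.of g).det < 0 := by
  obtain ⟨-, P, hP, hd⟩ := h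
  have h1 := congrArg Matrix.det hd
  rw [Matrix.det_mul, Matrix.det_mul, Matrix.det_transpose, Matrix.det_diagonal] at h1
  have h2 : ∏ i : Fin n, (if i.val = 0 then (-1 : ℝ) else 1) = -1 := by
    rw [Finset.prod_eq_single 0]
    · rw [if_pos (Fin.val_zero n)]
    · intro b _ hb
      rw [if_neg]
      exact fun h => hb (Fin.ext (h.trans (Fin.val_zero n).symm))
    · exact fun h => absurd (Finset.mem_univ _) h
  rw [h2] at h1
  have h3 : 0 < P.det ^ 2 := by positivity
  by_contra hc
  nlinarith [mul_nonneg h3.le (not_lt.mp hc)]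

theorem contDiff_det : ContDiff ℝ ∞ (fun g : Ix2 n => (Matrix.of g).det) := by
  simp only [Matrix.det_apply, Matrix.of_apply]
  refine ContDiff.sum fun σ _ => ContDiff.const_smul _ ?_
  refine contDiff_prod fun i _ => ?_
  exact (contDiff_apply ℝ ℝ i).comp (contDiff_apply ℝ (Fin n → ℝ) (σ i))

theorem symEval_of_symm (f : Ix2 n → Ix3 n → ℝ) {g : Ix2 n} {Q : Ix3 n}
    (hg : ∀ a b, g a b = g b a) (hQ : ∀ a b c, Q a b c = Q a c b) :
    symEval f (g, Q) = f g Q := by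
  unfold symEval
  congr 1
  · ext a b; simp only [hg b a]; ring
  · ext a b c; simp only [hQ a c b]; ring

theorem mainDensity_of_symm (f : Ix2 n → Ix3 n → ℝ) {g : Ix2 n} {Q : Ix3 n}
    (hg : ∀ a b, g a b = g b a) (hQ : ∀ a b c, Q a b c = Q a c b) :
    mainDensity f (g, Q) = sqrtNegDet g * f g Q :=
  symEval_of_symm _ hg hQ

theorem contDiffAt_mainDensity [NeZero n] {f : Ix2 n → Ix3 n → ℝ} (hf : IsScalarFunction f)
    {g : Ix2 n} {Q : Ix3 n} (hg : IsLorentzian g) (hQ : ∀ a b c, Q a b c = Q a c b) :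
    ContDiffAt ℝ ∞ (mainDensity f) (g, Q) := by
  refine ContDiffAt.mul ?_ (hf.smooth g Q hg hQ)
  have hs : ContDiff ℝ ∞ (fun p : Arg n => (fun a b => (p.1 a b + p.1 b a) / 2 : Ix2 n)) := by
    rw [contDiff_pi]; intro a; rw [contDiff_pi]; intro b
    have h : ∀ a b, ContDiff ℝ ∞ (fun p : Arg n => p.1 a b) := fun a b =>
      ((contDiff_apply ℝ ℝ b).comp (contDiff_apply ℝ (Fin n → ℝ) a)).comp contDiff_fst
    exact ((h a b).add (h b a)).div_const 2
  unfold sqrtNegDet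
  refine ContDiffAt.sqrt ((contDiff_det.comp hs).neg.contDiffAt) ?_
  have : (fun a b => (g a b + g b a) / 2 : Ix2 n) = g := by
    ext a b; rw [hg.1 b a]; ring
  simp only [this]
  linarith [hg.det_neg]

theorem fderiv_mainDensity_apply (f : Ix2 n → Ix3 n → ℝ) (p : Arg n) (h : Ix2 n) (q : Ix3 n) :
    fderiv ℝ (mainDensity f) p (h, q) =
      ∑ a, ∑ b, dMetric f p a b * h a b + ∑ a, ∑ b, ∑ c, dNonmet f p a b c * q a b c := by
  have hh : h = ∑ a, ∑ b, h a b • (Pi.single a (Pi.single b 1) : Ix2 n) := by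
    ext a b
    simp [Finset.sum_apply, Pi.single_apply, apply_ite, ite_apply]
  have hq : q = ∑ a, ∑ b, ∑ c, q a b c • (Pi.single a (Pi.single b (Pi.single c 1)) : Ix3 n) := by
    ext a b c
    simp [Finset.sum_apply, Pi.single_apply, apply_ite, ite_apply]
  have h1 : fderiv ℝ (mainDensity f) p (h, 0) = ∑ a, ∑ b, dMetric f p a b * h a b := by
    have : (fderiv ℝ (mainDensity f) p).comp (ContinuousLinearMap.inl ℝ (Ix2 n) (Ix3 n)) h =
        ∑ a, ∑ b, dMetric f p a b * h a b := by
      conv_lhs => rw [hh]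
      simp only [map_sum, map_smul, smul_eq_mul, dMetric, ContinuousLinearMap.comp_apply,
        ContinuousLinearMap.inl_apply]
      simp only [mul_comm]
    simpa using this
  have h2 : fderiv ℝ (mainDensity f) p (0, q) = ∑ a, ∑ b, ∑ c, dNonmet f p a b c * q a b c := by
    have : (fderiv ℝ (mainDensity f) p).comp (ContinuousLinearMap.inr ℝ (Ix2 n) (Ix3 n)) q =
        ∑ a, ∑ b, ∑ c, dNonmet f p a b c * q a b c := by
      conv_lhs => rw [hq]
      simp only [map_sum, map_smul, smul_eq_mul, dNonmet, ContinuousLinearMap.comp_apply,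
        ContinuousLinearMap.inr_apply]
      simp only [mul_comm]
    simpa using this
  rw [← h1, ← h2, ← map_add]
  simp

/-- Since `mainDensity` symmetrizes its arguments, directions with the same symmetric part have the
same derivative. The symmetry of the partial derivatives in `dMetric_symm` and `dNonmet_symm` comes
from this. -/
theorem fderiv_mainDensity_congr {f : Ix2 n → Ix3 n → ℝ} {p v v' : Arg n}
    (hd : DifferentiableAt ℝ (mainDensity f) p)
    (h : ∀ t : ℝ, mainDensity f (p + t • v) = mainDensity f (p + t • v')) :
    fderiv ℝ (mainDensity f) p v = fderiv ℝ (mainDensity f) p v' := by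
  rw [← hd.lineDeriv_eq_fderiv, ← hd.lineDeriv_eq_fderiv, lineDeriv, lineDeriv, funext h]

theorem dMetric_symm {f : Ix2 n → Ix3 n → ℝ} {p : Arg n}
    (hd : DifferentiableAt ℝ (mainDensity f) p) (a b : Fin n) :
    dMetric f p a b = dMetric f p b a := by
  refine fderiv_mainDensity_congr hd fun t => ?_
  unfold mainDensity symEval
  have : ∀ c d : Fin n, (Pi.single a (Pi.single b (1 : ℝ)) : Ix2 n) c d =
      (Pi.single b (Pi.single a (1 : ℝ)) : Ix2 n) d c := by
    intro c d
    by_cases h1 : c = a <;> by_cases h2 : d = b <;> simp [h1, h2]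
  simp only [Prod.fst_add, Prod.smul_fst, Pi.add_apply, Pi.smul_apply, Prod.snd_add,
    Prod.smul_snd, this, smul_eq_mul]
  congr 2
  · ext c d; ring_nf
  · ext c d; ring_nf

theorem dNonmet_symm {f : Ix2 n → Ix3 n → ℝ} {p : Arg n}
    (hd : DifferentiableAt ℝ (mainDensity f) p) (a b c : Fin n) :
    dNonmet f p a b c = dNonmet f p a c b := by
  refine fderiv_mainDensity_congr hd fun t => ?_
  unfold mainDensity symEval
  have : ∀ k d h : Fin n, (Pi.single a (Pi.single b (Pi.single c (1 : ℝ))) : Ix3 n) k d h =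
      (Pi.single a (Pi.single c (Pi.single b (1 : ℝ))) : Ix3 n) k h d := by
    intro k d h
    by_cases h0 : k = a <;> by_cases h1 : d = b <;> by_cases h2 : h = c <;>
      simp [h0, h1, h2]
  simp only [Prod.fst_add, Prod.smul_fst, Pi.add_apply, Pi.smul_apply, Prod.snd_add,
    Prod.smul_snd, this, smul_eq_mul]
  congr 2
  ext k d h; ring_nf

/-- The scalar `f` is unchanged, while `√(-g)` acquires `√(det A ^ 2) = det A`, the determinant
being positive. -/
theorem mainDensity_frame_change {f : Ix2 n → Ix3 n → ℝ} (hf : IsScalarFunction f)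
    {g : Ix2 n} {Q : Ix3 n} (hg : IsLorentzian g) (hQ : ∀ a b c, Q a b c = Q a c b)
    {A : Mat n} (hA : 0 < A.det) :
    mainDensity f (fun a b => ∑ c, ∑ d, A c a * A d b * g c d,
        fun a b c => ∑ d, ∑ h, ∑ k, A d a * A h b * A k c * Q d h k) =
      A.det * mainDensity f (g, Q) := by
  rw [mainDensity_of_symm, mainDensity_of_symm f hg.1 hQ, hf.invariant g Q hg hQ A hA]
  · have : Matrix.of (fun a b => ∑ c, ∑ d, A c a * A d b * g c d) =
        A.transpose * Matrix.of g * A := by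
      ext a b
      simp only [Matrix.of_apply, Matrix.mul_apply, Matrix.transpose_apply, Finset.sum_mul]
      rw [Finset.sum_comm]
      exact Finset.sum_congr rfl fun c _ => Finset.sum_congr rfl fun d _ => by ring
    rw [sqrtNegDet, this, Matrix.det_mul, Matrix.det_mul, Matrix.det_transpose, sqrtNegDet,
      show -(A.det * (Matrix.of g).det * A.det) = A.det ^ 2 * (-(Matrix.of g).det) by ring,
      Real.sqrt_mul (sq_nonneg _), Real.sqrt_sq hA.le]
    ring
  · intro a b
    rw [Finset.sum_comm]
    exact Finset.sum_congr rfl fun c _ => Finset.sum_congr rfl fun d _ => by rw [hg.1 d c]; ring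
  · intro a b c
    refine Finset.sum_congr rfl fun d _ => ?_
    rw [Finset.sum_comm]
    exact Finset.sum_congr rfl fun h _ => Finset.sum_congr rfl fun k _ => by rw [hQ d k h]; ring

/-- The identity that expresses the invariance of the Lagrangian function under infinitesimal
changes of frame. -/
theorem infinitesimal_invariance [NeZero n] {f : Ix2 n → Ix3 n → ℝ} (hf : IsScalarFunction f)
    {g : Ix2 n} {Q : Ix3 n} (hg : IsLorentzian g) (hQ : ∀ a b c, Q a b c = Q a c b)
    (a e : Fin n) :
    2 * ∑ c, dMetric f (g, Q) a c * g c e + ∑ b, ∑ c, dNonmet f (g, Q) a b c * Q e b c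
      + 2 * ∑ b, ∑ c, dNonmet f (g, Q) b a c * Q b c e =
      if a = e then mainDensity f (g, Q) else 0 := by
  have hd : DifferentiableAt ℝ (mainDensity f) (g, Q) :=
    (contDiffAt_mainDensity hf hg hQ).differentiableAt (by simp)
  -- The elementary frame changes `1 + t E_{ea}`. As rank-one perturbations they have determinant `1
  -- + t` on the diagonal and `1` off it, which produces the Kronecker delta on the right.
  let A : ℝ → Mat n := fun t => 1 + Matrix.vecMulVec (Pi.single e t) (Pi.single a 1)
  have hA : ∀ t c b, A t c b = (if c = b then 1 else 0) + t * (if c = e ∧ b = a then 1 else 0) := by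
    intro t c b
    simp only [A, Matrix.add_apply, Matrix.one_apply, Matrix.vecMulVec_apply, Pi.single_apply]
    by_cases h1 : c = e <;> by_cases h2 : b = a <;> simp [h1, h2]
  have hdet : ∀ t, (A t).det = 1 + t * (if a = e then 1 else 0) := by
    intro t
    simp only [A]
    rw [Matrix.vecMulVec_eq Unit, Matrix.det_one_add_replicateCol_mul_replicateRow]
    by_cases h : a = e
    · subst h; simp
    · simp [h, Ne.symm h]
  let q : ℝ → Arg n := fun t => (fun b c => ∑ d, ∑ h, A t d b * A t h c * g d h,
    fun b c k => ∑ d, ∑ h, ∑ l, A t d b * A t h c * A t l k * Q d h l)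
  have hA' : ∀ c b, HasDerivAt (fun t => A t c b) (if c = e ∧ b = a then 1 else 0) 0 := by
    intro c b
    simp only [hA]
    simpa using ((hasDerivAt_id (0 : ℝ)).mul_const (if c = e ∧ b = a then (1 : ℝ) else 0)).const_add
      (if c = b then (1 : ℝ) else 0)
  have hA0 : ∀ c b, A 0 c b = if c = b then 1 else 0 := by intro c b; simp [hA]
  have hq0 : q 0 = (g, Q) := by
    simp only [q, hA0]
    ext <;> simp
  have hq : HasDerivAt q (fun b c => (if b = a then g e c else 0) + (if c = a then g b e else 0),
      fun b c k => (if b = a then Q e c k else 0) + (if c = a then Q b e k else 0)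
        + (if k = a then Q b c e else 0)) 0 := by
    refine HasDerivAt.prodMk ?_ ?_
    · refine hasDerivAt_pi.2 fun b => hasDerivAt_pi.2 fun c => ?_
      refine (HasDerivAt.fun_sum fun d _ => HasDerivAt.fun_sum fun h _ =>
        ((hA' d b).mul (hA' h c)).mul_const (g d h)).congr_deriv ?_
      simp only [hA0, ite_and]
      simp [add_mul, Finset.sum_add_distrib, ite_mul]
    · refine hasDerivAt_pi.2 fun b => hasDerivAt_pi.2 fun c => hasDerivAt_pi.2 fun k => ?_
      refine (HasDerivAt.fun_sum fun d _ => HasDerivAt.fun_sum fun h _ => HasDerivAt.fun_sum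
        fun l _ => (((hA' d b).mul (hA' h c)).mul (hA' l k)).mul_const (Q d h l)).congr_deriv ?_
      simp only [hA0, ite_and]
      simp only [add_mul, Finset.sum_add_distrib, ite_mul, mul_ite, mul_one, mul_zero, one_mul,
        zero_mul, Finset.sum_ite_eq', Finset.mem_univ, if_true,
        Pi.mul_apply, hA0]
      by_cases hk : k = a <;> simp [hk]
  have h1 : HasDerivAt (fun t => mainDensity f (q t))
      ((if a = e then 1 else 0) * mainDensity f (g, Q)) 0 := by
    -- Invariance is assumed for positive determinant only, which holds for small `t` and suffices
    -- for the derivative at `0`.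
    have hev : ∀ᶠ t : ℝ in nhds 0, 0 < (A t).det := by
      have hc : Continuous fun t : ℝ => (A t).det := by simp only [hdet]; fun_prop
      exact (isOpen_lt continuous_const hc).mem_nhds (by simp [hdet])
    have h2 : HasDerivAt (fun t => (A t).det * mainDensity f (g, Q))
        ((if a = e then 1 else 0) * mainDensity f (g, Q)) 0 := by
      simp only [hdet]
      simpa using (((hasDerivAt_id (0 : ℝ)).mul_const (if a = e then (1 : ℝ) else 0)).const_add
        (1 : ℝ)).mul_const (mainDensity f (g, Q))
    refine h2.congr_of_eventuallyEq ?_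
    filter_upwards [hev] with t ht
    exact mainDensity_frame_change hf hg hQ ht
  have h2 : HasDerivAt (fun t => mainDensity f (q t)) _ 0 :=
    (hd.hasFDerivAt.comp_hasDerivAt_of_eq 0 hq hq0.symm)
  -- The same derivative computed by the chain rule and by the density law; the rest of the proof
  -- collects equal terms using the symmetries of `g`, `Q` and the partial derivatives.
  have h3 := h2.unique h1
  rw [fderiv_mainDensity_apply] at h3
  have hP := dNonmet_symm hd
  have hG := dMetric_symm hd
  have e1 : ∑ b, dMetric f (g, Q) b a * g b e = ∑ c, dMetric f (g, Q) a c * g c e :=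
    Finset.sum_congr rfl fun b _ => by rw [hG]
  have e2 : ∑ c, dMetric f (g, Q) a c * g e c = ∑ c, dMetric f (g, Q) a c * g c e :=
    Finset.sum_congr rfl fun b _ => by rw [hg.1]
  have e3 : ∑ b, ∑ c, dNonmet f (g, Q) b a c * Q b e c =
      ∑ b, ∑ c, dNonmet f (g, Q) b a c * Q b c e :=
    Finset.sum_congr rfl fun b _ => Finset.sum_congr rfl fun c _ => by rw [hQ]
  have e4 : ∑ b, ∑ c, dNonmet f (g, Q) b c a * Q b c e =
      ∑ b, ∑ c, dNonmet f (g, Q) b a c * Q b c e :=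
    Finset.sum_congr rfl fun b _ => Finset.sum_congr rfl fun c _ => by rw [hP]
  simp only [mul_add, Finset.sum_add_distrib, mul_ite, mul_zero, Finset.sum_ite_eq',
    Finset.mem_univ, if_true, ite_mul, one_mul, zero_mul] at h3
  have e5 : ∀ F : Fin n → Fin n → Fin n → ℝ, (∑ b, ∑ c, ∑ k, if b = a then F b c k else 0) =
      ∑ c, ∑ k, F a c k := by
    intro F
    rw [Finset.sum_eq_single a]
    · simp
    · intro b _ hb; simp [hb]
    · simp
  have e6 : ∀ F : Fin n → Fin n → Fin n → ℝ, (∑ b, ∑ c, ∑ k, if c = a then F b c k else 0) =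
      ∑ b, ∑ k, F b a k := by
    intro F
    refine Finset.sum_congr rfl fun b _ => ?_
    rw [Finset.sum_eq_single a]
    · simp
    · intro b _ hb; simp [hb]
    · simp
  have e7 : ∀ F : Fin n → Fin n → ℝ, (∑ b, ∑ c, if b = a then F b c else 0) = ∑ c, F a c := by
    intro F
    rw [Finset.sum_eq_single a]
    · simp
    · intro b _ hb; simp [hb]
    · simp
  rw [e5, e6, e7, e1, e2, e3, e4] at h3
  rw [← h3]; ring

end LagrangianFunction

/-! ### One-parameter families -/

section Families

variable {n : ℕ} {U : Set (E n)} {x : E n} {F : ℝ × E n → ℝ}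

theorem hasDerivAt_family (hU : IsOpen U) (hx : x ∈ U)
    (hF : ContDiffOn ℝ ∞ F (Set.univ ×ˢ U)) (s : ℝ) :
    HasDerivAt (fun s => F (s, x)) (fderiv ℝ F (s, x) (1, 0)) s := by
  have h := (differentiableAt_of_contDiffOn (x := (s, x)) (isOpen_univ.prod hU)
    ⟨Set.mem_univ s, hx⟩ hF).hasFDerivAt
  exact h.comp_hasDerivAt s ((hasDerivAt_id s).prodMk (hasDerivAt_const s x))

theorem hasDerivAt_family_zero (hU : IsOpen U) (hx : x ∈ U)
    (hF : ContDiffOn ℝ ∞ F (Set.univ ×ˢ U)) :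
    HasDerivAt (fun s => F (s, x)) (deriv (fun s => F (s, x)) 0) 0 :=
  (hasDerivAt_family hU hx hF 0).differentiableAt.hasDerivAt

theorem contDiffOn_variation (hU : IsOpen U) (hF : ContDiffOn ℝ ∞ F (Set.univ ×ˢ U)) :
    ContDiffOn ℝ ∞ (fun y => deriv (fun s => F (s, y)) 0) U := by
  have h1 : ContDiffOn ℝ ∞ (fun y => fderiv ℝ F (0, y) (1, 0)) U :=
    ((hF.fderiv_of_isOpen (m := ∞) (isOpen_univ.prod hU) (by simp)).comp
      (contDiff_prodMk_right (0 : ℝ)).contDiffOn fun _ hy => ⟨Set.mem_univ _, hy⟩).clm_apply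
      contDiffOn_const
  exact h1.congr fun y hy => (hasDerivAt_family hU hy hF 0).deriv

/-- The derivatives in the parameter and in a coordinate are mixed second derivatives of one
function on `ℝ × E n`, so symmetry of the second derivative interchanges them. -/
theorem hasDerivAt_pd_family (hU : IsOpen U) (hx : x ∈ U)
    (hF : ContDiffOn ℝ ∞ F (Set.univ ×ˢ U)) (a : Fin n) :
    HasDerivAt (fun s => pd a (fun y => F (s, y)) x)
      (pd a (fun y => deriv (fun s => F (s, y)) 0) x) 0 := by
  have hop : IsOpen ((Set.univ : Set ℝ) ×ˢ U) := isOpen_univ.prod hU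
  have h0 : ((0 : ℝ), x) ∈ (Set.univ : Set ℝ) ×ˢ U := ⟨Set.mem_univ _, hx⟩
  have hs : IsSymmSndFDerivAt ℝ F (0, x) :=
    (hF.contDiffAt (hop.mem_nhds h0)).isSymmSndFDerivAt (by simpa using ENat.LEInfty.out)
  have hd : HasFDerivAt (fderiv ℝ F) (fderiv ℝ (fderiv ℝ F) (0, x)) (0, x) :=
    (differentiableAt_of_contDiffOn hop h0
      (hF.fderiv_of_isOpen (m := ∞) hop (by simp))).hasFDerivAt
  have h1 : ∀ s, pd a (fun y => F (s, y)) x = fderiv ℝ F (s, x) (0, basisVec a) := by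
    intro s
    have h := (differentiableAt_of_contDiffOn (x := (s, x)) hop ⟨Set.mem_univ s, hx⟩ hF).hasFDerivAt
    have h2 : HasFDerivAt (fun y => F (s, y)) _ x := h.comp x (hasFDerivAt_prodMk_right s x)
    rw [pd, h2.fderiv]
    simp
  have h2 : pd a (fun y => deriv (fun s => F (s, y)) 0) x =
      fderiv ℝ (fderiv ℝ F) (0, x) (0, basisVec a) (1, 0) := by
    rw [pd_congr hU hx a fun y hy => (hasDerivAt_family hU hy hF 0).deriv]
    have h3 : HasFDerivAt (fun y => fderiv ℝ F (0, y) (1, 0)) _ x :=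
      (hd.comp x (hasFDerivAt_prodMk_right (0 : ℝ) x)).clm_apply
        (hasFDerivAt_const ((1 : ℝ), (0 : E n)) x)
    rw [pd, h3.fderiv]
    simp
  simp only [h1]
  rw [h2, hs.eq]
  have h4 := (hd.comp_hasDerivAt (0 : ℝ) ((hasDerivAt_id (0 : ℝ)).prodMk (hasDerivAt_const 0 x)))
  simpa using h4.clm_apply (hasDerivAt_const (0 : ℝ) ((0 : ℝ), (basisVec a : E n)))

end Families

/-! ### The first variation of the Lagrangian density -/

section Sums

variable {ι W : Type*} [Fintype ι] [AddCommMonoid W]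

theorem sum_rotate3 (F : ι → ι → ι → W) : ∑ a, ∑ b, ∑ c, F a b c = ∑ c, ∑ a, ∑ b, F a b c := by
  rw [Finset.sum_comm (s := Finset.univ) (t := Finset.univ) (f := fun c a => ∑ b, F a b c)]
  exact Finset.sum_congr rfl fun a _ => Finset.sum_comm

theorem sum_rotate4 (F : ι → ι → ι → ι → W) :
    ∑ a, ∑ b, ∑ c, ∑ d, F a b c d = ∑ d, ∑ a, ∑ b, ∑ c, F a b c d := by
  rw [Finset.sum_comm (s := Finset.univ) (t := Finset.univ) (f := fun d a => ∑ b, ∑ c, F a b c d)]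
  exact Finset.sum_congr rfl fun a _ => sum_rotate3 _

end Sums

/-! ### Divergences of the two boundary terms. -/

section Variation

variable {n : ℕ} {U : Set (E n)} {x : E n}

theorem sum_densMat3 (D : E n → Ix4 n) (x : E n) (R : Ix4 n) :
    ∑ a, ∑ b, ∑ c, ∑ d, D x a b c d * R a b c d =
      ∑ c, ∑ d, (densMat3 D c d x * Matrix.of fun a b => R a b c d).trace := by
  simp only [Matrix.trace, Matrix.diag, Matrix.mul_apply, densMat3, Matrix.of_apply]
  rw [sum_rotate4, sum_rotate4]
  exact Finset.sum_congr rfl fun c _ => Finset.sum_congr rfl fun d _ => Finset.sum_comm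

theorem theta_eq (D : E n → Ix4 n) (γ : E n → Ix3 n) (y : E n) (a : Fin n) :
    theta (D y) (γ y) a = 2 * ∑ b, (densMat3 D a b y * connMat γ b y).trace := by
  simp only [theta, Matrix.trace, Matrix.diag, Matrix.mul_apply, densMat3, connMat,
    Matrix.of_apply, Finset.mul_sum]
  rw [sum_rotate3]
  refine Finset.sum_congr rfl fun b _ => ?_
  rw [Finset.sum_comm]
  exact Finset.sum_congr rfl fun b _ => Finset.sum_congr rfl fun b _ => by ring

theorem msmooth_densMat3 {D : E n → Ix4 n}
    (hD : ∀ a b c d, ContDiffOn ℝ ∞ (fun y => D y a b c d) U) (c d : Fin n) :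
    MSmooth U (densMat3 D c d) := fun b a => hD a b c d

theorem msmooth_densMat4 {D : E n → Ix5 n}
    (hD : ∀ a b c d f, ContDiffOn ℝ ∞ (fun y => D y a b c d f) U) (c d f : Fin n) :
    MSmooth U (densMat4 D c d f) := fun b a => hD a b c d f

theorem densMat3_antisymm {D : E n → Ix4 n} (h : ∀ a b c d, D x a b c d = -D x a b d c)
    (c d : Fin n) : densMat3 D c d x = -densMat3 D d c x := by
  ext b a; exact h a b c d

/-- `δR_{cd}` is the antisymmetrization of `2 D_c δA_d`, and an antisymmetric `D` performs that
antisymmetrization by itself. -/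
theorem trace_linCurvature (Γ γ : E n → Ix3 n) {D : E n → Ix4 n}
    (h : ∀ a b c d, D x a b c d = -D x a b d c) :
    ∑ a, ∑ b, ∑ c, ∑ d, D x a b c d * linCurvature Γ γ x a b c d =
      2 * ∑ c, ∑ d, (densMat3 D c d x * covD (connMat Γ) c (connMat γ d) x).trace := by
  rw [sum_densMat3]
  have e : ∀ c d, (Matrix.of fun a b => linCurvature Γ γ x a b c d) =
      covD (connMat Γ) c (connMat γ d) x - covD (connMat Γ) d (connMat γ c) x := by
    intro c d; ext a b; exact linCurvature_eq Γ γ x a b c d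
  simp only [e, mul_sub, Matrix.trace_sub, Finset.sum_sub_distrib]
  rw [Finset.sum_comm (f := fun c d => (densMat3 D c d x * covD (connMat Γ) d (connMat γ c) x).trace)]
  rw [two_mul, sub_eq_add_neg, ← Finset.sum_neg_distrib]
  congr 1
  refine Finset.sum_congr rfl fun c _ => ?_
  rw [← Finset.sum_neg_distrib]
  refine Finset.sum_congr rfl fun d _ => ?_
  rw [densMat3_antisymm h d c, neg_mul, Matrix.trace_neg, neg_neg]

theorem contDiffOn_theta {D : E n → Ix4 n} {γ : E n → Ix3 n}
    (hD : ∀ a b c d, ContDiffOn ℝ ∞ (fun y => D y a b c d) U)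
    (hγ : ∀ a b c, ContDiffOn ℝ ∞ (fun y => γ y a b c) U) (a : Fin n) :
    ContDiffOn ℝ ∞ (fun y => theta (D y) (γ y) a) U :=
  ContDiffOn.sum fun d _ => ContDiffOn.sum fun c _ => ContDiffOn.sum fun b _ =>
    (contDiffOn_const.mul (hD d c a b)).mul (hγ d b c)

/-- The left side contains no connection, so any `Γ` may be inserted in the Leibniz rule. One half
is the `λ_R δR` term of the varied Lagrangian, the other the derivative term of the connection
equation. -/
theorem div_theta (hU : IsOpen U) (hx : x ∈ U) (Γ : E n → Ix3 n) {D : E n → Ix4 n}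
    {γ : E n → Ix3 n} (hD : ∀ a b c d, ContDiffOn ℝ ∞ (fun y => D y a b c d) U)
    (hγ : ∀ a b c, ContDiffOn ℝ ∞ (fun y => γ y a b c) U)
    (h : ∀ a b c d, D x a b c d = -D x a b d c) :
    ∑ a, pd a (fun y => theta (D y) (γ y) a) x =
      ∑ a, ∑ b, ∑ c, ∑ d, D x a b c d * linCurvature Γ γ x a b c d
      + 2 * ∑ b, ((∑ d, covD (connMat Γ) d (densMat3 D d b) x) * connMat γ b x).trace := by
  have hDm := msmooth_densMat3 hD
  have hγm := msmooth_connMat hγ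
  have h1 : ∀ a, pd a (fun y => theta (D y) (γ y) a) x =
      2 * ∑ b, ((covD (connMat Γ) a (densMat3 D a b) x * connMat γ b x).trace
        + (densMat3 D a b x * covD (connMat Γ) a (connMat γ b) x).trace) := by
    intro a
    simp only [theta_eq]
    have hd : ∀ b, DifferentiableAt ℝ (fun y => (densMat3 D a b y * connMat γ b y).trace) x :=
      fun b => differentiableAt_of_contDiffOn hU hx ((hDm a b).mul (hγm b)).trace
    rw [pd_const_mul _ _ (DifferentiableAt.fun_sum fun b _ => hd b), pd_sum _ _ fun b _ => hd b]
    congr 1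
    exact Finset.sum_congr rfl fun b _ => pd_trace_mul hU hx (hDm a b) (hγm b) a
  simp only [h1, trace_linCurvature Γ γ h, ← Finset.mul_sum, Finset.sum_add_distrib,
    Finset.sum_mul, Matrix.trace_sum]
  rw [Finset.sum_comm (f := fun a b => (covD (connMat Γ) a (densMat3 D a b) x *
    connMat γ b x).trace)]
  ring

theorem sum_torsion_sub_nablaUpper3 (Γ P : E n → Ix3 n) (x : E n) (a b : Fin n) :
    (∑ c, ((∑ d, torsion (Γ x) d d c) * P x c a b - nablaUpper3 Γ P x c c a b)) =
      -(∑ c, pd c (fun y => P y c a b) x) - ∑ c, ∑ k, Γ x a c k * P x c k b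
        - ∑ c, ∑ k, Γ x b c k * P x c a k := by
  have e3 : ∑ c, ∑ k, Γ x c c k * P x k a b = ∑ c, ∑ k, Γ x k k c * P x c a b :=
    Finset.sum_comm
  simp only [nablaUpper3, torsion, Finset.sum_sub_distrib, Finset.sum_add_distrib,
    Finset.sum_mul, sub_mul, e3]
  ring

/-- The left side is `P δQ`, with `h = δg` and `γ = δΓ`. Moving the derivative off `δg` leaves the
divergence term of the metric equation, and the `δΓ` part is the `P` term of the connection
equation. -/
theorem div_thetaMetric (hU : IsOpen U) (hx : x ∈ U) {P : E n → Ix3 n} {g h : E n → Ix2 n}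
    (Γ γ : E n → Ix3 n) (hP : ∀ a b c, ContDiffOn ℝ ∞ (fun y => P y a b c) U)
    (hh : ∀ a b, ContDiffOn ℝ ∞ (fun y => h y a b) U)
    (hPs : ∀ a b c, P x a b c = P x a c b) (hg : ∀ a b, g x a b = g x b a) :
    ∑ a, ∑ b, ∑ c, P x a b c * (pd a (fun y => h y b c) x
        - ∑ k, (γ x k a b * g x k c + Γ x k a b * h x k c)
        - ∑ k, (γ x k a c * g x b k + Γ x k a c * h x b k)) =
      ∑ a, pd a (fun y => thetaMetric (P y) (h y) a) x
      + ∑ a, ∑ b, (∑ c, ((∑ d, torsion (Γ x) d d c) * P x c a b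
          - nablaUpper3 Γ P x c c a b)) * h x a b
      - 2 * ∑ a, ∑ b, ∑ c, (∑ d, P x b c d * g x d a) * γ x a b c := by
  have h1 : ∀ a, pd a (fun y => thetaMetric (P y) (h y) a) x =
      ∑ b, ∑ c, (pd a (fun y => P y a b c) x * h x b c + P x a b c * pd a (fun y => h y b c) x) := by
    intro a
    have hd : ∀ b c, DifferentiableAt ℝ (fun y => P y a b c * h y b c) x := fun b c =>
      differentiableAt_of_contDiffOn hU hx ((hP a b c).mul (hh b c))
    simp only [thetaMetric]
    rw [pd_sum _ _ fun b _ => DifferentiableAt.fun_sum fun c _ => hd b c]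
    refine Finset.sum_congr rfl fun b _ => ?_
    rw [pd_sum _ _ fun c _ => hd b c]
    exact Finset.sum_congr rfl fun c _ => pd_mul _ (differentiableAt_of_contDiffOn hU hx (hP a b c))
      (differentiableAt_of_contDiffOn hU hx (hh b c))
  -- The two terms with `γ` coincide because `P` is symmetric in its last two indices and `g` is
  -- symmetric; hence the factor `2` in the connection equation.
  have t1 : ∑ a, ∑ b, ∑ c, ∑ k, P x a b c * (γ x k a b * g x k c) =
      ∑ a, ∑ b, ∑ c, (∑ d, P x b c d * g x d a) * γ x a b c := by
    rw [sum_rotate4]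
    simp only [Finset.sum_mul]
    exact Finset.sum_congr rfl fun a _ => Finset.sum_congr rfl fun b _ =>
      Finset.sum_congr rfl fun c _ => Finset.sum_congr rfl fun d _ => by rw [hg a d]; ring
  have t2 : ∑ a, ∑ b, ∑ c, ∑ k, P x a b c * (γ x k a c * g x b k) =
      ∑ a, ∑ b, ∑ c, (∑ d, P x b c d * g x d a) * γ x a b c := by
    rw [← t1]
    refine Finset.sum_congr rfl fun a _ => ?_
    rw [Finset.sum_comm]
    exact Finset.sum_congr rfl fun b _ => Finset.sum_congr rfl fun c _ =>
      Finset.sum_congr rfl fun d _ => by rw [hg c d, hPs a c b]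
  have t3 : ∑ a, ∑ b, ∑ c, ∑ k, P x a b c * (Γ x k a b * h x k c) =
      ∑ a, ∑ b, (∑ c, ∑ k, Γ x a c k * P x c k b) * h x a b := by
    rw [sum_rotate4]
    refine Finset.sum_congr rfl fun k _ => ?_
    rw [sum_rotate3]
    simp only [Finset.sum_mul]
    exact Finset.sum_congr rfl fun a _ => Finset.sum_congr rfl fun b _ =>
      Finset.sum_congr rfl fun c _ => by ring
  have t4 : ∑ a, ∑ b, ∑ c, ∑ k, P x a b c * (Γ x k a c * h x b k) =
      ∑ a, ∑ b, (∑ c, ∑ k, Γ x b c k * P x c a k) * h x a b := by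
    rw [sum_rotate4]
    rw [Finset.sum_comm (f := fun a b => (∑ c, ∑ k, Γ x b c k * P x c a k) * h x a b)]
    refine Finset.sum_congr rfl fun k _ => ?_
    rw [Finset.sum_comm]
    simp only [Finset.sum_mul]
    exact Finset.sum_congr rfl fun a _ => Finset.sum_congr rfl fun b _ =>
      Finset.sum_congr rfl fun c _ => by ring
  have t6 : ∑ a, ∑ b, (∑ c, pd c (fun y => P y c a b) x) * h x a b =
      ∑ a, ∑ b, ∑ c, pd a (fun y => P y a b c) x * h x b c := by
    simp only [Finset.sum_mul]
    exact sum_rotate3 _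
  simp only [sum_torsion_sub_nablaUpper3]
  simp only [h1, mul_sub, mul_add, sub_mul, neg_mul, Finset.mul_sum, Finset.sum_add_distrib,
    Finset.sum_sub_distrib, Finset.sum_neg_distrib, t1, t2, t3, t4, t6]
  simp only [← Finset.mul_sum]
  ring

theorem sum_torsion {D γ : Ix3 n} (h : ∀ a b c, D a b c = -D a c b) :
    ∑ a, ∑ b, ∑ c, D a b c * torsion γ a b c = 2 * ∑ a, ∑ b, ∑ c, D a b c * γ a b c := by
  simp only [Finset.mul_sum]
  refine Finset.sum_congr rfl fun a _ => ?_
  rw [← sub_eq_zero, ← Finset.sum_sub_distrib]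
  simp only [← Finset.sum_sub_distrib]
  refine sum_sum_eq_zero_of_antisymm fun i j => ?_
  rw [h a j i]; simp only [torsion]; ring

end Variation

/-! ### Smoothness and symmetries of the fields, and the off-shell variation formula. -/

section FirstVariation

variable {n : ℕ} {M : Type*} [TopologicalSpace M] [ChartedSpace (E n) M]
  {e : Chart n M} {x : E n}

theorem nonmetricity_symm {g : E n → Ix2 n} {U : Set (E n)} (hU : IsOpen U) (hx : x ∈ U)
    (hg : ∀ y ∈ U, ∀ a b, g y a b = g y b a) (Γ : E n → Ix3 n) (a b c : Fin n) :
    nonmetricity g Γ x a b c = nonmetricity g Γ x a c b := by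
  simp only [nonmetricity]
  rw [pd_congr hU hx a fun y hy => hg y hy b c]
  simp only [hg x hx b, hg x hx c]
  ring

theorem Config.IsField.metric_symm {φ : Config n M} (hφ : φ.IsField) (he : e ∈ atlas (E n) M)
    (hx : x ∈ e.target) (a b : Fin n) : φ.g e x a b = φ.g e x b a :=
  (hφ.metric.lorentzian e he x hx).1 a b

theorem Config.IsField.nonmetricity_symm {φ : Config n M} (hφ : φ.IsField)
    (he : e ∈ atlas (E n) M) (hx : x ∈ e.target) (a b c : Fin n) :
    nonmetricity (φ.g e) (φ.Γ e) x a b c = nonmetricity (φ.g e) (φ.Γ e) x a c b :=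
  STG.nonmetricity_symm e.open_target hx (fun _ hy => hφ.metric_symm he hy) _ a b c

theorem contDiffOn_nonmetricity {g : E n → Ix2 n} {Γ : E n → Ix3 n} {U : Set (E n)}
    (hU : IsOpen U) (hg : ∀ a b, ContDiffOn ℝ ∞ (fun y => g y a b) U)
    (hΓ : ∀ a b c, ContDiffOn ℝ ∞ (fun y => Γ y a b c) U) (a b c : Fin n) :
    ContDiffOn ℝ ∞ (fun y => nonmetricity g Γ y a b c) U :=
  ((contDiffOn_pd hU (hg b c) a).sub (ContDiffOn.sum fun h _ => (hΓ h a b).mul (hg h c))).sub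
    (ContDiffOn.sum fun h _ => (hΓ h a c).mul (hg b h))

theorem Config.IsField.contDiffOn_arg {φ : Config n M} (hφ : φ.IsField)
    (he : e ∈ atlas (E n) M) : ContDiffOn ℝ ∞ (φ.arg e) e.target := by
  refine ContDiffOn.prodMk ?_ ?_
  · exact contDiffOn_pi.2 fun a => contDiffOn_pi.2 fun b => hφ.metric.smooth e he a b
  · exact contDiffOn_pi.2 fun a => contDiffOn_pi.2 fun b => contDiffOn_pi.2 fun c =>
      contDiffOn_nonmetricity e.open_target (hφ.metric.smooth e he)
        (hφ.connection.smooth e he) a b c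

variable {f : Ix2 n → Ix3 n → ℝ}

theorem Config.IsField.contDiffAt_mainDensity [NeZero n] {φ : Config n M} (hφ : φ.IsField)
    (hf : IsScalarFunction f) (he : e ∈ atlas (E n) M) (hx : x ∈ e.target) :
    ContDiffAt ℝ ∞ (mainDensity f) (φ.arg e x) :=
  STG.contDiffAt_mainDensity hf (hφ.metric.lorentzian e he x hx) (hφ.nonmetricity_symm he hx)

theorem Config.IsField.contDiffOn_conj [NeZero n] {φ : Config n M} (hφ : φ.IsField)
    (hf : IsScalarFunction f) (he : e ∈ atlas (E n) M) (a b c : Fin n) :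
    ContDiffOn ℝ ∞ (fun y => φ.conj f e y a b c) e.target := by
  intro x hx
  have h1 := (hφ.contDiffAt_mainDensity hf he hx).fderiv_right (m := ∞) (by simp)
  have h2 := (hφ.contDiffOn_arg he).contDiffAt (e.open_target.mem_nhds hx)
  exact ((h1.comp x h2).clm_apply contDiffAt_const).contDiffWithinAt

theorem Config.IsField.conj_symm [NeZero n] {φ : Config n M} (hφ : φ.IsField)
    (hf : IsScalarFunction f) (he : e ∈ atlas (E n) M) (hx : x ∈ e.target) (a b c : Fin n) :
    φ.conj f e x a b c = φ.conj f e x a c b :=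
  dNonmet_symm ((hφ.contDiffAt_mainDensity hf he hx).differentiableAt (by simp)) a b c

theorem Config.IsField.eomConnection_eq {φ : Config n M} (hφ : φ.IsField)
    (he : e ∈ atlas (E n) M) (hx : x ∈ e.target) (a b c : Fin n) :
    φ.eomConnection f e x a b c =
      -2 * (∑ d, covD (connMat (φ.Γ e)) d (densMat3 (φ.lamR e) d b) x) c a
      + 2 * φ.lamT e x a b c - 2 * ∑ d, φ.conj f e x b c d * φ.g e x d a := by
  rw [← div_nablaDensity3_eq (hφ.antisymmR e he x hx)]
  rfl

theorem hasDerivAt_curvature {Γ : ℝ → E n → Ix3 n} {U : Set (E n)} (hU : IsOpen U) (hx : x ∈ U)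
    (hΓ : ∀ a b c, ContDiffOn ℝ ∞ (fun p : ℝ × E n => Γ p.1 p.2 a b c) (Set.univ ×ˢ U))
    (a b c d : Fin n) :
    HasDerivAt (fun s => curvature (Γ s) x a b c d)
      (linCurvature (Γ 0) (fun y a b c => deriv (fun s => Γ s y a b c) 0) x a b c d) 0 := by
  have hv : ∀ a b c, HasDerivAt (fun s => Γ s x a b c) (deriv (fun s => Γ s x a b c) 0) 0 :=
    fun a b c => hasDerivAt_family_zero hU hx (hΓ a b c)
  refine (((hasDerivAt_pd_family hU hx (hΓ a d b) c).sub
    (hasDerivAt_pd_family hU hx (hΓ a c b) d)).add (HasDerivAt.fun_sum fun h _ =>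
      ((hv a c h).mul (hv h d b)).sub ((hv a d h).mul (hv h c b)))).congr_deriv ?_
  simp only [linCurvature]
  congr 1
  exact Finset.sum_congr rfl fun h _ => by ring

theorem hasDerivAt_mainDensity_family [NeZero n] {Φ : ℝ → Config n M} (hΦ : IsSmoothFamily Φ)
    (hf : IsScalarFunction f) (he : e ∈ atlas (E n) M) (hx : x ∈ e.target) :
    HasDerivAt (fun s => mainDensity f ((Φ s).arg e x))
      (∑ a, ∑ b, dMetric f ((Φ 0).arg e x) a b * (variation Φ).g e x a b
        + ∑ a, ∑ b, ∑ c, (Φ 0).conj f e x a b c * (pd a (fun y => (variation Φ).g e y b c) x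
          - ∑ k, ((variation Φ).Γ e x k a b * (Φ 0).g e x k c
            + (Φ 0).Γ e x k a b * (variation Φ).g e x k c)
          - ∑ k, ((variation Φ).Γ e x k a c * (Φ 0).g e x b k
            + (Φ 0).Γ e x k a c * (variation Φ).g e x b k))) 0 := by
  have hg : ∀ a b, HasDerivAt (fun s => (Φ s).g e x a b) ((variation Φ).g e x a b) 0 :=
    fun a b => hasDerivAt_family_zero e.open_target hx (hΦ.g e he a b)
  have hΓ : ∀ a b c, HasDerivAt (fun s => (Φ s).Γ e x a b c) ((variation Φ).Γ e x a b c) 0 :=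
    fun a b c => hasDerivAt_family_zero e.open_target hx (hΦ.Γ e he a b c)
  have harg : HasDerivAt (fun s => (Φ s).arg e x) ((variation Φ).g e x, fun a b c =>
      (pd a (fun y => (variation Φ).g e y b c) x
          - ∑ k, ((variation Φ).Γ e x k a b * (Φ 0).g e x k c
            + (Φ 0).Γ e x k a b * (variation Φ).g e x k c)
          - ∑ k, ((variation Φ).Γ e x k a c * (Φ 0).g e x b k
            + (Φ 0).Γ e x k a c * (variation Φ).g e x b k))) 0 := by
    refine HasDerivAt.prodMk ?_ ?_
    · exact hasDerivAt_pi.2 fun a => hasDerivAt_pi.2 fun b => hg a b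
    · refine hasDerivAt_pi.2 fun a => hasDerivAt_pi.2 fun b => hasDerivAt_pi.2 fun c => ?_
      exact ((hasDerivAt_pd_family e.open_target hx (hΦ.g e he b c) a).sub
        (HasDerivAt.fun_sum fun k _ => (hΓ k a b).mul (hg k c))).sub
        (HasDerivAt.fun_sum fun k _ => (hΓ k a c).mul (hg b k))
  have h := ((((hΦ.isField 0).contDiffAt_mainDensity hf he hx).differentiableAt
    (by simp)).hasFDerivAt).comp_hasDerivAt (0 : ℝ) harg
  rw [fderiv_mainDensity_apply] at h
  exact h

theorem Config.IsField.lagrangian_eq {φ : Config n M} (hφ : φ.IsField)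
    (he : e ∈ atlas (E n) M) (hx : x ∈ e.target) :
    φ.lagrangian f e x = mainDensity f (φ.arg e x)
      + ∑ a, ∑ b, ∑ c, ∑ d, φ.lamR e x a b c d * curvature (φ.Γ e) x a b c d
      + ∑ a, ∑ b, ∑ c, φ.lamT e x a b c * torsion (φ.Γ e x) a b c := by
  rw [Config.lagrangian, Config.arg, mainDensity_of_symm f (hφ.metric_symm he hx)
    (hφ.nonmetricity_symm he hx)]

/-- The variations of the multipliers contribute curvature and torsion directly. Everything else is
`div_theta` and `div_thetaMetric` read backwards, and no field equation is used. -/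
theorem hasDerivAt_lagrangian [NeZero n] {Φ : ℝ → Config n M} (hΦ : IsSmoothFamily Φ)
    (hf : IsScalarFunction f) (he : e ∈ atlas (E n) M) (hx : x ∈ e.target) :
    HasDerivAt (fun s => (Φ s).lagrangian f e x)
      ((Φ 0).eomTerm f (variation Φ) e x
        + ∑ a, pd a (fun y => theta ((Φ 0).lamR e y) ((variation Φ).Γ e y) a
            + thetaMetric ((Φ 0).conj f e y) ((variation Φ).g e y) a) x) 0 := by
  have hU := e.open_target
  have hφ := hΦ.isField 0
  have hγ : ∀ a b c, ContDiffOn ℝ ∞ (fun y => (variation Φ).Γ e y a b c) e.target :=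
    fun a b c => contDiffOn_variation hU (hΦ.Γ e he a b c)
  have hh : ∀ a b, ContDiffOn ℝ ∞ (fun y => (variation Φ).g e y a b) e.target :=
    fun a b => contDiffOn_variation hU (hΦ.g e he a b)
  have hR : HasDerivAt (fun s => ∑ a, ∑ b, ∑ c, ∑ d, (Φ s).lamR e x a b c d
      * curvature ((Φ s).Γ e) x a b c d)
      (∑ a, ∑ b, ∑ c, ∑ d, ((variation Φ).lamR e x a b c d * curvature ((Φ 0).Γ e) x a b c d
        + (Φ 0).lamR e x a b c d * linCurvature ((Φ 0).Γ e) ((variation Φ).Γ e) x a b c d)) 0 :=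
    HasDerivAt.fun_sum fun a _ => HasDerivAt.fun_sum fun b _ => HasDerivAt.fun_sum fun c _ =>
      HasDerivAt.fun_sum fun d _ =>
        (hasDerivAt_family_zero hU hx (hΦ.lamR e he a b c d)).mul
          (hasDerivAt_curvature (Γ := fun s => (Φ s).Γ e) hU hx (hΦ.Γ e he) a b c d)
  have hTor : HasDerivAt (fun s => ∑ a, ∑ b, ∑ c, (Φ s).lamT e x a b c
      * torsion ((Φ s).Γ e x) a b c)
      (∑ a, ∑ b, ∑ c, ((variation Φ).lamT e x a b c * torsion ((Φ 0).Γ e x) a b c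
        + (Φ 0).lamT e x a b c * torsion ((variation Φ).Γ e x) a b c)) 0 :=
    HasDerivAt.fun_sum fun a _ => HasDerivAt.fun_sum fun b _ => HasDerivAt.fun_sum fun c _ =>
      (hasDerivAt_family_zero hU hx (hΦ.lamT e he a b c)).mul
        ((hasDerivAt_family_zero hU hx (hΦ.Γ e he a b c)).sub
          (hasDerivAt_family_zero hU hx (hΦ.Γ e he a c b)))
  have hmain := ((hasDerivAt_mainDensity_family hΦ hf he hx).add hR).add hTor
  have heq : (fun s => (Φ s).lagrangian f e x) = fun s => mainDensity f ((Φ s).arg e x)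
      + ∑ a, ∑ b, ∑ c, ∑ d, (Φ s).lamR e x a b c d * curvature ((Φ s).Γ e) x a b c d
      + ∑ a, ∑ b, ∑ c, (Φ s).lamT e x a b c * torsion ((Φ s).Γ e x) a b c :=
    funext fun s => (hΦ.isField s).lagrangian_eq he hx
  rw [heq]
  refine hmain.congr_deriv ?_
  have hθ : ∀ a, pd a (fun y => theta ((Φ 0).lamR e y) ((variation Φ).Γ e y) a
      + thetaMetric ((Φ 0).conj f e y) ((variation Φ).g e y) a) x =
      pd a (fun y => theta ((Φ 0).lamR e y) ((variation Φ).Γ e y) a) x +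
      pd a (fun y => thetaMetric ((Φ 0).conj f e y) ((variation Φ).g e y) a) x := by
    intro a
    refine pd_add a ?_ ?_
    · exact differentiableAt_of_contDiffOn hU hx
        (contDiffOn_theta (hφ.densityR.smooth e he) hγ a)
    · exact differentiableAt_of_contDiffOn hU hx (ContDiffOn.sum fun b _ => ContDiffOn.sum
        fun c _ => (hφ.contDiffOn_conj hf he a b c).mul (hh b c))
  simp only [hθ]
  rw [Finset.sum_add_distrib, div_theta hU hx ((Φ 0).Γ e) (hφ.densityR.smooth e he) hγ
    (hφ.antisymmR e he x hx), div_thetaMetric hU hx ((Φ 0).Γ e) ((variation Φ).Γ e)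
    (hφ.contDiffOn_conj hf he) hh (hφ.conj_symm hf he hx) (hφ.metric_symm he hx)]
  have hT2 := sum_torsion (γ := (variation Φ).Γ e x) (hφ.antisymmT e he x hx)
  -- The connection equation splits into the three terms produced separately by `λ_R δR`, `λ_T δT`
  -- and `P δQ`.
  have hE : ∑ a, ∑ b, ∑ c, (Φ 0).eomConnection f e x a b c * (variation Φ).Γ e x a b c =
      -2 * ∑ b, ((∑ d, covD (connMat ((Φ 0).Γ e)) d (densMat3 ((Φ 0).lamR e) d b) x)
        * connMat ((variation Φ).Γ e) b x).trace
      + 2 * ∑ a, ∑ b, ∑ c, (Φ 0).lamT e x a b c * (variation Φ).Γ e x a b c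
      - 2 * ∑ a, ∑ b, ∑ c, (∑ d, (Φ 0).conj f e x b c d * (Φ 0).g e x d a)
        * (variation Φ).Γ e x a b c := by
    have : ∑ b, ((∑ d, covD (connMat ((Φ 0).Γ e)) d (densMat3 ((Φ 0).lamR e) d b) x)
        * connMat ((variation Φ).Γ e) b x).trace = ∑ a, ∑ b, ∑ c,
        (∑ d, covD (connMat ((Φ 0).Γ e)) d (densMat3 ((Φ 0).lamR e) d b) x) c a
          * (variation Φ).Γ e x a b c := by
      rw [Finset.sum_comm]
      refine Finset.sum_congr rfl fun b _ => ?_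
      rw [Finset.sum_comm]
      rfl
    rw [this]
    simp only [hφ.eomConnection_eq he hx, Finset.mul_sum, ← Finset.sum_add_distrib,
      ← Finset.sum_sub_distrib]
    refine Finset.sum_congr rfl fun a _ => Finset.sum_congr rfl fun b _ =>
      Finset.sum_congr rfl fun c _ => ?_
    simp only [← Finset.mul_sum]
    ring
  rw [Config.eomTerm, hE]
  simp only [Config.eomMetric, add_mul, Finset.sum_add_distrib, hT2]
  simp only [mul_comm (curvature _ _ _ _ _ _), mul_comm (torsion _ _ _ _) ((variation Φ).lamT _ _ _ _ _)]
  ring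

end FirstVariation

/-! ### Divergence identities for flat connections -/

section Divergence

variable {n : ℕ} {U : Set (E n)} {x : E n}

theorem densMat4_antisymm_first {κ : E n → Ix5 n}
    (h : ∀ a b c d f, κ x a b c d f = -κ x a b d c f) (c d f : Fin n) :
    densMat4 κ c d f x = -densMat4 κ d c f x := by
  ext b a; exact h a b c d f

theorem densMat4_antisymm_last {κ : E n → Ix5 n}
    (h : ∀ a b c d f, κ x a b c d f = -κ x a b c f d) (c d f : Fin n) :
    densMat4 κ c d f x = -densMat4 κ c f d x := by
  ext b a; exact h a b c d f

theorem covD_antisymm (hU : IsOpen U) (hx : x ∈ U) {A : Fin n → E n → Mat n} {X Y : E n → Mat n}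
    (h : ∀ y ∈ U, X y = -Y y) (d : Fin n) : covD A d X x = -covD A d Y x := by
  rw [covD_congr hU hx d h, covD_neg]

theorem densMat3_divDensity4 {Γ : E n → Ix3 n} {κ : E n → Ix5 n} (hT : torsion (Γ x) = 0)
    (h : ∀ a b c d f, κ x a b c d f = -κ x a b d c f ∧ κ x a b c d f = -κ x a b c f d)
    (c d : Fin n) :
    densMat3 (divDensity4 Γ κ) c d x = ∑ f, covD (connMat Γ) f (densMat4 κ c d f) x := by
  ext b a
  exact divDensity4_eq hT (fun a b c d f => (h a b c d f).1) (fun a b c d f => (h a b c d f).2)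
    a b c d

variable {Γ : E n → Ix3 n} {κ : E n → Ix5 n} {γ : E n → Ix3 n} {D : E n → Ix4 n}

/-- Flatness makes the second covariant derivative symmetric, and it is contracted with an
antisymmetric pair. This is the conservation law behind both the Noether charge and the `κ4`
transformation. -/
theorem covD_covD_eq_zero (hU : IsOpen U) (hx : x ∈ U)
    (hΓ : ∀ a b c, ContDiffOn ℝ ∞ (fun y => Γ y a b c) U) (hR : curvature Γ x = 0)
    {X : Fin n → Fin n → E n → Mat n} (hX : ∀ c d, MSmooth U (X c d))
    (h : ∀ y ∈ U, ∀ c d, X c d y = -X d c y) :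
    ∑ c, ∑ d, covD (connMat Γ) c (fun y => covD (connMat Γ) d (X c d) y) x = 0 := by
  refine sum_sum_eq_zero_of_antisymm fun c d => ?_
  rw [covD_comm hU hx (msmooth_connMat hΓ) (hX c d) c d (fieldStrength_eq_zero hR c d)]
  exact covD_antisymm hU hx (fun y hy => covD_antisymm hU hy (fun z hz => h z hz c d) c) d

/-- The `κ4` shift of `λ_R` is divergence-free, so the connection equation does not see it. -/
theorem sum_covD_covD_densMat4 (hU : IsOpen U) (hx : x ∈ U)
    (hΓ : ∀ a b c, ContDiffOn ℝ ∞ (fun y => Γ y a b c) U) (hR : curvature Γ x = 0)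
    (hκ : ∀ a b c d f, ContDiffOn ℝ ∞ (fun y => κ y a b c d f) U)
    (h : ∀ y ∈ U, ∀ a b c d f, κ y a b c d f = -κ y a b d c f ∧ κ y a b c d f = -κ y a b c f d)
    (b : Fin n) :
    ∑ d, covD (connMat Γ) d (fun y => ∑ f, covD (connMat Γ) f (densMat4 κ d b f) y) x = 0 := by
  have hA := msmooth_connMat hΓ
  have hs := msmooth_densMat4 hκ
  have e : ∀ d, covD (connMat Γ) d (fun y => ∑ f, covD (connMat Γ) f (densMat4 κ d b f) y) x =
      ∑ f, covD (connMat Γ) d (fun y => covD (connMat Γ) f (densMat4 κ d b f) y) x := fun d =>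
    covD_sum hU hx _ (fun f _ => (hs d b f).covD hU hA f) d
  simp only [e]
  refine covD_covD_eq_zero (X := fun d f => densMat4 κ d b f) hU hx hΓ hR
    (fun d f => hs d b f) fun y hy d f => ?_
  have h1 := fun a b c d f => (h y hy a b c d f).1
  have h2 := fun a b c d f => (h y hy a b c d f).2
  -- Three adjacent transpositions exchange the outer indices `d` and `f` around the spectator `b`.
  rw [densMat4_antisymm_first h1, densMat4_antisymm_last h2, densMat4_antisymm_first h1, neg_neg]

theorem covD_connMat_symm {c d : Fin n} (h : linCurvature Γ γ x = 0) :
    covD (connMat Γ) c (connMat γ d) x = covD (connMat Γ) d (connMat γ c) x := by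
  ext a b
  have := linCurvature_eq Γ γ x a b c d
  rw [h] at this
  simp only [Pi.zero_apply, Matrix.sub_apply] at this
  linarith

theorem yTensor_eq (κ : E n → Ix5 n) (γ : E n → Ix3 n) (y : E n) (a b : Fin n) :
    ∑ d, ∑ c, ∑ h, κ y d c a h b * γ y d h c =
      ∑ h, (densMat4 κ a h b y * connMat γ h y).trace := by
  simp only [Matrix.trace, Matrix.diag, Matrix.mul_apply, densMat4, connMat, Matrix.of_apply]
  rw [sum_rotate3]
  exact Finset.sum_congr rfl fun h _ => Finset.sum_comm

/-- In the Leibniz rule for `tr(κ γ)` the term with `Dγ` vanishes: `δR = 0` makes `D_b γ_h`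
symmetric, while `κ` is antisymmetric in `h`, `b`. What remains is the boundary term of `div κ`. -/
theorem theta_divDensity4 (hU : IsOpen U) (hx : x ∈ U) (hT : torsion (Γ x) = 0)
    (hκ : ∀ a b c d f, ContDiffOn ℝ ∞ (fun y => κ y a b c d f) U)
    (h : ∀ a b c d f, κ x a b c d f = -κ x a b d c f ∧ κ x a b c d f = -κ x a b c f d)
    (hγ : ∀ a b c, ContDiffOn ℝ ∞ (fun y => γ y a b c) U) (hF : linCurvature Γ γ x = 0)
    (a : Fin n) :
    theta (divDensity4 Γ κ x) (γ x) a =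
      2 * ∑ b, pd b (fun y => ∑ d, ∑ c, ∑ h, κ y d c a h b * γ y d h c) x := by
  have hs := msmooth_densMat4 hκ
  have hγs := msmooth_connMat hγ
  rw [theta_eq]
  simp only [yTensor_eq, densMat3_divDensity4 hT h]
  have e : ∀ b, pd b (fun y => ∑ h, (densMat4 κ a h b y * connMat γ h y).trace) x =
      ∑ h, ((covD (connMat Γ) b (densMat4 κ a h b) x * connMat γ h x).trace
        + (densMat4 κ a h b x * covD (connMat Γ) b (connMat γ h) x).trace) := by
    intro b
    rw [pd_sum _ _ fun f _ =>
      differentiableAt_of_contDiffOn hU hx ((hs a f b).mul (hγs f)).trace]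
    exact Finset.sum_congr rfl fun f _ => pd_trace_mul hU hx (hs a f b) (hγs f) b
  have z : ∑ b, ∑ h, (densMat4 κ a h b x * covD (connMat Γ) b (connMat γ h) x).trace = 0 :=
    sum_sum_eq_zero_of_antisymm fun i j => by
      rw [densMat4_antisymm_last (fun a b c d f => (h a b c d f).2), covD_connMat_symm hF,
        neg_mul, Matrix.trace_neg]
  simp only [e, Finset.sum_add_distrib, z, add_zero, Finset.sum_mul, Matrix.trace_sum]
  congr 1
  exact Finset.sum_comm

/-- A torsion-free `δΓ` is symmetric in the two indices contracted with the totally antisymmetric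
`D`. Hence `κ3` never reaches the boundary term. -/
theorem theta_eq_zero_of_antisymm {D : Ix4 n} {γ : Ix3 n} (hγ : torsion γ = 0)
    (h : ∀ a b c d, D a b c d = -D a c b d ∧ D a b c d = -D a b d c) : theta D γ = 0 := by
  have hs : ∀ a b c, γ a b c = γ a c b := fun a b c =>
    sub_eq_zero.mp (congrFun (congrFun (congrFun hγ a) b) c)
  ext a
  refine Finset.sum_eq_zero fun d _ => sum_sum_eq_zero_of_antisymm fun c b => ?_
  rw [hs d b c, (h d c a b).1, (h d a c b).2, (h d a b c).1]
  ring

theorem theta_add (D D' : Ix4 n) (γ : Ix3 n) (a : Fin n) :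
    theta (fun a b c d => D a b c d + D' a b c d) γ a = theta D γ a + theta D' γ a := by
  simp only [theta, mul_add, add_mul, Finset.sum_add_distrib]

theorem div_densMat3_totallyAntisymm (hx : x ∈ U) (hT : torsion (Γ x) = 0)
    (h : ∀ y ∈ U, ∀ a b c d, D y a b c d = -D y a c b d ∧ D y a b c d = -D y a b d c)
    (a b c : Fin n) :
    (∑ d, covD (connMat Γ) d (densMat3 D d b) x) c a =
      ∑ d, (pd d (fun y => D y a c d b) x - ∑ k, D x k c d b * Γ x k d a) := by
  have hs : ∀ a b c, Γ x a b c = Γ x a c b := fun a b c =>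
    sub_eq_zero.mp (congrFun (congrFun (congrFun hT a) b) c)
  have z : ∑ d, ∑ k, Γ x c d k * D x a k d b = 0 :=
    sum_sum_eq_zero_of_antisymm fun i j => by rw [hs c i j, (h x hx a j i b).1]; ring
  simp only [Matrix.sum_apply, covD, Matrix.sub_apply, Matrix.add_apply, Matrix.mul_apply,
    pdM_apply, connMat, densMat3, Matrix.of_apply, Finset.sum_sub_distrib,
    Finset.sum_add_distrib, z, add_zero]

/-- Under total antisymmetry the connection also drops out of the upper matrix index `c`, so the
divergence is antisymmetric in `b` and `c`. This lets the divergence of `κ3` in the connection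
equation match the shift of `λ_T`, whose contracted index sits elsewhere. -/
theorem div_densMat3_cyclic (hU : IsOpen U) (hx : x ∈ U) (hT : torsion (Γ x) = 0)
    (h : ∀ y ∈ U, ∀ a b c d, D y a b c d = -D y a c b d ∧ D y a b c d = -D y a b d c)
    (a b c : Fin n) :
    (∑ d, covD (connMat Γ) d (densMat3 D d b) x) c a =
      -(∑ d, covD (connMat Γ) d (densMat3 D d c) x) b a := by
  have hc : ∀ y ∈ U, ∀ a d, D y a c d b = -D y a b d c := fun y hy a d => by
    rw [(h y hy a c d b).1, (h y hy a d c b).2, (h y hy a d b c).1]; ring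
  rw [div_densMat3_totallyAntisymm hx hT h, div_densMat3_totallyAntisymm hx hT h,
    ← Finset.sum_neg_distrib]
  refine Finset.sum_congr rfl fun d _ => ?_
  rw [pd_congr hU hx d fun y hy => hc y hy a d, pd_neg]
  simp only [hc x hx, neg_mul, Finset.sum_neg_distrib]
  ring

/-- The linearized first Bianchi identity. It follows from `div_theta`: the boundary term is
identically zero, and the divergence of `D` is antisymmetric where `γ` is symmetric. -/
theorem sum_linCurvature_eq_zero_of_antisymm (hU : IsOpen U) (hx : x ∈ U) (hT : torsion (Γ x) = 0)
    (hD : ∀ a b c d, ContDiffOn ℝ ∞ (fun y => D y a b c d) U)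
    (h : ∀ y ∈ U, ∀ a b c d, D y a b c d = -D y a c b d ∧ D y a b c d = -D y a b d c)
    (hγ : ∀ a b c, ContDiffOn ℝ ∞ (fun y => γ y a b c) U) (hγT : ∀ y ∈ U, torsion (γ y) = 0) :
    ∑ a, ∑ b, ∑ c, ∑ d, D x a b c d * linCurvature Γ γ x a b c d = 0 := by
  have h1 := div_theta hU hx Γ hD hγ fun a b c d => (h x hx a b c d).2
  have h2 : ∀ a, pd a (fun y => theta (D y) (γ y) a) x = 0 := by
    intro a
    rw [pd_congr (G := fun _ => 0) hU hx a, pd_const]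
    intro y hy
    rw [theta_eq_zero_of_antisymm (hγT y hy) (h y hy)]; rfl
  have h3 : ∑ b, ((∑ d, covD (connMat Γ) d (densMat3 D d b) x) * connMat γ b x).trace = 0 := by
    simp only [Matrix.trace, Matrix.diag, Matrix.mul_apply]
    simp only [connMat, Matrix.of_apply]
    have : ∀ b, ∑ c, ∑ a, (∑ d, covD (connMat Γ) d (densMat3 D d b) x) c a * γ x a b c =
      ∑ a, ∑ c, (∑ d, covD (connMat Γ) d (densMat3 D d b) x) c a * γ x a b c :=
      fun b => Finset.sum_comm
    simp only [this]
    rw [Finset.sum_comm]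
    refine Finset.sum_eq_zero fun a _ => sum_sum_eq_zero_of_antisymm fun b c => ?_
    have hs : γ x a b c = γ x a c b :=
      sub_eq_zero.mp (congrFun (congrFun (congrFun (hγT x hx) a) b) c)
    rw [div_densMat3_cyclic hU hx hT h, hs, neg_mul]
  simp only [h2, h3, Finset.sum_const_zero] at h1
  linarith

theorem deltaMu_eq (κ : E n → Ix5 n) (Γ γ : E n → Ix3 n) (y : E n)
    (h : ∀ a b c d f, κ y a b c d f = -κ y a b d c f) (a : Fin n) :
    deltaMu (κ y) Γ γ y a =
      2 * ∑ c, ∑ d, (densMat4 κ c d a y * covD (connMat Γ) c (connMat γ d) y).trace :=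
  trace_linCurvature (D := fun y d b c h => κ y d b c h a) Γ γ fun d b c f => h d b c f a

theorem contDiffOn_linCurvature (hU : IsOpen U)
    (hΓ : ∀ a b c, ContDiffOn ℝ ∞ (fun y => Γ y a b c) U)
    (hγ : ∀ a b c, ContDiffOn ℝ ∞ (fun y => γ y a b c) U) (a b c d : Fin n) :
    ContDiffOn ℝ ∞ (fun y => linCurvature Γ γ y a b c d) U :=
  ((contDiffOn_pd hU (hγ a d b) c).sub (contDiffOn_pd hU (hγ a c b) d)).add
    (ContDiffOn.sum fun h _ => ((((hγ a c h).mul (hΓ h d b)).add ((hΓ a c h).mul (hγ h d b))).sub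
      ((hγ a d h).mul (hΓ h c b))).sub ((hΓ a d h).mul (hγ h c b)))

theorem contDiffOn_deltaMu (hU : IsOpen U)
    (hΓ : ∀ a b c, ContDiffOn ℝ ∞ (fun y => Γ y a b c) U)
    (hγ : ∀ a b c, ContDiffOn ℝ ∞ (fun y => γ y a b c) U)
    (hκ : ∀ a b c d f, ContDiffOn ℝ ∞ (fun y => κ y a b c d f) U) (a : Fin n) :
    ContDiffOn ℝ ∞ (fun y => deltaMu (κ y) Γ γ y a) U :=
  ContDiffOn.sum fun d _ => ContDiffOn.sum fun b _ => ContDiffOn.sum fun c _ =>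
    ContDiffOn.sum fun h _ => (hκ d b c h a).mul (contDiffOn_linCurvature hU hΓ hγ d b c h)

/-- The linearized second Bianchi identity, contracted with a totally antisymmetric density. -/
theorem div_deltaMu (hU : IsOpen U) (hx : x ∈ U) (hT : torsion (Γ x) = 0)
    (hΓ : ∀ a b c, ContDiffOn ℝ ∞ (fun y => Γ y a b c) U) (hR : curvature Γ x = 0)
    (hκ : ∀ a b c d f, ContDiffOn ℝ ∞ (fun y => κ y a b c d f) U)
    (h : ∀ y ∈ U, ∀ a b c d f, κ y a b c d f = -κ y a b d c f ∧ κ y a b c d f = -κ y a b c f d)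
    (hγ : ∀ a b c, ContDiffOn ℝ ∞ (fun y => γ y a b c) U) :
    ∑ a, pd a (fun y => deltaMu (κ y) Γ γ y a) x =
      ∑ a, ∑ b, ∑ c, ∑ d, divDensity4 Γ κ x a b c d * linCurvature Γ γ x a b c d := by
  have hs := msmooth_densMat4 hκ
  have hγs := msmooth_connMat hγ
  have hA := msmooth_connMat hΓ
  have h1 := fun y (hy : y ∈ U) a b c d f => (h y hy a b c d f).1
  have h2 := fun y (hy : y ∈ U) a b c d f => (h y hy a b c d f).2
  have hsm : ∀ a c d, ContDiffOn ℝ ∞ (fun y =>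
      (densMat4 κ c d a y * covD (connMat Γ) c (connMat γ d) y).trace) U := fun a c d =>
    ((hs c d a).mul ((hγs d).covD hU hA c)).trace
  have e : ∀ a, pd a (fun y => deltaMu (κ y) Γ γ y a) x =
      2 * ∑ c, ∑ d, ((covD (connMat Γ) a (densMat4 κ c d a) x
          * covD (connMat Γ) c (connMat γ d) x).trace
        + (densMat4 κ c d a x
          * covD (connMat Γ) a (fun y => covD (connMat Γ) c (connMat γ d) y) x).trace) := by
    intro a
    rw [pd_congr hU hx a fun y hy => deltaMu_eq κ Γ γ y (h1 y hy) a]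
    have hd : ∀ c d, DifferentiableAt ℝ (fun y =>
        (densMat4 κ c d a y * covD (connMat Γ) c (connMat γ d) y).trace) x := fun c d =>
      differentiableAt_of_contDiffOn hU hx (hsm a c d)
    rw [pd_const_mul _ _ (DifferentiableAt.fun_sum fun c _ => DifferentiableAt.fun_sum fun d _ =>
      hd c d), pd_sum _ _ fun c _ => DifferentiableAt.fun_sum fun d _ => hd c d]
    congr 1
    refine Finset.sum_congr rfl fun c _ => ?_
    rw [pd_sum _ _ fun d _ => hd c d]
    exact Finset.sum_congr rfl fun d _ => pd_trace_mul hU hx (hs c d a) ((hγs d).covD hU hA c) a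
  -- Flatness makes `D_a D_c γ_d` symmetric in `a`, `c`, against the antisymmetry of `κ`.
  have z : ∑ a, ∑ c, ∑ d, (densMat4 κ c d a x
      * covD (connMat Γ) a (fun y => covD (connMat Γ) c (connMat γ d) y) x).trace = 0 := by
    refine (sum_rotate3 _).trans (Finset.sum_eq_zero fun d _ => ?_)
    refine sum_sum_eq_zero_of_antisymm fun a c => ?_
    rw [covD_comm hU hx hA (hγs d) a c (fieldStrength_eq_zero hR a c),
      densMat4_antisymm_first (h1 x hx), densMat4_antisymm_last (h2 x hx),
      densMat4_antisymm_first (h1 x hx)]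
    simp only [neg_neg, neg_mul, Matrix.trace_neg]
  have hanti : ∀ a b c d, divDensity4 Γ κ x a b c d = -divDensity4 Γ κ x a b d c := by
    intro a b c d
    rw [divDensity4_eq hT (h1 x hx) (h2 x hx), divDensity4_eq hT (h1 x hx) (h2 x hx),
      Finset.sum_congr rfl fun f _ => covD_antisymm hU hx
        (fun y hy => densMat4_antisymm_first (h1 y hy) c d f) f,
      Finset.sum_neg_distrib, Matrix.neg_apply]
  rw [trace_linCurvature Γ γ hanti]
  simp only [densMat3_divDensity4 hT (h x hx), Finset.sum_mul, Matrix.trace_sum]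
  rw [Finset.sum_congr rfl fun a _ => e a, ← Finset.mul_sum]
  simp only [Finset.sum_add_distrib]
  rw [z, add_zero]
  exact congrArg (2 * ·) ((sum_rotate3 _).trans (sum_rotate3 _))

end Divergence

/-! ### Field configurations on shell -/

theorem lagrangian_eq_of_flat {n : ℕ} {M : Type*} [TopologicalSpace M]
    {e : Chart n M} {x : E n} (φ : Config n M) (f : Ix2 n → Ix3 n → ℝ)
    (hR : curvature (φ.Γ e) x = 0) (hT : torsion (φ.Γ e x) = 0) :
    φ.lagrangian f e x =
      sqrtNegDet (φ.g e x) * f (φ.g e x) (nonmetricity (φ.g e) (φ.Γ e) x) := by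
  simp [Config.lagrangian, hR, hT]

section OnShell

variable {n : ℕ} {M : Type*} [TopologicalSpace M] [ChartedSpace (E n) M]
  {e : Chart n M} {x : E n} {f : Ix2 n → Ix3 n → ℝ} {φ : Config n M}
  {κ4 : Comp n M (Ix5 n)} {κ3 : Comp n M (Ix4 n)}

theorem div_lamR_eq (hφ : φ.IsField) (hs : φ.OnShell f) (he : e ∈ atlas (E n) M)
    (hx : x ∈ e.target) (a b c : Fin n) :
    (∑ d, covD (connMat (φ.Γ e)) d (densMat3 (φ.lamR e) d b) x) c a =
      φ.lamT e x a b c - ∑ d, φ.conj f e x b c d * φ.g e x d a := by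
  have h := congrFun (congrFun (congrFun (hs.connection e he x hx) a) b) c
  rw [hφ.eomConnection_eq he hx] at h
  simp only [Pi.zero_apply] at h
  linarith

theorem sum_div_densMat3_gauge (hφ : φ.IsField) (hs : φ.OnShell f)
    (h4 : IsDensity4 κ4) (h4a : TotallyAntisymm4 κ4) (h3 : IsDensity3 κ3)
    (he : e ∈ atlas (E n) M) (hx : x ∈ e.target) (b : Fin n) :
    ∑ d, covD (connMat (φ.Γ e)) d (densMat3 ((φ.gauge κ4 κ3).lamR e) d b) x =
      ∑ d, covD (connMat (φ.Γ e)) d (densMat3 (φ.lamR e) d b) x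
      + ∑ d, covD (connMat (φ.Γ e)) d (densMat3 (κ3 e) d b) x := by
  have hU := e.open_target
  have hΓ := hφ.connection.smooth e he
  have hA := msmooth_connMat hΓ
  have hsκ := msmooth_densMat4 (h4.smooth e he)
  have hl := msmooth_densMat3 (hφ.densityR.smooth e he)
  have hk := msmooth_densMat3 (h3.smooth e he)
  have hdiv : ∀ d, MSmooth e.target fun y => ∑ f, covD (connMat (φ.Γ e)) f
      (densMat4 (κ4 e) d b f) y := fun d => MSmooth.sum _ fun f _ => (hsκ d b f).covD hU hA f
  have key : ∀ d, covD (connMat (φ.Γ e)) d (densMat3 ((φ.gauge κ4 κ3).lamR e) d b) x =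
      covD (connMat (φ.Γ e)) d (densMat3 (φ.lamR e) d b) x
      + covD (connMat (φ.Γ e)) d (fun y => ∑ f, covD (connMat (φ.Γ e)) f
        (densMat4 (κ4 e) d b f) y) x
      + covD (connMat (φ.Γ e)) d (densMat3 (κ3 e) d b) x := by
    intro d
    rw [← covD_add hU hx (hl d b) (hdiv d), ← covD_add hU hx ((hl d b).add (hdiv d)) (hk d b)]
    refine covD_congr hU hx d fun y hy => ?_
    rw [← densMat3_divDensity4 (hs.torsionFree e he y hy) (h4a e he y hy)]
    rfl
  simp only [key, Finset.sum_add_distrib]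
  rw [sum_covD_covD_densMat4 hU hx hΓ (hs.flat e he x hx) (h4.smooth e he) (h4a e he), add_zero]

theorem gauge_lamR_antisymm (hφ : φ.IsField) (hs : φ.OnShell f)
    (h4a : TotallyAntisymm4 κ4) (h3a : TotallyAntisymm3 κ3)
    (he : e ∈ atlas (E n) M) (hx : x ∈ e.target) (a b c d : Fin n) :
    (φ.gauge κ4 κ3).lamR e x a b c d = -(φ.gauge κ4 κ3).lamR e x a b d c := by
  have h1 := fun y (hy : y ∈ e.target) a b c d f => (h4a e he y hy a b c d f).1
  have h2 := fun y (hy : y ∈ e.target) a b c d f => (h4a e he y hy a b c d f).2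
  have hT := hs.torsionFree e he x hx
  simp only [Config.gauge]
  rw [hφ.antisymmR e he x hx, (h3a e he x hx a b c d).2,
    divDensity4_eq hT (h1 x hx) (h2 x hx), divDensity4_eq hT (h1 x hx) (h2 x hx),
    Finset.sum_congr rfl fun f _ => covD_antisymm e.open_target hx
      (fun y hy => densMat4_antisymm_first (h1 y hy) c d f) f,
    Finset.sum_neg_distrib, Matrix.neg_apply]
  ring

/-- Only the connection equation involves the multipliers. There `κ4` drops out by `D D κ4 = 0`, and
the `κ3` shift of `λ_R` is compensated by that of `λ_T`. -/
theorem gauge_onShell (hφ : φ.IsField) (hs : φ.OnShell f) (h4 : IsDensity4 κ4)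
    (h4a : TotallyAntisymm4 κ4) (h3 : IsDensity3 κ3) (h3a : TotallyAntisymm3 κ3) :
    (φ.gauge κ4 κ3).OnShell f where
  metric := hs.metric
  flat := hs.flat
  torsionFree := hs.torsionFree
  connection := by
    intro e he x hx
    ext a b c
    have h0 := congrFun (congrFun (congrFun (hs.connection e he x hx) a) b) c
    rw [hφ.eomConnection_eq he hx] at h0
    have h1 := div_nablaDensity3_eq (Γ := φ.Γ e) (gauge_lamR_antisymm hφ hs h4a h3a he hx) a b c
    rw [sum_div_densMat3_gauge hφ hs h4 h4a h3 he hx] at h1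
    have hT := hs.torsionFree e he x hx
    have h2 := sum_nablaDensity3_eq (D := κ3 e) hT (fun a b c d => (h3a e he x hx a b c d).2) a b c
    have h3' : ∑ d, covD (connMat (φ.Γ e)) d (densMat3 (κ3 e) c d) x =
        -∑ d, covD (connMat (φ.Γ e)) d (densMat3 (κ3 e) d c) x := by
      rw [← Finset.sum_neg_distrib]
      exact Finset.sum_congr rfl fun d _ => covD_antisymm e.open_target hx
        (fun y hy => densMat3_antisymm (fun a b c d => (h3a e he y hy a b c d).2) c d) d
    -- Two sign changes, one from the last index pair of `κ3` and one from exchanging `b` and `c`,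
    -- align the divergence in `λ_T` with the one in `λ_R`.
    rw [h3', Matrix.neg_apply, ← div_densMat3_cyclic e.open_target hx hT (h3a e he)] at h2
    have h4 : (φ.gauge κ4 κ3).lamT e x a b c = φ.lamT e x a b c +
        ∑ d, nablaDensity3 (φ.Γ e) (κ3 e) x d a b c d := rfl
    rw [Matrix.add_apply] at h1
    have h5 : (φ.gauge κ4 κ3).eomConnection f e x a b c =
        (2 * ∑ d, ((∑ h, torsion (φ.Γ e x) h h d) * (φ.gauge κ4 κ3).lamR e x a c d b
          - nablaDensity3 (φ.Γ e) ((φ.gauge κ4 κ3).lamR e) x d a c d b)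
        + ∑ d, ∑ h, (φ.gauge κ4 κ3).lamR e x a c d h * torsion (φ.Γ e x) b d h)
        + 2 * (φ.gauge κ4 κ3).lamT e x a b c
        - 2 * ∑ d, φ.conj f e x b c d * φ.g e x d a := rfl
    rw [h5, h1, h4, h2]
    simp only [Pi.zero_apply] at h0 ⊢
    linarith

theorem eomTerm_eq_zero (hs : φ.OnShell f) (he : e ∈ atlas (E n) M) (hx : x ∈ e.target)
    (δφ : Config n M) : φ.eomTerm f δφ e x = 0 := by
  simp [Config.eomTerm, hs.metric e he x hx, hs.connection e he x hx, hs.flat e he x hx,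
    hs.torsionFree e he x hx]

/-- Without torsion the `λ_T` terms vanish for every `s`, so the Lagrangian changes by `(div κ4 +
κ3) R`. As `R = 0` at `s = 0`, only `δR` contributes: `κ3 δR = 0` by the first Bianchi identity and
`(div κ4) δR` is the divergence of `δμ` by the second. -/
theorem hasDerivAt_gauge_lagrangian [NeZero n] (hφ : φ.IsField) (hs : φ.OnShell f)
    (hf : IsScalarFunction f) (h4 : IsDensity4 κ4)
    (h4a : TotallyAntisymm4 κ4) (h3 : IsDensity3 κ3) (h3a : TotallyAntisymm3 κ3)
    {Φ : ℝ → Config n M} (hΦ : IsSmoothFamily Φ) (h0 : Φ 0 = φ)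
    (hΦT : ∀ s, ∀ e ∈ atlas (E n) M, ∀ x ∈ e.target, torsion ((Φ s).Γ e x) = 0)
    (he : e ∈ atlas (E n) M) (hx : x ∈ e.target) :
    HasDerivAt (fun s => ((Φ s).gauge κ4 κ3).lagrangian f e x)
      (∑ a, pd a (fun y => theta (φ.lamR e y) ((variation Φ).Γ e y) a
        + thetaMetric (φ.conj f e y) ((variation Φ).g e y) a
        + deltaMu (κ4 e y) (φ.Γ e) ((variation Φ).Γ e) y a) x) 0 := by
  subst h0
  have hU := e.open_target
  have hΓ := hφ.connection.smooth e he
  have hγ : ∀ a b c, ContDiffOn ℝ ∞ (fun y => (variation Φ).Γ e y a b c) e.target :=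
    fun a b c => contDiffOn_variation hU (hΦ.Γ e he a b c)
  have hh : ∀ a b, ContDiffOn ℝ ∞ (fun y => (variation Φ).g e y a b) e.target :=
    fun a b => contDiffOn_variation hU (hΦ.g e he a b)
  have hT := hs.torsionFree e he x hx
  have hR := hs.flat e he x hx
  have hγT : ∀ y ∈ e.target, torsion ((variation Φ).Γ e y) = 0 := by
    intro y hy
    ext a b c
    have : ∀ s, (Φ s).Γ e y a b c = (Φ s).Γ e y a c b := fun s =>
      sub_eq_zero.mp (congrFun (congrFun (congrFun (hΦT s e he y hy) a) b) c)
    simp [torsion, variation, this]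
  have heq : (fun s => ((Φ s).gauge κ4 κ3).lagrangian f e x) = fun s =>
      (Φ s).lagrangian f e x + ∑ a, ∑ b, ∑ c, ∑ d,
        (divDensity4 ((Φ s).Γ e) (κ4 e) x a b c d + κ3 e x a b c d)
          * curvature ((Φ s).Γ e) x a b c d := by
    funext s
    simp only [Config.lagrangian, Config.gauge, hΦT s e he x hx, Pi.zero_apply, mul_zero,
      Finset.sum_const_zero, add_zero, add_mul, Finset.sum_add_distrib]
    ring
  have hdΓ : ∀ a b c, DifferentiableAt ℝ (fun s => (Φ s).Γ e x a b c) 0 := fun a b c =>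
    (hasDerivAt_family_zero hU hx (hΦ.Γ e he a b c)).differentiableAt
  -- `div κ4` depends on `s` through `Γ`, but its derivative multiplies `R = 0`; differentiability
  -- is all that is needed.
  have hdiv : ∀ a b c d, DifferentiableAt ℝ
      (fun s => divDensity4 ((Φ s).Γ e) (κ4 e) x a b c d) 0 := by
    intro a b c d
    unfold divDensity4
    fun_prop
  have hprod : ∀ a b c d, HasDerivAt (fun s =>
      (divDensity4 ((Φ s).Γ e) (κ4 e) x a b c d + κ3 e x a b c d)
          * curvature ((Φ s).Γ e) x a b c d)
      ((divDensity4 ((Φ 0).Γ e) (κ4 e) x a b c d + κ3 e x a b c d)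
          * linCurvature ((Φ 0).Γ e) ((variation Φ).Γ e) x a b c d) 0 := by
    intro a b c d
    refine (((hdiv a b c d).hasDerivAt.add_const (κ3 e x a b c d)).mul
      (hasDerivAt_curvature (Γ := fun s => (Φ s).Γ e) hU hx (hΦ.Γ e he) a b c d)).congr_deriv ?_
    rw [hR]
    simp only [Pi.zero_apply, mul_zero, zero_add]
    rfl
  rw [heq]
  refine ((hasDerivAt_lagrangian hΦ hf he hx).add (HasDerivAt.fun_sum fun a _ =>
    HasDerivAt.fun_sum fun b _ => HasDerivAt.fun_sum fun c _ => HasDerivAt.fun_sum fun d _ =>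
      hprod a b c d)).congr_deriv ?_
  rw [eomTerm_eq_zero hs he hx, zero_add]
  simp only [add_mul, Finset.sum_add_distrib]
  rw [sum_linCurvature_eq_zero_of_antisymm hU hx hT (h3.smooth e he) (h3a e he) hγ hγT, add_zero,
    ← div_deltaMu hU hx hT hΓ hR (h4.smooth e he) (h4a e he) hγ, ← Finset.sum_add_distrib]
  refine Finset.sum_congr rfl fun a _ => (pd_add a ?_ ?_).symm
  · exact differentiableAt_of_contDiffOn hU hx
      ((contDiffOn_theta (hφ.densityR.smooth e he) hγ a).add (ContDiffOn.sum fun b _ =>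
        ContDiffOn.sum fun c _ => (hφ.contDiffOn_conj hf he a b c).mul (hh b c)))
  · exact differentiableAt_of_contDiffOn hU hx
      (contDiffOn_deltaMu hU hΓ hγ (h4.smooth e he) a)

/-- `L_V Γ = D(∇V)` leaves a flat connection flat to first order, so `δμ` vanishes along it. Both
Lagrangians reduce to `√(-g) f` at zero curvature and torsion. -/
theorem gauge_noetherCurrent (hφ : φ.IsField) (hs : φ.OnShell f) (he : e ∈ atlas (E n) M)
    {V : E n → Ix1 n} (hV : ∀ a, ContDiffOn ℝ ∞ (fun x => V x a) e.target)
    (hx : x ∈ e.target) (a : Fin n) :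
    theta (φ.lamR e x) (lieConnection V (φ.Γ e) x) a
        + thetaMetric (φ.conj f e x) (lieMetric V (φ.g e) x) a
        + deltaMu (κ4 e x) (φ.Γ e) (lieConnection V (φ.Γ e)) x a
        - V x a * (φ.gauge κ4 κ3).lagrangian f e x = φ.noetherCurrent f e V x a := by
  have h1 := linCurvature_lieConnection e.open_target hx (hφ.connection.smooth e he) hV
    (hs.torsionFree e he) (hs.flat e he)
  have hR := hs.flat e he x hx
  have hT := hs.torsionFree e he x hx
  rw [lagrangian_eq_of_flat (φ.gauge κ4 κ3) f hR hT, Config.noetherCurrent,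
    lagrangian_eq_of_flat φ f hR hT]
  simp only [deltaMu, h1, Pi.zero_apply, mul_zero, Finset.sum_const_zero, add_zero]
  rfl

/-- The bivector density whose divergence is the Noether current. -/
def chargeTensor (φ : Config n M) (e : Chart n M) (V : E n → Ix1 n) (y : E n) : Ix2 n :=
  fun a b => (densMat3 (φ.lamR e) a b y * nablaMat (φ.Γ e) V y).trace
    + ∑ d, φ.lamT e y d a b * V y d

theorem lieMetric_eq {g : E n → Ix2 n} {Γ : E n → Ix3 n} {V : E n → Ix1 n}
    (hT : torsion (Γ x) = 0) (hg : ∀ a b, g x a b = g x b a) (b c : Fin n) :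
    lieMetric V g x b c = ∑ h, V x h * nonmetricity g Γ x h b c
      + ∑ h, nablaVec Γ V x b h * g x h c + ∑ h, nablaVec Γ V x c h * g x h b := by
  have hs : ∀ a b c, Γ x a b c = Γ x a c b := fun a b c =>
    sub_eq_zero.mp (congrFun (congrFun (congrFun hT a) b) c)
  have e1 : ∑ h, ∑ k, V x h * (Γ x k h b * g x k c) = ∑ h, ∑ k, Γ x h b k * V x k * g x h c := by
    rw [Finset.sum_comm]
    exact Finset.sum_congr rfl fun h _ => Finset.sum_congr rfl fun k _ => by rw [hs h b k]; ring
  have e2 : ∑ h, ∑ k, V x h * (Γ x k h c * g x b k) = ∑ h, ∑ k, Γ x h c k * V x k * g x h b := by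
    rw [Finset.sum_comm]
    exact Finset.sum_congr rfl fun h _ => Finset.sum_congr rfl fun k _ => by
      rw [hs h c k, hg b h]; ring
  simp only [lieMetric, nonmetricity, nablaVec, Finset.sum_add_distrib, mul_sub, Finset.mul_sum,
    Finset.sum_sub_distrib, add_mul, Finset.sum_mul, e1, e2]
  simp only [hg b]
  simp only [mul_comm (g x _ _)]
  ring

/-- The matrix `√(-g) P^{bc}_a`. -/
def conjMat (φ : Config n M) (f : Ix2 n → Ix3 n → ℝ) (e : Chart n M) (b : Fin n) (y : E n) :
    Mat n := Matrix.of fun c a => ∑ d, φ.conj f e y b c d * φ.g e y d a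

theorem conjMat_eq (hφ : φ.IsField) (hs : φ.OnShell f) (he : e ∈ atlas (E n) M)
    (hx : x ∈ e.target) (b : Fin n) :
    conjMat φ f e b x + ∑ d, covD (connMat (φ.Γ e)) d (densMat3 (φ.lamR e) d b) x =
      densMat2 (φ.lamT e) b x := by
  ext c a
  rw [Matrix.add_apply, div_lamR_eq hφ hs he hx]
  simp [conjMat, densMat2]

theorem msmooth_conjMat [NeZero n] (hφ : φ.IsField) (hf : IsScalarFunction f)
    (he : e ∈ atlas (E n) M) (b : Fin n) : MSmooth e.target (conjMat φ f e b) := by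
  intro c a
  simp only [conjMat, Matrix.of_apply]
  exact ContDiffOn.sum fun d _ =>
    (hφ.contDiffOn_conj hf he b c d).mul (hφ.metric.smooth e he d a)

/-- Taking the covariant divergence of the connection equation removes `λ_R`, since `D D λ_R = 0`.
-/
theorem div_conjMat_eq_div_lamT [NeZero n] (hφ : φ.IsField) (hf : IsScalarFunction f)
    (hs : φ.OnShell f) (he : e ∈ atlas (E n) M) (hx : x ∈ e.target) :
    ∑ b, covD (connMat (φ.Γ e)) b (conjMat φ f e b) x =
      ∑ b, covD (connMat (φ.Γ e)) b (densMat2 (φ.lamT e) b) x := by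
  have hU := e.open_target
  have hΓ := hφ.connection.smooth e he
  have hA := msmooth_connMat hΓ
  have hl := msmooth_densMat3 (hφ.densityR.smooth e he)
  have key : ∀ b, covD (connMat (φ.Γ e)) b (densMat2 (φ.lamT e) b) x =
      covD (connMat (φ.Γ e)) b (conjMat φ f e b) x
      + ∑ d, covD (connMat (φ.Γ e)) b
        (fun y => covD (connMat (φ.Γ e)) d (densMat3 (φ.lamR e) d b) y) x := by
    intro b
    rw [← covD_sum hU hx _ fun d _ => (hl d b).covD hU hA d,
      ← covD_add hU hx (msmooth_conjMat hφ hf he b)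
        (MSmooth.sum _ fun d _ => (hl d b).covD hU hA d)]
    exact covD_congr hU hx b fun y hy => (conjMat_eq hφ hs he hy b).symm
  simp only [key, Finset.sum_add_distrib]
  rw [covD_covD_eq_zero (X := fun c d => densMat3 (φ.lamR e) d c) hU hx hΓ (hs.flat e he x hx)
    (fun c d => hl d c) fun y hy c d => densMat3_antisymm (hφ.antisymmR e he y hy) d c, add_zero]

/-- In the product `P g` the derivative of `P` is converted by the metric equation, and the
derivative of `g` is the non-metricity. This brings the divergence into the form of
`infinitesimal_invariance`. -/
theorem div_conjMat_apply [NeZero n] (hφ : φ.IsField) (hf : IsScalarFunction f)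
    (hs : φ.OnShell f) (he : e ∈ atlas (E n) M) (hx : x ∈ e.target) (a k : Fin n) :
    (∑ b, covD (connMat (φ.Γ e)) b (conjMat φ f e b) x) a k =
      ∑ c, dMetric f (φ.arg e x) a c * φ.g e x c k
      + ∑ b, ∑ c, φ.conj f e x b a c * nonmetricity (φ.g e) (φ.Γ e) x b c k := by
  have hU := e.open_target
  have hT := hs.torsionFree e he x hx
  have hG : ∀ c, dMetric f (φ.arg e x) a c =
      ∑ b, (pd b (fun y => φ.conj f e y b a c) x + ∑ h, φ.Γ e x a b h * φ.conj f e x b h c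
        + ∑ h, φ.Γ e x c b h * φ.conj f e x b a h) := by
    intro c
    have h1 := congrFun (congrFun (hs.metric e he x hx) a) c
    rw [Config.eomMetric, sum_torsion_sub_nablaUpper3] at h1
    simp only [Pi.zero_apply, Finset.sum_add_distrib] at h1 ⊢
    linarith
  have hp : ∀ b, pd b (fun y => conjMat φ f e b y a k) x =
      ∑ c, (pd b (fun y => φ.conj f e y b a c) x * φ.g e x c k
        + φ.conj f e x b a c * pd b (fun y => φ.g e y c k) x) := by
    intro b
    have hd := fun c => differentiableAt_of_contDiffOn hU hx (hφ.contDiffOn_conj hf he b a c)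
    have hdg := fun c => differentiableAt_of_contDiffOn hU hx (hφ.metric.smooth e he c k)
    simp only [conjMat, Matrix.of_apply]
    rw [pd_sum (H := fun c y => φ.conj f e y b a c * φ.g e y c k) _ _
      fun c _ => (hd c).mul (hdg c)]
    exact Finset.sum_congr rfl fun c _ => pd_mul b (hd c) (hdg c)
  have e1 : ∑ b, ∑ h, ∑ d, φ.Γ e x a b h * (φ.conj f e x b h d * φ.g e x d k) =
      ∑ c, ∑ b, ∑ h, φ.Γ e x a b h * φ.conj f e x b h c * φ.g e x c k := by
    rw [sum_rotate3]
    exact Finset.sum_congr rfl fun _ _ => Finset.sum_congr rfl fun _ _ =>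
      Finset.sum_congr rfl fun _ _ => by ring
  have e2 : ∑ b, ∑ h, ∑ d, φ.conj f e x b a d * φ.g e x d h * φ.Γ e x h b k =
      ∑ b, ∑ c, ∑ h, φ.conj f e x b a c * (φ.Γ e x h b k * φ.g e x c h) := by
    refine Finset.sum_congr rfl fun b _ => ?_
    rw [Finset.sum_comm]
    exact Finset.sum_congr rfl fun _ _ => Finset.sum_congr rfl fun _ _ => by ring
  have e3 : ∑ b, ∑ c, ∑ h, φ.conj f e x b a c * (φ.Γ e x h b c * φ.g e x h k) =
      ∑ c, ∑ b, ∑ h, φ.Γ e x c b h * φ.conj f e x b a h * φ.g e x c k := by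
    rw [Finset.sum_comm (s := Finset.univ (α := Fin n)) (f := fun c b => ∑ h,
      φ.Γ e x c b h * φ.conj f e x b a h * φ.g e x c k)]
    refine Finset.sum_congr rfl fun b _ => ?_
    rw [Finset.sum_comm]
    exact Finset.sum_congr rfl fun _ _ => Finset.sum_congr rfl fun _ _ => by ring
  have e4 : ∑ b, ∑ c, pd b (fun y => φ.conj f e y b a c) x * φ.g e x c k =
      ∑ c, ∑ b, pd b (fun y => φ.conj f e y b a c) x * φ.g e x c k := Finset.sum_comm
  simp only [Matrix.sum_apply, covD, Matrix.sub_apply, Matrix.add_apply, pdM_apply, hp,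
    Matrix.mul_apply, hG, nonmetricity]
  simp only [conjMat, connMat, Matrix.of_apply, Finset.sum_add_distrib, Finset.sum_sub_distrib,
    Finset.mul_sum, Finset.sum_mul, mul_sub, add_mul, e1, e2, e3, e4]
  ring

theorem div_lamT_apply (hφ : φ.IsField) (hs : φ.OnShell f) (he : e ∈ atlas (E n) M)
    (hx : x ∈ e.target) (a k : Fin n) :
    (∑ b, covD (connMat (φ.Γ e)) b (densMat2 (φ.lamT e) b) x) a k =
      -∑ b, pd b (fun y => φ.lamT e y k a b) x
        + ∑ b, ∑ h, φ.lamT e x h a b * φ.Γ e x h b k := by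
  have hsym : ∀ a b c, φ.Γ e x a b c = φ.Γ e x a c b := fun a b c =>
    sub_eq_zero.mp (congrFun (congrFun (congrFun (hs.torsionFree e he x hx) a) b) c)
  have z : ∑ b, ∑ h, φ.Γ e x a b h * φ.lamT e x k b h = 0 :=
    sum_sum_eq_zero_of_antisymm fun i j => by
      rw [hsym a i j, hφ.antisymmT e he x hx k i j]; ring
  have hp : ∀ b, pd b (fun y => φ.lamT e y k b a) x = -pd b (fun y => φ.lamT e y k a b) x := by
    intro b
    rw [pd_congr e.open_target hx b fun y hy => hφ.antisymmT e he y hy k b a, pd_neg]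
  simp only [Matrix.sum_apply, covD, Matrix.sub_apply, Matrix.add_apply, pdM_apply,
    Matrix.mul_apply, densMat2, connMat, Matrix.of_apply, Finset.sum_add_distrib,
    Finset.sum_sub_distrib, hp, z]
  simp only [hφ.antisymmT e he x hx _ _ a, neg_mul, Finset.sum_neg_distrib]
  ring

/-- The Leibniz rule on `tr(λ_R ∇V)` reproduces `Θ` and, through the connection equation, the part
of `P L_V g` containing `∇V`, up to `tr(λ_T ∇V)`. The Leibniz rule on `λ_T V` absorbs that. The
leftover is algebraic in `V` and cancels against `V^a L` by frame invariance. -/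
theorem noetherCurrent_eq [NeZero n] (hφ : φ.IsField) (hf : IsScalarFunction f)
    (hs : φ.OnShell f) (he : e ∈ atlas (E n) M)
    {V : E n → Ix1 n} (hV : ∀ a, ContDiffOn ℝ ∞ (fun x => V x a) e.target)
    (hx : x ∈ e.target) (a : Fin n) :
    φ.noetherCurrent f e V x a = 2 * ∑ b, pd b (fun y => chargeTensor φ e V y a b) x := by
  have hU := e.open_target
  have hΓ := hφ.connection.smooth e he
  have hT := hs.torsionFree e he
  have hl := msmooth_densMat3 (hφ.densityR.smooth e he)
  have hN := msmooth_nablaMat hU hΓ hV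
  have hdT := fun a b c => differentiableAt_of_contDiffOn hU hx (hφ.densityT.smooth e he a b c)
  have hdV := fun a => differentiableAt_of_contDiffOn hU hx (hV a)
  have hX : ∀ b, pd b (fun y => chargeTensor φ e V y a b) x =
      (covD (connMat (φ.Γ e)) b (densMat3 (φ.lamR e) a b) x * nablaMat (φ.Γ e) V x).trace
      + (densMat3 (φ.lamR e) a b x * covD (connMat (φ.Γ e)) b (nablaMat (φ.Γ e) V) x).trace
      + ∑ d, (pd b (fun y => φ.lamT e y d a b) x * V x d
        + φ.lamT e x d a b * pd b (fun y => V y d) x) := by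
    intro b
    simp only [chargeTensor]
    rw [pd_add (G := fun y => ∑ d, φ.lamT e y d a b * V y d) b
      (differentiableAt_of_contDiffOn hU hx ((hl a b).mul hN).trace)
      (DifferentiableAt.fun_sum fun d _ => (hdT d a b).mul (hdV d)),
      pd_trace_mul hU hx (hl a b) hN b,
      pd_sum (H := fun d y => φ.lamT e y d a b * V y d) _ _
        fun d _ => (hdT d a b).mul (hdV d)]
    congr 1
    exact Finset.sum_congr rfl fun d _ => pd_mul b (hdT d a b) (hdV d)
  have hθ : theta (φ.lamR e x) (lieConnection V (φ.Γ e) x) a =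
      2 * ∑ b, (densMat3 (φ.lamR e) a b x
        * covD (connMat (φ.Γ e)) b (nablaMat (φ.Γ e) V) x).trace := by
    rw [theta_eq (φ.lamR e) (lieConnection V (φ.Γ e)) x a]
    congr 1
    refine Finset.sum_congr rfl fun b _ => ?_
    congr 2
    ext c d
    exact lieConnection_eq hU hx hΓ hV hT (hs.flat e he x hx) c b d
  have hPs := hφ.conj_symm hf he hx
  have hθg : thetaMetric (φ.conj f e x) (lieMetric V (φ.g e) x) a =
      ∑ k, V x k * ∑ b, ∑ c, φ.conj f e x a b c * nonmetricity (φ.g e) (φ.Γ e) x k b c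
      + 2 * (conjMat φ f e a x * nablaMat (φ.Γ e) V x).trace := by
    have e0 : (conjMat φ f e a x * nablaMat (φ.Γ e) V x).trace =
        ∑ b, ∑ c, ∑ h, φ.conj f e x a b c * (nablaVec (φ.Γ e) V x b h * φ.g e x h c) := by
      simp only [Matrix.trace, Matrix.diag, Matrix.mul_apply, conjMat, nablaMat, Matrix.of_apply,
        Finset.sum_mul]
      refine Finset.sum_congr rfl fun b _ => ?_
      rw [Finset.sum_comm]
      exact Finset.sum_congr rfl fun c _ => Finset.sum_congr rfl fun h _ => by
        rw [hφ.metric_symm he hx c h]; ring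
    have e1 : ∑ b, ∑ c, ∑ h, φ.conj f e x a b c * (nablaVec (φ.Γ e) V x c h * φ.g e x h b) =
        ∑ b, ∑ c, ∑ h, φ.conj f e x a b c * (nablaVec (φ.Γ e) V x b h * φ.g e x h c) := by
      rw [Finset.sum_comm]
      exact Finset.sum_congr rfl fun b _ => Finset.sum_congr rfl fun c _ =>
        Finset.sum_congr rfl fun h _ => by rw [hPs]
    have e2 : ∑ b, ∑ c, ∑ h, φ.conj f e x a b c * (V x h * nonmetricity (φ.g e) (φ.Γ e) x h b c) =
        ∑ k, ∑ b, ∑ c, V x k * (φ.conj f e x a b c * nonmetricity (φ.g e) (φ.Γ e) x k b c) := by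
      rw [sum_rotate3]
      exact Finset.sum_congr rfl fun b _ => Finset.sum_congr rfl fun c _ =>
        Finset.sum_congr rfl fun h _ => by ring
    simp only [thetaMetric, lieMetric_eq (hT x hx) (hφ.metric_symm he hx), mul_add,
      Finset.sum_add_distrib, Finset.mul_sum]
    rw [e0, e1, e2]
    simp only [Finset.mul_sum]
    simp only [two_mul, Finset.sum_add_distrib]
    ring
  have hL : φ.lagrangian f e x = mainDensity f (φ.arg e x) := by
    rw [lagrangian_eq_of_flat φ f (hs.flat e he x hx) (hT x hx), Config.arg,
      mainDensity_of_symm f (hφ.metric_symm he hx) (hφ.nonmetricity_symm he hx)]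
  -- The connection equation with the divergence index of `λ_R` moved to the last place, which flips
  -- its sign.
  have hp : conjMat φ f e a x = densMat2 (φ.lamT e) a x
      + ∑ b, covD (connMat (φ.Γ e)) b (densMat3 (φ.lamR e) a b) x := by
    rw [← conjMat_eq hφ hs he hx a, add_assoc, ← Finset.sum_add_distrib, Finset.sum_eq_zero,
      add_zero]
    intro d _
    rw [covD_antisymm hU hx (fun y hy => densMat3_antisymm (hφ.antisymmR e he y hy) a d) d,
      add_neg_cancel]
  -- The coefficient of `V^k` in the remainder. The divergence of `λ_T` equals that of `P`, which
  -- the metric equation evaluates; frame invariance then gives `δ^a_k L`.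
  have hinv : ∀ k, ∑ b, ∑ c, φ.conj f e x a b c * nonmetricity (φ.g e) (φ.Γ e) x k b c
      + 2 * (-∑ b, pd b (fun y => φ.lamT e y k a b) x
        + ∑ b, ∑ h, φ.lamT e x h a b * φ.Γ e x h b k) =
      if a = k then mainDensity f (φ.arg e x) else 0 := by
    intro k
    rw [← div_lamT_apply hφ hs he hx, ← div_conjMat_eq_div_lamT hφ hf hs he hx,
      div_conjMat_apply hφ hf hs he hx]
    refine Eq.trans ?_ (infinitesimal_invariance hf (hφ.metric.lorentzian e he x hx)
      (hφ.nonmetricity_symm he hx) a k)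
    simp only [Config.conj, Config.arg]
    ring
  have hinv' : ∑ k, V x k * ∑ b, ∑ c, φ.conj f e x a b c
        * nonmetricity (φ.g e) (φ.Γ e) x k b c
      + 2 * (-∑ b, ∑ k, pd b (fun y => φ.lamT e y k a b) x * V x k
        + ∑ b, ∑ k, ∑ h, φ.lamT e x h a b * φ.Γ e x h b k * V x k) =
      V x a * mainDensity f (φ.arg e x) := by
    have h1 : ∑ k, V x k * (∑ b, ∑ c, φ.conj f e x a b c * nonmetricity (φ.g e) (φ.Γ e) x k b c
      + 2 * (-∑ b, pd b (fun y => φ.lamT e y k a b) x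
        + ∑ b, ∑ h, φ.lamT e x h a b * φ.Γ e x h b k)) = V x a * mainDensity f (φ.arg e x) := by
      simp [hinv]
    rw [← h1, Finset.sum_comm (f := fun b k => pd b (fun y => φ.lamT e y k a b) x * V x k),
      Finset.sum_comm (f := fun b k => ∑ h, φ.lamT e x h a b * φ.Γ e x h b k * V x k)]
    simp only [← Finset.sum_mul]
    rw [← Finset.sum_neg_distrib, ← Finset.sum_add_distrib, Finset.mul_sum,
      ← Finset.sum_add_distrib]
    exact Finset.sum_congr rfl fun k _ => by ring
  have htr : (densMat2 (φ.lamT e) a x * nablaMat (φ.Γ e) V x).trace =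
      ∑ b, ∑ d, φ.lamT e x d a b * pd b (fun y => V y d) x
      + ∑ b, ∑ k, ∑ h, φ.lamT e x h a b * φ.Γ e x h b k * V x k := by
    simp only [Matrix.trace, Matrix.diag, Matrix.mul_apply, densMat2, nablaMat, Matrix.of_apply,
      nablaVec, mul_add, Finset.sum_add_distrib, Finset.mul_sum]
    congr 1
    refine Finset.sum_congr rfl fun b _ => ?_
    rw [Finset.sum_comm]
    exact Finset.sum_congr rfl fun _ _ => Finset.sum_congr rfl fun _ _ => by ring
  rw [Config.noetherCurrent, hθ, hθg, hL, ← hinv', hp]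
  simp only [add_mul, Matrix.trace_add, htr, hX, Finset.sum_add_distrib, Finset.sum_mul,
    Matrix.trace_sum]
  ring

end OnShell

/-! ### Exterior calculus with the antisymmetric symbol -/

section Exterior

variable {n k : ℕ}

/-- The exterior product `u ∧ α` of a covector and a form. -/
def wedge (u : E n →L[ℝ] ℝ) (α : E n [⋀^Fin k]→L[ℝ] ℝ) : E n [⋀^Fin (k + 1)]→L[ℝ] ℝ :=
  ContinuousAlternatingMap.alternatizeUncurryFin (u.smulRight α)

theorem wedge_apply (u : E n →L[ℝ] ℝ) (α : E n [⋀^Fin k]→L[ℝ] ℝ) (v : Fin (k + 1) → E n) :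
    wedge u α v = ∑ i : Fin (k + 1), (-1 : ℝ) ^ (i : ℕ) * (u (v i) * α (i.removeNth v)) := by
  simp [wedge, ContinuousAlternatingMap.alternatizeUncurryFin_apply]

/-- Contraction is an antiderivation. Since `u ∧ ε = 0` in top degree, iterating this expresses `u
∧` a contraction of `ε` by fewer contractions, and so computes exterior derivatives of forms built
from `ε`. -/
theorem wedge_curryLeft (u : E n →L[ℝ] ℝ) (α : E n [⋀^Fin (k + 1)]→L[ℝ] ℝ) (a : E n) :
    wedge u (α.curryLeft a) = u a • α - (wedge u α).curryLeft a := by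
  ext v
  have h : ∀ i : Fin (k + 1), i.succ.removeNth (Matrix.vecCons a v) =
      Matrix.vecCons a (i.removeNth v) := by
    intro i
    ext1 j
    refine Fin.cases ?_ (fun j => ?_) j
    · simp [Fin.removeNth]
    · simp [Fin.removeNth]
  have h0 : (0 : Fin (k + 2)).removeNth (Matrix.vecCons a v) = v := by
    ext1 j; simp [Fin.removeNth]
  simp only [ContinuousAlternatingMap.sub_apply, ContinuousAlternatingMap.smul_apply,
    ContinuousAlternatingMap.curryLeft_apply_apply, wedge_apply]
  rw [Fin.sum_univ_succ (n := k + 1)]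
  simp only [h, h0, Matrix.cons_val_zero, Matrix.cons_val_succ, Fin.val_succ, pow_succ,
    Fin.val_zero, pow_zero, smul_eq_mul]
  simp only [mul_neg, mul_one, neg_mul, Finset.sum_neg_distrib, one_mul]
  ring

theorem wedge_top (u : E n →L[ℝ] ℝ) (α : E n [⋀^Fin n]→L[ℝ] ℝ) : wedge u α = 0 := by
  ext v
  refine (wedge u α).map_linearDependent v fun h => ?_
  have := h.fintype_card_le_finrank
  simp at this

theorem wedge_curryLeft_top (u : E (n + 1) →L[ℝ] ℝ) (α : E (n + 1) [⋀^Fin (n + 1)]→L[ℝ] ℝ)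
    (a : E (n + 1)) : wedge u (α.curryLeft a) = u a • α := by
  rw [wedge_curryLeft, wedge_top]
  ext v; simp

theorem curryLeft_smul' (r : ℝ) (α : E n [⋀^Fin (k + 1)]→L[ℝ] ℝ) (a : E n) :
    (r • α).curryLeft a = r • α.curryLeft a := rfl

theorem wedge_curryLeft_curryLeft_top (u : E (n + 2) →L[ℝ] ℝ)
    (α : E (n + 2) [⋀^Fin (n + 2)]→L[ℝ] ℝ) (a b : E (n + 2)) :
    wedge u ((α.curryLeft a).curryLeft b) = u b • α.curryLeft a - u a • α.curryLeft b := by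
  rw [wedge_curryLeft, wedge_curryLeft_top, curryLeft_smul']

theorem wedge_curryLeft_three_top (u : E (n + 3) →L[ℝ] ℝ)
    (α : E (n + 3) [⋀^Fin (n + 3)]→L[ℝ] ℝ) (a b c : E (n + 3)) :
    wedge u (((α.curryLeft a).curryLeft b).curryLeft c) =
      u c • (α.curryLeft a).curryLeft b - u b • (α.curryLeft a).curryLeft c
        + u a • (α.curryLeft b).curryLeft c := by
  rw [wedge_curryLeft, wedge_curryLeft_curryLeft_top]
  ext v
  simp only [ContinuousAlternatingMap.sub_apply, ContinuousAlternatingMap.smul_apply,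
    ContinuousAlternatingMap.add_apply, ContinuousAlternatingMap.curryLeft_apply_apply, smul_eq_mul]
  ring

theorem extDeriv_sum_smul {ι : Type*} (s : Finset ι) {F : ι → E n → ℝ}
    {α : ι → E n [⋀^Fin k]→L[ℝ] ℝ} {x : E n} (hF : ∀ i ∈ s, DifferentiableAt ℝ (F i) x) :
    extDeriv (fun y => ∑ i ∈ s, F i y • α i) x = ∑ i ∈ s, wedge (fderiv ℝ (F i) x) (α i) := by
  have h : HasFDerivAt (fun y => ∑ i ∈ s, F i y • α i)
      (∑ i ∈ s, (fderiv ℝ (F i) x).smulRight (α i)) x :=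
    HasFDerivAt.fun_sum fun i hi => (hF i hi).hasFDerivAt.smul_const (α i)
  rw [extDeriv, h.fderiv, ← ContinuousAlternatingMap.alternatizeUncurryFinCLM_apply, map_sum]
  rfl

variable {m : ℕ}

/-- The basis of the `(n-1)`-forms given by the antisymmetric symbol. -/
def epsBasis1 (a : Fin (m + 2)) : E (m + 2) [⋀^Fin (m + 1)]→L[ℝ] ℝ :=
  (eps (m + 2)).curryLeft (basisVec a)

/-- The spanning set of the `(n-2)`-forms given by the antisymmetric symbol. -/
def epsBasis2 (a b : Fin (m + 2)) : E (m + 2) [⋀^Fin m]→L[ℝ] ℝ :=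
  ((eps (m + 2)).curryLeft (basisVec a)).curryLeft (basisVec b)

/-- The spanning set of the `(n-3)`-forms given by the antisymmetric symbol. -/
def epsBasis3 (a b c : Fin (m + 1 + 2)) : E (m + 1 + 2) [⋀^Fin m]→L[ℝ] ℝ :=
  (((eps (m + 1 + 2)).curryLeft (basisVec a)).curryLeft (basisVec b)).curryLeft (basisVec c)

/-- The `(n-3)`-form `ε_{abc a_4 ... a_n} Z^{abc}`. -/
def epsForm3 (Z : Ix3 (m + 1 + 2)) : E (m + 1 + 2) [⋀^Fin m]→L[ℝ] ℝ :=
  ∑ a, ∑ b, ∑ c, Z a b c • epsBasis3 a b c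

theorem epsForm1_def (J : Ix1 (m + 2)) : epsForm1 J = ∑ a, J a • epsBasis1 a := rfl

theorem epsForm2_def (X : Ix2 (m + 2)) : epsForm2 X = ∑ a, ∑ b, X a b • epsBasis2 a b := rfl

theorem epsBasis2_swap (a b : Fin (m + 2)) : epsBasis2 a b = -epsBasis2 b a := by
  ext v
  have h := (eps (m + 2)).toAlternatingMap.map_swap (Matrix.vecCons (basisVec b) (Matrix.vecCons (basisVec a) v))
    (i := 0) (j := 1) (by simp)
  simp only [epsBasis2, ContinuousAlternatingMap.curryLeft_apply_apply,
    ContinuousAlternatingMap.neg_apply]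
  refine Eq.trans ?_ h
  change eps (m + 2) _ = eps (m + 2) _
  congr 1
  ext1 j
  refine Fin.cases ?_ (fun j => Fin.cases ?_ (fun j => ?_) j) j
  · simp
  · simp
  · have h0 : (j.succ.succ : Fin (m + 2)) ≠ 0 := Fin.succ_ne_zero _
    have h1 : (j.succ.succ : Fin (m + 2)) ≠ 1 := by
      intro h; exact Fin.succ_ne_zero j (Fin.succ_injective _ h)
    simp only [Function.comp_apply, Equiv.swap_apply_of_ne_of_ne h0 h1]
    simp

/-- The two contractions contribute `∂_b X^{ab} ε_a - ∂_a X^{ab} ε_b`. Antisymmetry makes both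
halves equal, whence the factor `2`; with three indices the same mechanism gives the factor `3`. -/
theorem extDeriv_epsForm2 {X : E (m + 2) → Ix2 (m + 2)} {U : Set (E (m + 2))} {x : E (m + 2)}
    (hU : IsOpen U) (hx : x ∈ U) (hX : ∀ a b, ContDiffOn ℝ ∞ (fun y => X y a b) U)
    (h : ∀ y ∈ U, ∀ a b, X y a b = -X y b a) :
    extDeriv (fun y => epsForm2 (X y)) x =
      epsForm1 fun a => 2 * ∑ b, pd b (fun y => X y a b) x := by
  have hd : ∀ a b, DifferentiableAt ℝ (fun y => X y a b) x := fun a b =>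
    differentiableAt_of_contDiffOn hU hx (hX a b)
  have h1 := extDeriv_sum_smul (Finset.univ : Finset (Fin (m + 2) × Fin (m + 2)))
    (F := fun p y => X y p.1 p.2) (α := fun p => epsBasis2 p.1 p.2) (x := x) fun p _ => hd _ _
  simp only [Fintype.sum_prod_type] at h1
  simp only [epsForm2_def, epsForm1_def, h1]
  have h2 : ∀ a b, wedge (fderiv ℝ (fun y => X y a b) x) (epsBasis2 a b) =
      pd b (fun y => X y a b) x • epsBasis1 a - pd a (fun y => X y a b) x • epsBasis1 b :=
    fun a b => wedge_curryLeft_curryLeft_top _ _ _ _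
  have h3 : ∀ a b, pd a (fun y => X y a b) x = -pd a (fun y => X y b a) x := fun a b => by
    rw [pd_congr hU hx a fun y hy => h y hy a b, pd_neg]
  simp only [h2, Finset.sum_sub_distrib]
  rw [Finset.sum_comm (f := fun a b => pd a (fun y => X y a b) x • epsBasis1 b)]
  simp only [h3, neg_smul, Finset.sum_neg_distrib, sub_neg_eq_add, two_mul, add_smul,
    Finset.sum_add_distrib, ← Finset.sum_smul]

theorem extDeriv_epsForm3 {Z : E (m + 1 + 2) → Ix3 (m + 1 + 2)} {U : Set (E (m + 1 + 2))}
    {x : E (m + 1 + 2)}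
    (hU : IsOpen U) (hx : x ∈ U) (hZ : ∀ a b c, ContDiffOn ℝ ∞ (fun y => Z y a b c) U)
    (h : ∀ y ∈ U, ∀ a b c, Z y a b c = -Z y b a c ∧ Z y a b c = -Z y a c b) :
    extDeriv (fun y => epsForm3 (Z y)) x =
      (3 : ℝ) • epsForm2 fun a b => ∑ c, pd c (fun y => Z y a b c) x := by
  have hd : ∀ a b c, DifferentiableAt ℝ (fun y => Z y a b c) x := fun a b c =>
    differentiableAt_of_contDiffOn hU hx (hZ a b c)
  have h1 := extDeriv_sum_smul
    (Finset.univ : Finset (Fin (m + 1 + 2) × Fin (m + 1 + 2) × Fin (m + 1 + 2)))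
    (F := fun p y => Z y p.1 p.2.1 p.2.2) (α := fun p => epsBasis3 p.1 p.2.1 p.2.2) (x := x)
    fun p _ => hd _ _ _
  simp only [Fintype.sum_prod_type] at h1
  simp only [epsForm2_def, epsForm3, h1]
  have h2 : ∀ a b c, wedge (fderiv ℝ (fun y => Z y a b c) x) (epsBasis3 a b c) =
      pd c (fun y => Z y a b c) x • epsBasis2 a b - pd b (fun y => Z y a b c) x • epsBasis2 a c
        + pd a (fun y => Z y a b c) x • epsBasis2 b c :=
    fun a b c => wedge_curryLeft_three_top (n := m) _ _ _ _ _
  have h3 : ∀ a b c, pd b (fun y => Z y a b c) x = -pd b (fun y => Z y a c b) x :=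
    fun a b c => by
      rw [pd_congr hU hx b fun y hy => (h y hy a b c).2, pd_neg]
  have h4 : ∀ a b c, pd a (fun y => Z y a b c) x = pd a (fun y => Z y b c a) x :=
    fun a b c => pd_congr hU hx a fun y hy => by
      rw [(h y hy a b c).1, (h y hy b a c).2, neg_neg]
  have e1 : ∑ a, ∑ b, ∑ c, pd b (fun y => Z y a b c) x • epsBasis2 a c =
      -∑ a, ∑ b, ∑ c, pd c (fun y => Z y a b c) x • epsBasis2 a b := by
    rw [← Finset.sum_neg_distrib]
    refine Finset.sum_congr rfl fun a _ => ?_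
    rw [Finset.sum_comm, ← Finset.sum_neg_distrib]
    refine Finset.sum_congr rfl fun b _ => ?_
    rw [← Finset.sum_neg_distrib]
    exact Finset.sum_congr rfl fun c _ => by
      rw [h3 a c b]
      exact neg_smul (M := E (m + 1 + 2) [⋀^Fin (m + 1)]→L[ℝ] ℝ) _ _
  have e2 : ∑ a, ∑ b, ∑ c, pd a (fun y => Z y a b c) x • epsBasis2 b c =
      ∑ a, ∑ b, ∑ c, pd c (fun y => Z y a b c) x • epsBasis2 a b := by
    rw [sum_rotate3 (fun a b c => pd c (fun y => Z y a b c) x • epsBasis2 a b)]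
    exact Finset.sum_congr rfl fun a _ => Finset.sum_congr rfl fun b _ =>
      Finset.sum_congr rfl fun c _ => by rw [h4 a b c]
  simp only [h2, Finset.sum_add_distrib, Finset.sum_sub_distrib, e1, e2, Finset.sum_smul]
  module

/-! ### Pullback of forms built from tensor densities -/

theorem eps_comp (n : ℕ) (L : E n →L[ℝ] E n) (v : Fin n → E n) :
    eps n (fun i => L (v i)) = LinearMap.det (L : E n →ₗ[ℝ] E n) * eps n v :=
  (EuclideanSpace.basisFun (Fin n) ℝ).toBasis.det_comp (L : E n →ₗ[ℝ] E n) v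

theorem det_eq_of_entries {n : ℕ} (L : E n →L[ℝ] E n) {J : Ix2 n}
    (hJ : ∀ a A, L (basisVec a) A = J A a) :
    LinearMap.det (L : E n →ₗ[ℝ] E n) = (Matrix.of J).det := by
  rw [← LinearMap.det_toMatrix (EuclideanSpace.basisFun (Fin n) ℝ).toBasis]
  congr 1
  ext A a
  rw [LinearMap.toMatrix_apply]
  simp [← hJ]

theorem clm_basisVec {n : ℕ} (L : E n →L[ℝ] E n) {J : Ix2 n}
    (hJ : ∀ a A, L (basisVec a) A = J A a) (a : Fin n) :
    L (basisVec a) = ∑ A, J A a • (basisVec A : E n) := by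
  ext i
  simp [hJ, Pi.single_apply]

theorem eps_compContinuousLinearMap (n : ℕ) (L : E n →L[ℝ] E n) {J : Ix2 n}
    (hJ : ∀ a A, L (basisVec a) A = J A a) :
    (eps n).compContinuousLinearMap L = (Matrix.of J).det • eps n := by
  ext v
  exact (eps_comp n L v).trans (by rw [det_eq_of_entries L hJ]; rfl)

theorem sum_smul_curryLeft {n k : ℕ} {ι : Type*} (s : Finset ι) (r : ι → ℝ)
    (α : ι → E n [⋀^Fin (k + 1)]→L[ℝ] ℝ) (w : E n) :
    (∑ i ∈ s, r i • α i).curryLeft w = ∑ i ∈ s, r i • (α i).curryLeft w := by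
  ext v
  simp only [ContinuousAlternatingMap.curryLeft_apply_apply, ContinuousAlternatingMap.sum_apply,
    ContinuousAlternatingMap.smul_apply]

theorem compContinuousLinearMap_sum_smul {n k : ℕ} {ι : Type*} (s : Finset ι) (r : ι → ℝ)
    (α : ι → E n [⋀^Fin k]→L[ℝ] ℝ) {n' : ℕ} (L : E n' →L[ℝ] E n) :
    (∑ i ∈ s, r i • α i).compContinuousLinearMap L =
      ∑ i ∈ s, r i • (α i).compContinuousLinearMap L := by
  ext v
  simp only [ContinuousAlternatingMap.compContinuousLinearMap_apply,
    ContinuousAlternatingMap.sum_apply, ContinuousAlternatingMap.smul_apply]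

theorem sum_comm33 {ι W : Type*} [Fintype ι] [AddCommMonoid W] (F : ι → ι → ι → ι → ι → ι → W) :
    ∑ a, ∑ b, ∑ c, ∑ i, ∑ j, ∑ k, F a b c i j k = ∑ i, ∑ j, ∑ k, ∑ a, ∑ b, ∑ c, F a b c i j k := by
  have h := Finset.sum_comm (s := (Finset.univ : Finset (ι × ι × ι)))
    (t := (Finset.univ : Finset (ι × ι × ι)))
    (f := fun p q => F p.1 p.2.1 p.2.2 q.1 q.2.1 q.2.2)
  simpa only [Fintype.sum_prod_type] using h

/-- Pulling back `ε` produces the Jacobian determinant, which the density weight cancels. Positivity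
of the determinant is needed because the weight involves its absolute value. -/
theorem epsForm2_pullback (L : E (m + 2) →L[ℝ] E (m + 2)) {J : Ix2 (m + 2)}
    (hJ : ∀ a A, L (basisVec a) A = J A a) (hdet : 0 < (Matrix.of J).det)
    {X X' : Ix2 (m + 2)} (hX : ∀ A B, |(Matrix.of J).det| * X' A B =
      ∑ a, ∑ b, J A a * J B b * X a b) :
    (epsForm2 X').compContinuousLinearMap L = epsForm2 X := by
  have key : ∀ a b, (Matrix.of J).det • epsBasis2 a b =
      ∑ A, ∑ B, (J A a * J B b) • (epsBasis2 A B).compContinuousLinearMap L := by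
    intro a b
    have h1 : (Matrix.of J).det • epsBasis2 a b =
        (((eps (m + 2)).curryLeft (L (basisVec a))).curryLeft
          (L (basisVec b))).compContinuousLinearMap L := by
      rw [← ContinuousAlternatingMap.curryLeft_compContinuousLinearMap,
        ← ContinuousAlternatingMap.curryLeft_compContinuousLinearMap,
        eps_compContinuousLinearMap (m + 2) L hJ]
      rfl
    rw [h1, clm_basisVec L hJ a, map_sum]
    simp only [map_smul, sum_smul_curryLeft, compContinuousLinearMap_sum_smul]
    refine Finset.sum_congr rfl fun A _ => ?_
    rw [clm_basisVec L hJ b, map_sum]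
    simp only [map_smul, compContinuousLinearMap_sum_smul, Finset.smul_sum, smul_smul]
    rfl
  -- Both sides are compared after multiplication by the determinant, so the inverse Jacobian never
  -- appears.
  have h2 : (Matrix.of J).det • (epsForm2 X').compContinuousLinearMap L =
      (Matrix.of J).det • epsForm2 X := by
    rw [abs_of_pos hdet] at hX
    simp only [epsForm2_def, Finset.smul_sum, smul_comm _ (X _ _), key]
    rw [sum_rotate4, sum_rotate4]
    simp only [smul_smul, ← Finset.sum_smul]
    ext v
    simp only [ContinuousAlternatingMap.compContinuousLinearMap_apply,
      ContinuousAlternatingMap.sum_apply, ContinuousAlternatingMap.smul_apply, smul_eq_mul,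
      ← mul_assoc, hX, Finset.mul_sum, mul_comm (X _ _)]
  exact smul_right_injective _ hdet.ne' h2

theorem epsForm3_pullback (L : E (m + 1 + 2) →L[ℝ] E (m + 1 + 2)) {J : Ix2 (m + 1 + 2)}
    (hJ : ∀ a A, L (basisVec a) A = J A a) (hdet : 0 < (Matrix.of J).det)
    {Z Z' : Ix3 (m + 1 + 2)} (hZ : ∀ A B C, |(Matrix.of J).det| * Z' A B C =
      ∑ a, ∑ b, ∑ c, J A a * J B b * J C c * Z a b c) :
    (epsForm3 Z').compContinuousLinearMap L = epsForm3 Z := by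
  have key : ∀ a b c, (Matrix.of J).det • epsBasis3 (m := m) a b c =
      ∑ A, ∑ B, ∑ C, (J A a * J B b * J C c) •
        (epsBasis3 (m := m) A B C).compContinuousLinearMap L := by
    intro a b c
    have h1 : (Matrix.of J).det • epsBasis3 (m := m) a b c =
        ((((eps (m + 1 + 2)).curryLeft (L (basisVec a))).curryLeft
          (L (basisVec b))).curryLeft (L (basisVec c))).compContinuousLinearMap L := by
      rw [← ContinuousAlternatingMap.curryLeft_compContinuousLinearMap,
        ← ContinuousAlternatingMap.curryLeft_compContinuousLinearMap,
        ← ContinuousAlternatingMap.curryLeft_compContinuousLinearMap,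
        eps_compContinuousLinearMap (m + 1 + 2) L hJ]
      rfl
    rw [h1, clm_basisVec L hJ a, map_sum]
    simp only [map_smul, sum_smul_curryLeft, compContinuousLinearMap_sum_smul]
    refine Finset.sum_congr rfl fun A _ => ?_
    rw [clm_basisVec L hJ b, map_sum]
    simp only [map_smul, sum_smul_curryLeft, compContinuousLinearMap_sum_smul, Finset.smul_sum]
    refine Finset.sum_congr rfl fun B _ => ?_
    rw [clm_basisVec L hJ c, map_sum]
    simp only [map_smul, compContinuousLinearMap_sum_smul, Finset.smul_sum, smul_smul, mul_assoc]
    rfl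
  have h2 : (Matrix.of J).det • (epsForm3 Z').compContinuousLinearMap L =
      (Matrix.of J).det • epsForm3 (m := m) Z := by
    rw [abs_of_pos hdet] at hZ
    simp only [epsForm3, Finset.smul_sum, smul_comm _ (Z _ _ _), key]
    rw [sum_comm33]
    simp only [smul_smul, ← Finset.sum_smul]
    ext v
    simp only [ContinuousAlternatingMap.compContinuousLinearMap_apply,
      ContinuousAlternatingMap.sum_apply, ContinuousAlternatingMap.smul_apply, smul_eq_mul,
      ← mul_assoc, hZ, Finset.mul_sum, mul_comm (Z _ _ _)]
  exact smul_right_injective _ hdet.ne' h2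

end Exterior

/-! ### Coordinate changes -/

section CoordinateChange

variable {n : ℕ} {M : Type*} [TopologicalSpace M] {e e' : Chart n M} {x : E n}

theorem isOpen_overlap (e e' : Chart n M) : IsOpen (overlap e e') :=
  e.isOpen_inter_preimage_symm e'.open_source

theorem trans_mem_target (hx : x ∈ overlap e e') : trans e e' x ∈ e'.target :=
  e'.map_source hx.2

theorem trans_mem_overlap (hx : x ∈ overlap e e') : trans e e' x ∈ overlap e' e := by
  refine ⟨trans_mem_target hx, ?_⟩
  have : e'.symm (trans e e' x) = e.symm x := e'.left_inv hx.2
  rw [Set.mem_preimage, this]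
  exact e.map_target hx.1

theorem trans_trans (hx : x ∈ overlap e e') : trans e' e (trans e e' x) = x := by
  have : e'.symm (trans e e' x) = e.symm x := e'.left_inv hx.2
  rw [trans, this]
  exact e.right_inv hx.1

theorem fderiv_trans_basisVec (h : DifferentiableAt ℝ (trans e e') x) (a A : Fin n) :
    fderiv ℝ (trans e e') x (basisVec a) A = jac e e' x A a := by
  have h1 : HasFDerivAt (fun y => trans e e' y A)
      ((EuclideanSpace.proj A : E n →L[ℝ] ℝ).comp (fderiv ℝ (trans e e') x)) x :=
    (EuclideanSpace.proj A : E n →L[ℝ] ℝ).hasFDerivAt.comp x h.hasFDerivAt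
  rw [jac, pd, h1.fderiv]
  rfl

theorem pd_comp_trans (h : DifferentiableAt ℝ (trans e e') x) {F : E n → ℝ}
    (hF : DifferentiableAt ℝ F (trans e e' x)) (a : Fin n) :
    pd a (fun y => F (trans e e' y)) x = ∑ A, jac e e' x A a * pd A F (trans e e' x) := by
  have h1 : HasFDerivAt (fun y => F (trans e e' y)) _ x := hF.hasFDerivAt.comp x h.hasFDerivAt
  rw [pd, h1.fderiv, ContinuousLinearMap.comp_apply, fderiv_apply_eq_sum_pd]
  simp only [fderiv_trans_basisVec h]

/-- `N'` is conjugate to `N` by `J`, and the trace is invariant under conjugation. `S` stands for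
the transformed density before the endomorphism indices are changed. -/
theorem det_mul_trace_eq {J N N' L' S : Mat n} (hJ : J.det ≠ 0) {r : ℝ}
    (hL : r • (L' * J) = J * S) (hN : N' * J = J * N) :
    r * (L' * N').trace = (S * N).trace := by
  have hu : IsUnit J.det := isUnit_iff_ne_zero.mpr hJ
  have h1 : N' = J * N * J⁻¹ := by
    rw [← hN, mul_assoc, Matrix.mul_nonsing_inv _ hu, mul_one]
  have h2 : r • (L' * N') = J * (S * N) * J⁻¹ := by
    rw [h1, ← mul_assoc, ← mul_assoc, ← smul_mul_assoc, ← smul_mul_assoc, hL, mul_assoc J S N]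
  rw [← smul_eq_mul, ← Matrix.trace_smul, h2, Matrix.trace_mul_comm, ← mul_assoc,
    Matrix.nonsing_inv_mul _ hu, one_mul]

variable [ChartedSpace (E n) M] [IsManifold (𝓡 n) ∞ M]

theorem contDiffOn_trans (he : e ∈ atlas (E n) M) (he' : e' ∈ atlas (E n) M) :
    ContDiffOn ℝ ∞ (trans e e') (overlap e e') := by
  have h := (contDiffGroupoid ∞ (𝓡 n)).compatible he he'
  rw [contDiffGroupoid, mem_groupoid_of_pregroupoid] at h
  have h2 := h.1
  simp only [contDiffPregroupoid, modelWithCornersSelf_coe, modelWithCornersSelf_coe_symm,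
    Function.comp_id, Function.id_comp, Set.preimage_id, Set.range_id, Set.inter_univ] at h2
  rw [OpenPartialHomeomorph.trans_source, OpenPartialHomeomorph.symm_source] at h2
  exact h2

theorem differentiableAt_trans (he : e ∈ atlas (E n) M) (he' : e' ∈ atlas (E n) M)
    (hx : x ∈ overlap e e') : DifferentiableAt ℝ (trans e e') x :=
  differentiableAt_of_contDiffOn (isOpen_overlap e e') hx (contDiffOn_trans he he')

theorem contDiffOn_jac (he : e ∈ atlas (E n) M) (he' : e' ∈ atlas (E n) M) (A a : Fin n) :
    ContDiffOn ℝ ∞ (fun y => jac e e' y A a) (overlap e e') :=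
  contDiffOn_pd (isOpen_overlap e e')
    ((EuclideanSpace.proj A : E n →L[ℝ] ℝ).contDiff.comp_contDiffOn (contDiffOn_trans he he')) a

/-- The tensor law of the covariant derivative of a vector field. -/
theorem nablaMat_law {Γ : Comp n M (Ix3 n)} (hΓ : IsConnection Γ)
    (he : e ∈ atlas (E n) M) (he' : e' ∈ atlas (E n) M) {V V' : E n → Ix1 n}
    (hV : ∀ a, ContDiffOn ℝ ∞ (fun x => V x a) e.target)
    (hV' : ∀ a, ContDiffOn ℝ ∞ (fun x => V' x a) e'.target)
    (h : ∀ x ∈ overlap e e', ∀ A, V' (trans e e' x) A = ∑ a, jac e e' x A a * V x a)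
    (hx : x ∈ overlap e e') :
    nablaMat (Γ e') V' (trans e e' x) * Matrix.of (jac e e' x) =
      Matrix.of (jac e e' x) * nablaMat (Γ e) V x := by
  have hd := differentiableAt_trans he he' hx
  have hdV := fun a => differentiableAt_of_contDiffOn e.open_target hx.1 (hV a)
  have hdV' := fun a => differentiableAt_of_contDiffOn e'.open_target (trans_mem_target hx) (hV' a)
  have hdJ := fun A a => differentiableAt_of_contDiffOn (isOpen_overlap e e') hx
    (contDiffOn_jac he he' A a)
  ext A b
  -- The product rule leaves a second derivative of the coordinate change, which the inhomogeneous
  -- term in the law of `Γ` cancels in `h3`.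
  have h1 : ∑ B, pd B (fun y => V' y A) (trans e e' x) * jac e e' x B b =
      ∑ a, (pd b (fun y => jac e e' y A a) x * V x a
        + jac e e' x A a * pd b (fun y => V y a) x) := by
    have h2 := pd_comp_trans hd (hdV' A) b
    rw [pd_congr (isOpen_overlap e e') hx b fun y hy => h y hy A,
      pd_sum (H := fun a y => jac e e' y A a * V y a) _ _ fun a _ => (hdJ A a).mul (hdV a)] at h2
    simp only [mul_comm (pd _ _ (trans e e' x))]
    rw [← h2]
    exact Finset.sum_congr rfl fun a _ => pd_mul b (hdJ A a) (hdV a)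
  have h3 : ∑ B, ∑ C, Γ e' (trans e e' x) A B C * V' (trans e e' x) C * jac e e' x B b =
      ∑ c, (∑ a, jac e e' x A a * Γ e x a b c - pd b (fun y => jac e e' y A c) x) * V x c := by
    have h4 : ∀ c, (∑ a, jac e e' x A a * Γ e x a b c - pd b (fun y => jac e e' y A c) x) * V x c
        = ∑ B, ∑ C, Γ e' (trans e e' x) A B C * jac e e' x B b * jac e e' x C c * V x c := by
      intro c
      rw [← hΓ.law e he e' he' x hx A b c]
      simp only [Finset.sum_mul]
    simp only [h4, h x hx, Finset.mul_sum, Finset.sum_mul]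
    refine Eq.trans ?_ (sum_rotate3 (fun B C c => Γ e' (trans e e' x) A B C * jac e e' x B b
      * jac e e' x C c * V x c))
    exact Finset.sum_congr rfl fun B _ => Finset.sum_congr rfl fun C _ =>
      Finset.sum_congr rfl fun c _ => by ring
  have h5 : ∑ a, ∑ c, jac e e' x A a * (Γ e x a b c * V x c) =
      ∑ c, (∑ a, jac e e' x A a * Γ e x a b c) * V x c := by
    rw [Finset.sum_comm]
    simp only [Finset.sum_mul, mul_assoc]
  simp only [Matrix.mul_apply, nablaMat, Matrix.of_apply, nablaVec, add_mul, mul_add,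
    Finset.sum_add_distrib, Finset.sum_mul, Finset.mul_sum, h1, h3, h5, sub_mul,
    Finset.sum_sub_distrib]
  ring

end CoordinateChange

/-! ### Transformation laws of densities contracted with `∇V`. -/

section TensorLaws

variable {n : ℕ} {M : Type*} [TopologicalSpace M] {e e' : Chart n M} {x : E n}
  [ChartedSpace (E n) M] [IsManifold (𝓡 n) ∞ M] {φ : Config n M}

theorem chargeTensor_law (hM : OrientedAtlas n M) (hφ : φ.IsField)
    (he : e ∈ atlas (E n) M) (he' : e' ∈ atlas (E n) M) {V V' : E n → Ix1 n}
    (hV : ∀ a, ContDiffOn ℝ ∞ (fun x => V x a) e.target)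
    (hV' : ∀ a, ContDiffOn ℝ ∞ (fun x => V' x a) e'.target)
    (h : ∀ x ∈ overlap e e', ∀ A, V' (trans e e' x) A = ∑ a, jac e e' x A a * V x a)
    (hx : x ∈ overlap e e') (A B : Fin n) :
    |jacDet e e' x| * chargeTensor φ e' V' (trans e e' x) A B =
      ∑ a, ∑ b, jac e e' x A a * jac e e' x B b * chargeTensor φ e V x a b := by
  have hN := nablaMat_law hφ.connection he he' hV hV' h hx
  have hL : |jacDet e e' x| • (densMat3 (φ.lamR e') A B (trans e e' x) * Matrix.of (jac e e' x)) =
      Matrix.of (jac e e' x) * ∑ a, ∑ b, (jac e e' x A a * jac e e' x B b) •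
        densMat3 (φ.lamR e) a b x := by
    ext b a
    have := hφ.densityR.law e he e' he' x hx a b A B
    simp only [Matrix.smul_apply, Matrix.mul_apply, densMat3, Matrix.of_apply, Matrix.sum_apply,
      smul_eq_mul]
    simp only [mul_comm (φ.lamR e' _ _ _ _ _), this, Finset.mul_sum]
    exact Finset.sum_congr rfl fun _ _ => Finset.sum_congr rfl fun _ _ =>
      Finset.sum_congr rfl fun _ _ => by ring
  have h1 := det_mul_trace_eq (hM e he e' he' x hx).ne' hL hN
  have h2 : |jacDet e e' x| * ∑ D, φ.lamT e' (trans e e' x) D A B * V' (trans e e' x) D =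
      ∑ a, ∑ b, jac e e' x A a * jac e e' x B b * ∑ d, φ.lamT e x d a b * V x d := by
    have h3 : |jacDet e e' x| * ∑ D, φ.lamT e' (trans e e' x) D A B * V' (trans e e' x) D =
        ∑ d, (|jacDet e e' x| * ∑ D, jac e e' x D d * φ.lamT e' (trans e e' x) D A B) * V x d := by
      simp only [h x hx, Finset.mul_sum, Finset.sum_mul]
      rw [Finset.sum_comm]
      exact Finset.sum_congr rfl fun _ _ => Finset.sum_congr rfl fun _ _ => by ring
    rw [h3]
    simp only [hφ.densityT.law e he e' he' x hx, Finset.mul_sum, Finset.sum_mul]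
    rw [sum_rotate3 (fun a b d => jac e e' x A a * jac e e' x B b
      * (φ.lamT e x d a b * V x d))]
    exact Finset.sum_congr rfl fun _ _ => Finset.sum_congr rfl fun _ _ =>
      Finset.sum_congr rfl fun _ _ => by ring
  simp only [chargeTensor, mul_add, h1, h2, Finset.sum_add_distrib, Finset.sum_mul,
    Matrix.trace_sum, Matrix.smul_mul, Matrix.trace_smul, smul_eq_mul]

theorem trace_densMat4_law (hM : OrientedAtlas n M) {κ : Comp n M (Ix5 n)} (hκ : IsDensity4 κ)
    {Γ : Comp n M (Ix3 n)} (hΓ : IsConnection Γ)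
    (he : e ∈ atlas (E n) M) (he' : e' ∈ atlas (E n) M) {V V' : E n → Ix1 n}
    (hV : ∀ a, ContDiffOn ℝ ∞ (fun x => V x a) e.target)
    (hV' : ∀ a, ContDiffOn ℝ ∞ (fun x => V' x a) e'.target)
    (h : ∀ x ∈ overlap e e', ∀ A, V' (trans e e' x) A = ∑ a, jac e e' x A a * V x a)
    (hx : x ∈ overlap e e') (A B C : Fin n) :
    |jacDet e e' x| * (densMat4 (κ e') A B C (trans e e' x)
        * nablaMat (Γ e') V' (trans e e' x)).trace =
      ∑ a, ∑ b, ∑ c, jac e e' x A a * jac e e' x B b * jac e e' x C c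
        * (densMat4 (κ e) a b c x * nablaMat (Γ e) V x).trace := by
  have hN := nablaMat_law hΓ he he' hV hV' h hx
  have hL : |jacDet e e' x| • (densMat4 (κ e') A B C (trans e e' x) * Matrix.of (jac e e' x)) =
      Matrix.of (jac e e' x) * ∑ a, ∑ b, ∑ c, (jac e e' x A a * jac e e' x B b * jac e e' x C c) •
        densMat4 (κ e) a b c x := by
    ext b a
    have := hκ.law e he e' he' x hx a b A B C
    simp only [Matrix.smul_apply, Matrix.mul_apply, densMat4, Matrix.of_apply, Matrix.sum_apply,
      smul_eq_mul]
    simp only [mul_comm (κ e' _ _ _ _ _ _), this, Finset.mul_sum]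
    exact Finset.sum_congr rfl fun _ _ => Finset.sum_congr rfl fun _ _ =>
      Finset.sum_congr rfl fun _ _ => Finset.sum_congr rfl fun _ _ => by ring
  have h1 := det_mul_trace_eq (hM e he e' he' x hx).ne' hL hN
  simp only [h1, Finset.sum_mul, Matrix.trace_sum, Matrix.smul_mul, Matrix.trace_smul, smul_eq_mul]

end TensorLaws

/-! ### The Noether charge -/

section NoetherCharge

variable {m : ℕ} {M : Type*} [TopologicalSpace M]

/-- The Noether charge `ε_{ab...} (λ_{Rd}^{cab} ∇_c V^d + λ_{Td}^{ab} V^d)`. -/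
def noetherCharge (φ : Config (m + 2) M) : ChargeOperator m M where
  W e x d := epsForm2 fun a b =>
    ∑ c, ∑ h, φ.lamR e x h c a b * φ.Γ e x h c d + φ.lamT e x d a b
  B e x c d := epsForm2 fun a b => φ.lamR e x d c a b

theorem epsForm2_add (X Y : Ix2 (m + 2)) :
    epsForm2 (fun a b => X a b + Y a b) = epsForm2 X + epsForm2 Y := by
  simp only [epsForm2_def, add_smul, Finset.sum_add_distrib]

theorem epsForm2_smul (r : ℝ) (X : Ix2 (m + 2)) :
    epsForm2 (fun a b => r * X a b) = r • epsForm2 X := by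
  simp only [epsForm2_def, mul_smul, Finset.smul_sum]

theorem epsForm2_sum {ι : Type*} (s : Finset ι) (X : ι → Ix2 (m + 2)) :
    epsForm2 (fun a b => ∑ i ∈ s, X i a b) = ∑ i ∈ s, epsForm2 (X i) := by
  simp only [epsForm2_def, Finset.sum_smul]
  rw [Finset.sum_congr rfl fun a _ => Finset.sum_comm, Finset.sum_comm]

theorem noetherCharge_eval (φ : Config (m + 2) M) (e : Chart (m + 2) M)
    (V : E (m + 2) → Ix1 (m + 2)) (x : E (m + 2)) :
    (noetherCharge φ).eval e V x = epsForm2 (chargeTensor φ e V x) := by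
  have h : chargeTensor φ e V x = fun a b =>
      ∑ d, V x d * (∑ c, ∑ h, φ.lamR e x h c a b * φ.Γ e x h c d + φ.lamT e x d a b)
      + ∑ c, ∑ d, pd c (fun y => V y d) x * φ.lamR e x d c a b := by
    ext a b
    have h1 : ∑ c, ∑ d, φ.lamR e x d c a b * ∑ h, φ.Γ e x d c h * V x h =
        ∑ d, ∑ c, ∑ h, V x d * (φ.lamR e x h c a b * φ.Γ e x h c d) := by
      simp only [Finset.mul_sum]
      rw [sum_rotate3]
      exact Finset.sum_congr rfl fun _ _ => Finset.sum_congr rfl fun _ _ =>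
        Finset.sum_congr rfl fun _ _ => by ring
    simp only [chargeTensor, Matrix.trace, Matrix.diag, Matrix.mul_apply, densMat3, nablaMat,
      Matrix.of_apply, nablaVec, mul_add, Finset.sum_add_distrib, h1]
    simp only [Finset.mul_sum, mul_comm (φ.lamT e x _ a b), mul_comm (φ.lamR e x _ _ a b) (pd _ _ _)]
    ring
  rw [h, epsForm2_add, epsForm2_sum]
  simp only [epsForm2_sum, epsForm2_smul]
  rfl

theorem chargeTensor_antisymm {n : ℕ} {M : Type*} [TopologicalSpace M] [ChartedSpace (E n) M]
    {φ : Config n M} (hφ : φ.IsField) {e : Chart n M} (he : e ∈ atlas (E n) M) {x : E n}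
    (hx : x ∈ e.target) (V : E n → Ix1 n) (a b : Fin n) :
    chargeTensor φ e V x a b = -chargeTensor φ e V x b a := by
  simp only [chargeTensor]
  rw [densMat3_antisymm (hφ.antisymmR e he x hx) a b, neg_mul, Matrix.trace_neg, neg_add,
    ← Finset.sum_neg_distrib]
  congr 1
  exact Finset.sum_congr rfl fun d _ => by rw [hφ.antisymmT e he x hx d a b]; ring

theorem contDiffOn_chargeTensor {n : ℕ} {M : Type*} [TopologicalSpace M] [ChartedSpace (E n) M]
    {φ : Config n M} (hφ : φ.IsField) {e : Chart n M} (he : e ∈ atlas (E n) M)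
    {V : E n → Ix1 n} (hV : ∀ a, ContDiffOn ℝ ∞ (fun x => V x a) e.target) (a b : Fin n) :
    ContDiffOn ℝ ∞ (fun y => chargeTensor φ e V y a b) e.target :=
  ((msmooth_densMat3 (hφ.densityR.smooth e he) a b).mul
    (msmooth_nablaMat e.open_target (hφ.connection.smooth e he) hV)).trace.add
    (ContDiffOn.sum fun d _ => (hφ.densityT.smooth e he d a b).mul (hV d))

theorem contDiffOn_epsForm2 {X : E (m + 2) → Ix2 (m + 2)} {U : Set (E (m + 2))}
    (hX : ∀ a b, ContDiffOn ℝ ∞ (fun y => X y a b) U) :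
    ContDiffOn ℝ ∞ (fun y => epsForm2 (X y)) U :=
  ContDiffOn.sum fun a _ => ContDiffOn.sum fun b _ => (hX a b).smul contDiffOn_const

theorem isNoetherCharge_noetherCharge [ChartedSpace (E (m + 2)) M] [IsManifold (𝓡 (m + 2)) ∞ M]
    (hM : OrientedAtlas (m + 2) M) {f : Ix2 (m + 2) → Ix3 (m + 2) → ℝ} (hf : IsScalarFunction f)
    {φ : Config (m + 2) M} (hφ : φ.IsField) (hs : φ.OnShell f) :
    IsNoetherCharge f φ (noetherCharge φ) where
  smoothW e he d := contDiffOn_epsForm2 fun a b => (ContDiffOn.sum fun c _ =>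
    ContDiffOn.sum fun h _ => (hφ.densityR.smooth e he h c a b).mul
      (hφ.connection.smooth e he h c d)).add (hφ.densityT.smooth e he d a b)
  smoothB e he c d := contDiffOn_epsForm2 fun a b => hφ.densityR.smooth e he d c a b
  law e he e' he' V V' hV hV' h x hx := by
    rw [noetherCharge_eval, noetherCharge_eval]
    exact epsForm2_pullback _ (fun a A => fderiv_trans_basisVec
      (differentiableAt_trans he he' hx) a A) (hM e he e' he' x hx)
      (chargeTensor_law hM hφ he he' hV hV' h hx)
  extDeriv_eq e he V hV x hx := by
    have h1 : (noetherCharge φ).eval e V = fun y => epsForm2 (chargeTensor φ e V y) :=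
      funext fun y => noetherCharge_eval φ e V y
    rw [h1, extDeriv_epsForm2 e.open_target hx (contDiffOn_chargeTensor hφ he hV)
      fun y hy a b => chargeTensor_antisymm hφ he hy V a b]
    congr 1
    ext a
    exact (noetherCurrent_eq hφ hf hs he hV hx a).symm

end NoetherCharge

/-! ### Uniqueness of the Noether charge on surfaces where the vector field vanishes -/

section Uniqueness

variable {m : ℕ} {M : Type*} [TopologicalSpace M]

/-- The vector field with the only component `V^d = u(y - x)² / 2`. -/
def quadraticField {n : ℕ} (u : E n →L[ℝ] ℝ) (x : E n) (d : Fin n) (y : E n) : Ix1 n :=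
  fun k => if k = d then u (y - x) ^ 2 / 2 else 0

theorem contDiff_quadraticField {n : ℕ} (u : E n →L[ℝ] ℝ) (x : E n) (d k : Fin n) :
    ContDiff ℝ ∞ (fun y => quadraticField u x d y k) := by
  unfold quadraticField
  split_ifs
  · fun_prop
  · exact contDiff_const

theorem pd_quadraticField {n : ℕ} (u : E n →L[ℝ] ℝ) (x y : E n) (d k c : Fin n) :
    pd c (fun y => quadraticField u x d y k) y =
      if k = d then u (y - x) * u (basisVec c) else 0 := by
  unfold quadraticField
  split_ifs
  · have h : HasFDerivAt (fun y => u (y - x) ^ 2 / 2) (u (y - x) • u) y := by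
      have h1 : HasFDerivAt (fun y => u (y - x)) u y :=
        u.hasFDerivAt.comp y ((hasFDerivAt_id y).sub_const x)
      refine ((h1.pow 2).mul_const (2⁻¹ : ℝ)).congr_fderiv ?_
      ext v
      simp
      ring
    rw [pd, h.fderiv]; rfl
  · exact pd_const c 0

/-- The field and its first derivatives vanish at `x`, so only the derivative of the factor `u(y -
x)` in front of the first-order coefficients survives. -/
theorem extDeriv_eval_quadraticField {e : Chart (m + 2) M} {Q : ChargeOperator m M}
    {x : E (m + 2)} (hW : ∀ d, DifferentiableAt ℝ (fun y => Q.W e y d) x)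
    (hB : ∀ c d, DifferentiableAt ℝ (fun y => Q.B e y c d) x)
    (u : E (m + 2) →L[ℝ] ℝ) (d : Fin (m + 2)) :
    extDeriv (Q.eval e (quadraticField u x d)) x =
      wedge u (∑ c, u (basisVec c) • Q.B e x c d) := by
  have h1 : Q.eval e (quadraticField u x d) = fun y =>
      (u (y - x) ^ 2 / 2) • Q.W e y d + u (y - x) • ∑ c, u (basisVec c) • Q.B e y c d := by
    ext1 y
    simp only [ChargeOperator.eval, pd_quadraticField]
    simp only [quadraticField, ite_smul, zero_smul, Finset.sum_ite_eq', Finset.mem_univ, if_true,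
      Finset.smul_sum, smul_smul]
  have h2 : HasFDerivAt (fun y => u (y - x)) u x :=
    u.hasFDerivAt.comp x ((hasFDerivAt_id x).sub_const x : HasFDerivAt (fun y => y - x) _ x)
  have h3 : HasFDerivAt (fun y => u (y - x) ^ 2 / 2) (0 : E (m + 2) →L[ℝ] ℝ) x := by
    have h := (h2.mul h2).const_mul (2⁻¹ : ℝ)
    have h' : (fun y => u (y - x) ^ 2 / 2) = fun y => 2⁻¹ * (u (y - x) * u (y - x)) := by
      ext1 y; ring
    rw [h']
    refine h.congr_fderiv ?_
    simp
  have h4 : HasFDerivAt (fun y => ∑ c, u (basisVec c) • Q.B e y c d)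
      (∑ c, u (basisVec c) • fderiv ℝ (fun y => Q.B e y c d) x) x :=
    HasFDerivAt.fun_sum fun c _ => (hB c d).hasFDerivAt.const_smul (u (basisVec c))
  have h5 := (h3.smul (hW d).hasFDerivAt).add (h2.smul h4)
  have h6 : HasFDerivAt (Q.eval e (quadraticField u x d))
      (u.smulRight (∑ c, u (basisVec c) • Q.B e x c d)) x := by
    rw [h1]
    refine h5.congr_fderiv ?_
    ext v w
    simp
  rw [extDeriv, h6.fderiv]
  rfl

theorem wedge_vecCons {n k : ℕ} (u : E n →L[ℝ] ℝ) (α : E n [⋀^Fin k]→L[ℝ] ℝ) (s : E n)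
    {t : Fin k → E n} (ht : ∀ i, u (t i) = 0) : wedge u α (Matrix.vecCons s t) = u s * α t := by
  rw [wedge_apply, Fin.sum_univ_succ]
  have h0 : (0 : Fin (k + 1)).removeNth (Matrix.vecCons s t) = t := by
    ext1 j; simp [Fin.removeNth]
  simp [h0, ht]

/-- With `V = 0` only `u_c B^c_d`, `u = dV^d`, enters. The quadratic field shows that `u ∧ (u_c
B^c_d)` is determined by the current, and this determines `u_c B^c_d` on vectors annihilated by `u`.
The agreement is pointwise, so no comparison up to exact forms is required. -/
theorem IsNoetherCharge.eval_eq [ChartedSpace (E (m + 2)) M] {f : Ix2 (m + 2) → Ix3 (m + 2) → ℝ}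
    {φ : Config (m + 2) M} {Q Q' : ChargeOperator m M} (hQ : IsNoetherCharge f φ Q)
    (hQ' : IsNoetherCharge f φ Q') {e : Chart (m + 2) M} (he : e ∈ atlas (E (m + 2)) M)
    {x : E (m + 2)} (hx : x ∈ e.target) {V : E (m + 2) → Ix1 (m + 2)} (hV : V x = 0)
    {t : Fin m → E (m + 2)} (ht : ∀ d k, fderiv ℝ (fun y => V y d) x (t k) = 0) :
    Q.eval e V x t = Q'.eval e V x t := by
  have key : ∀ d, (∑ c, pd c (fun y => V y d) x • Q.B e x c d) t =
      (∑ c, pd c (fun y => V y d) x • Q'.B e x c d) t := by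
    intro d
    set u := fderiv ℝ (fun y => V y d) x with hu
    have hpd : ∀ c, pd c (fun y => V y d) x = u (basisVec c) := fun c => rfl
    by_cases h0 : u = 0
    · simp [hpd, h0]
    obtain ⟨s, hs⟩ : ∃ s, u s ≠ 0 := by
      by_contra! h
      exact h0 (ContinuousLinearMap.ext h)
    have hsm : ∀ a, ContDiffOn ℝ ∞ (fun y => quadraticField u x d y a) e.target :=
      fun a => (contDiff_quadraticField u x d a).contDiffOn
    have h1 := hQ.extDeriv_eq e he _ hsm x hx
    rw [← hQ'.extDeriv_eq e he _ hsm x hx,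
      extDeriv_eval_quadraticField
        (fun d => differentiableAt_of_contDiffOn e.open_target hx (hQ.smoothW e he d))
        (fun c d => differentiableAt_of_contDiffOn e.open_target hx (hQ.smoothB e he c d)),
      extDeriv_eval_quadraticField
        (fun d => differentiableAt_of_contDiffOn e.open_target hx (hQ'.smoothW e he d))
        (fun c d => differentiableAt_of_contDiffOn e.open_target hx (hQ'.smoothB e he c d))] at h1
    -- Evaluation on one vector transverse to the kernel of `u` followed by `t` isolates a single
    -- term of the exterior product.
    have h2 := congrArg (fun α => α (Matrix.vecCons s t)) h1
    simp only [wedge_vecCons u _ s (ht d)] at h2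
    exact mul_left_cancel₀ hs h2
  have hev : ∀ Q : ChargeOperator m M, Q.eval e V x t =
      ∑ d, (∑ c, pd c (fun y => V y d) x • Q.B e x c d) t := by
    intro Q
    rw [ChargeOperator.eval, Finset.sum_comm]
    simp [hV, ContinuousAlternatingMap.sum_apply]
  rw [hev, hev]
  exact Finset.sum_congr rfl fun d _ => key d

end Uniqueness

/-! ### Two-forms normal to a surface of codimension two -/

section NormalForms

variable {m : ℕ} {t : Fin m → E (m + 2)} {b F : Ix2 (m + 2)}

/-- The linear form with given components. -/
def covector {n : ℕ} (u : Ix1 n) : E n →ₗ[ℝ] ℝ where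
  toFun v := ∑ d, u d * v d
  map_add' v w := by simp [mul_add, Finset.sum_add_distrib]
  map_smul' r v := by
    simp only [PiLp.smul_apply, smul_eq_mul, RingHom.id_apply, Finset.mul_sum]
    exact Finset.sum_congr rfl fun _ _ => by ring

theorem covector_apply {n : ℕ} (u : Ix1 n) (v : E n) : covector u v = ∑ d, u d * v d := rfl

theorem covector_basisVec {n : ℕ} (u : Ix1 n) (d : Fin n) : covector u (basisVec d) = u d := by
  simp [covector_apply]

/-- Antisymmetric forms that annihilate `m` independent vectors in dimension `m + 2` are
proportional to each other. -/
theorem exists_eq_mul_of_annihilate (ht : LinearIndependent ℝ t)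
    (hb : ∀ a d, b a d = -b d a) (hbt : ∀ a k, ∑ d, b a d * t k d = 0)
    (hF : ∀ a d, F a d = -F d a) (hFt : ∀ a k, ∑ d, F a d * t k d = 0)
    {p q : Fin (m + 2)} (hpq : b p q ≠ 0) : ∃ r, ∀ a d, F a d = r * b a d := by
  have hbd : ∀ a, b a a = 0 := fun a => by linarith [hb a a]
  -- Because `b_{pq} ≠ 0`, the vectors `∂_p`, `∂_q` complete `t` to a basis; a covector vanishing on
  -- all of them is zero.
  have hspan : ∀ u : Ix1 (m + 2), u p = 0 → u q = 0 → (∀ k, ∑ d, u d * t k d = 0) → u = 0 := by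
    intro u hup huq hut
    have hq : basisVec q ∉ Submodule.span ℝ (Set.range t) := by
      intro h
      have h1 : Submodule.span ℝ (Set.range t) ≤ LinearMap.ker (covector (b p)) := by
        rw [Submodule.span_le]
        rintro _ ⟨k, rfl⟩
        exact hbt p k
      exact hpq ((covector_basisVec (b p) q).symm.trans (h1 h))
    have hi : LinearIndependent ℝ (Fin.cons (basisVec q) t : Fin (m + 1) → E (m + 2)) :=
      linearIndependent_finCons.2 ⟨ht, hq⟩
    have hp : basisVec p ∉ Submodule.span ℝ
        (Set.range (Fin.cons (basisVec q) t : Fin (m + 1) → E (m + 2))) := by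
      intro h
      have h1 : Submodule.span ℝ (Set.range (Fin.cons (basisVec q) t : Fin (m + 1) → E (m + 2))) ≤
          LinearMap.ker (covector (b q)) := by
        rw [Submodule.span_le]
        rintro _ ⟨k, rfl⟩
        refine Fin.cases ?_ (fun k => ?_) k
        · exact (covector_basisVec (b q) q).trans (hbd q)
        · exact hbt q k
      have h2 := (covector_basisVec (b q) p).symm.trans (h1 h)
      rw [hb] at h2
      exact hpq (neg_eq_zero.mp h2)
    have hi2 : LinearIndependent ℝ (Fin.cons (basisVec p) (Fin.cons (basisVec q) t :
        Fin (m + 1) → E (m + 2)) : Fin (m + 2) → E (m + 2)) :=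
      linearIndependent_finCons.2 ⟨hi, hp⟩
    have htop := hi2.span_eq_top_of_card_eq_finrank' (by simp)
    have hker : (⊤ : Submodule ℝ (E (m + 2))) ≤ LinearMap.ker (covector u) := by
      rw [← htop, Submodule.span_le]
      rintro _ ⟨k, rfl⟩
      refine Fin.cases ?_ (fun k => Fin.cases ?_ (fun k => ?_) k) k
      · exact (covector_basisVec u p).trans hup
      · exact (covector_basisVec u q).trans huq
      · exact hut k
    ext d
    exact (covector_basisVec u d).symm.trans (hker Submodule.mem_top)
  refine ⟨F p q / b p q, ?_⟩
  set r := F p q / b p q with hr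
  -- The multiple of `b` is chosen so that `G_{pq} = 0`. Then rows `p` and `q` of `G` vanish, hence
  -- by antisymmetry columns `p` and `q`, hence every row.
  let G : Ix2 (m + 2) := fun a d => F a d - r * b a d
  have hG : ∀ a d, G a d = -G d a := fun a d => by
    simp only [G]; rw [hF a d, hb a d]; ring
  have hGt : ∀ a k, ∑ d, G a d * t k d = 0 := by
    intro a k
    simp only [G, sub_mul, Finset.sum_sub_distrib, hFt, mul_assoc, ← Finset.mul_sum, hbt]
    ring
  have hGpq : G p q = 0 := by
    simp only [G, hr]; field_simp; ring
  have hGd : ∀ a, G a a = 0 := fun a => by linarith [hG a a]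
  have hGp : G p = 0 := hspan _ (hGd p) hGpq (hGt p)
  have hGq : G q = 0 := hspan _ (by rw [hG, hGpq, neg_zero]) (hGd q) (hGt q)
  intro a d
  have : G a = 0 := hspan _ (by rw [hG, hGp]; simp) (by rw [hG, hGq]; simp) (hGt a)
  have := congrFun this d
  simp only [G, Pi.zero_apply] at this
  linarith

theorem exists_ne_zero_of_annihilate {F : Ix2 (m + 2)} {w : Ix4 (m + 2)}
    (h : ∑ a, ∑ c, ∑ d, ∑ k, w a c d k * F a d * F c k = -2) :
    ∃ p q, F p q ≠ 0 := by
  by_contra! h0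
  simp [h0] at h

/-- The exterior square of a normal two-form vanishes. -/
theorem sum_antisymm_mul_normal_eq_zero (ht : LinearIndependent ℝ t)
    (hb : ∀ a d, b a d = -b d a) (hbt : ∀ a k, ∑ d, b a d * t k d = 0)
    {p q : Fin (m + 2)} (hpq : b p q ≠ 0) {D : Ix3 (m + 2)}
    (hD : ∀ a b c, D a b c = -D b a c ∧ D a b c = -D a c b) (h : Fin (m + 2)) :
    ∑ c, ∑ a, ∑ d, D c a d * b c h * b a d = 0 := by
  -- The exterior product of two rows of `b` is again a normal two-form, hence a multiple `r b`.
  -- This shows that `b` is simple.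
  let F : Ix2 (m + 2) := fun a c => b q a * b p c - b q c * b p a
  have hFt : ∀ a k, ∑ d, F a d * t k d = 0 := by
    intro a k
    have : ∑ d, F a d * t k d = b q a * ∑ d, b p d * t k d - b p a * ∑ d, b q d * t k d := by
      simp only [F, Finset.mul_sum, ← Finset.sum_sub_distrib]
      exact Finset.sum_congr rfl fun _ _ => by ring
    rw [this, hbt, hbt]; ring
  obtain ⟨r, hr⟩ := exists_eq_mul_of_annihilate ht hb hbt (F := F)
    (fun a d => by simp only [F]; ring) hFt hpq
  -- `F_{pq} = -(b_{pq})^2` is nonzero, so `r` is too and `b` can be replaced by `F` in both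
  -- factors; every resulting term repeats a covector.
  have hr0 : r ≠ 0 := by
    intro h0
    have h1 := hr p q
    have h2 : b p p = 0 := by linarith [hb p p]
    simp only [F, h0, h2, hb q p, zero_mul, mul_zero, sub_zero] at h1
    exact hpq (by simpa using h1)
  have z : ∀ u w w' : Ix1 (m + 2), (∑ c, ∑ a, ∑ d, D c a d * (u c * u a * w d)) = 0 ∧
      (∑ c, ∑ a, ∑ d, D c a d * (u c * w a * u d)) = 0 := by
    intro u w _
    constructor
    · refine (sum_rotate3 _).trans (Finset.sum_eq_zero fun d _ =>
        sum_sum_eq_zero_of_antisymm fun c a => ?_)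
      rw [(hD c a d).1]; ring
    · have : ∑ c, ∑ a, ∑ d, D c a d * (u c * w a * u d) =
          ∑ a, ∑ c, ∑ d, D c a d * (u c * w a * u d) := Finset.sum_comm
      rw [this]
      refine Finset.sum_eq_zero fun a _ => sum_sum_eq_zero_of_antisymm fun c d => ?_
      rw [(hD c a d).1, (hD a c d).2, (hD a d c).1]; ring
  have h1 : r ^ 2 * ∑ c, ∑ a, ∑ d, D c a d * b c h * b a d = 0 := by
    have h2 : r ^ 2 * ∑ c, ∑ a, ∑ d, D c a d * b c h * b a d =
        b p h * (∑ c, ∑ a, ∑ d, D c a d * (b q c * b q a * b p d)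
          - ∑ c, ∑ a, ∑ d, D c a d * (b q c * b p a * b q d))
        - b q h * (∑ c, ∑ a, ∑ d, D c a d * (b p c * b q a * b p d)
          - ∑ c, ∑ a, ∑ d, D c a d * (b p c * b p a * b q d)) := by
      simp only [Finset.mul_sum, ← Finset.sum_sub_distrib]
      refine Finset.sum_congr rfl fun c _ => Finset.sum_congr rfl fun a _ =>
        Finset.sum_congr rfl fun d _ => ?_
      have e1 := hr c h
      have e2 := hr a d
      calc r ^ 2 * (D c a d * b c h * b a d) = D c a d * (r * b c h) * (r * b a d) := by ring
        _ = _ := by rw [← e1, ← e2]; simp only [F]; ring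
    rw [h2, (z (b q) (b p) 0).1, (z (b q) (b p) 0).2, (z (b p) (b q) 0).1, (z (b p) (b q) 0).2]
    ring
  exact (mul_eq_zero.mp h1).resolve_left (pow_ne_zero 2 hr0)

/-- The restriction of `ε_{ab...} X^{ab}` to a surface only depends on the contraction of `X` with
a normal two-form. -/
theorem epsForm2_apply_eq_zero (ht : LinearIndependent ℝ t)
    (hb : ∀ a d, b a d = -b d a) (hbt : ∀ a k, ∑ d, b a d * t k d = 0)
    {p q : Fin (m + 2)} (hpq : b p q ≠ 0) {X : Ix2 (m + 2)}
    (hX : ∑ a, ∑ d, X a d * b a d = 0) : epsForm2 X t = 0 := by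
  -- Contracting with a tangent vector repeats an argument of `ε`. So `ε_{ad}` evaluated on the
  -- tangent frame is itself a normal two-form, a multiple of `b`.
  have h1 : ∀ a k, ∑ d, epsBasis2 a d t * t k d = 0 := by
    intro a k
    have h2 : ∑ d, epsBasis2 a d t * t k d =
        (((eps (m + 2)).curryLeft (basisVec a)).curryLeft (t k)) t := by
      have : t k = ∑ d, t k d • (basisVec d : E (m + 2)) := by
        ext i; simp [Pi.single_apply]
      conv_rhs => rw [this]
      simp only [map_sum, map_smul, ContinuousAlternatingMap.sum_apply,
        ContinuousAlternatingMap.smul_apply, smul_eq_mul]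
      exact Finset.sum_congr rfl fun d _ => mul_comm _ _
    rw [h2, ContinuousAlternatingMap.curryLeft_apply_apply]
    exact ((eps (m + 2)).curryLeft (basisVec a)).map_eq_zero_of_eq _
      (i := 0) (j := k.succ) (by simp) (Fin.succ_ne_zero k).symm
  obtain ⟨r, hr⟩ := exists_eq_mul_of_annihilate ht hb hbt (F := fun a d => epsBasis2 a d t)
    (fun a d => by rw [epsBasis2_swap]; rfl) h1 hpq
  have h3 : epsForm2 X t = ∑ a, ∑ d, X a d * epsBasis2 a d t := by
    simp [epsForm2_def, ContinuousAlternatingMap.sum_apply]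
  rw [h3]
  simp only [hr]
  have : ∑ a, ∑ d, X a d * (r * b a d) = r * ∑ a, ∑ d, X a d * b a d := by
    simp only [Finset.mul_sum]
    exact Finset.sum_congr rfl fun _ _ => Finset.sum_congr rfl fun _ _ => by ring
  rw [this, hX, mul_zero]

end NormalForms

/-! ### Closed surfaces in charts -/

theorem sum_rotate_left4 {ι W : Type*} [Fintype ι] [AddCommMonoid W] (F : ι → ι → ι → ι → W) :
    ∑ a, ∑ b, ∑ c, ∑ d, F a b c d = ∑ b, ∑ c, ∑ d, ∑ a, F a b c d :=
  Finset.sum_comm.trans (Finset.sum_congr rfl fun _ _ => Finset.sum_comm.trans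
    (Finset.sum_congr rfl fun _ _ => Finset.sum_comm))

theorem sum_rotate_left3 {ι W : Type*} [Fintype ι] [AddCommMonoid W] (F : ι → ι → ι → W) :
    ∑ a, ∑ b, ∑ c, F a b c = ∑ b, ∑ c, ∑ a, F a b c :=
  Finset.sum_comm.trans (Finset.sum_congr rfl fun _ _ => Finset.sum_comm)

section Surface

variable {m : ℕ} {M N : Type*} [TopologicalSpace M] [ChartedSpace (E (m + 2)) M]
  [TopologicalSpace N] [ChartedSpace (E m) N]
  {S : ClosedSurface m M N} {c : OpenPartialHomeomorph N (E m)} {e : Chart (m + 2) M}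

/-- The coordinates, in the chart `c`, of the points of the surface in the chart `e`. -/
def ClosedSurface.paramDomain (S : ClosedSurface m M N) (c : OpenPartialHomeomorph N (E m))
    (e : Chart (m + 2) M) : Set (E m) := c.target ∩ c.symm ⁻¹' (S.ι ⁻¹' e.source)

theorem ClosedSurface.isOpen_paramDomain (S : ClosedSurface m M N)
    (c : OpenPartialHomeomorph N (E m)) (e : Chart (m + 2) M) : IsOpen (S.paramDomain c e) :=
  c.isOpen_inter_preimage_symm (e.open_source.preimage S.smooth.continuous)

theorem ClosedSurface.param_mem {y : E m} (hy : y ∈ S.paramDomain c e) :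
    S.param c e y ∈ e.target := e.map_source hy.2

variable {φ : Config (m + 2) M} {V : Comp (m + 2) M (Ix1 (m + 2))}
  {b : Chart (m + 2) M → N → Ix2 (m + 2)} {κ : ℝ} {y : E m}

theorem IsBifurcationSurface.binormal_ne_zero (hB : IsBifurcationSurface S φ V b κ)
    (he : e ∈ atlas (E (m + 2)) M) {p : N} (hp : S.ι p ∈ e.source) :
    ∃ i j, b e p i j ≠ 0 :=
  exists_ne_zero_of_annihilate (w := fun a c d h => invMetric (φ.g e (e (S.ι p))) a c *
    invMetric (φ.g e (e (S.ι p))) d h) (hB.binormal.normalized e he p hp)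

theorem IsBifurcationSurface.normal (hB : IsBifurcationSurface S φ V b κ)
    (hc : c ∈ atlas (E m) N) (he : e ∈ atlas (E (m + 2)) M) (hy : y ∈ S.paramDomain c e)
    (a : Fin (m + 2)) (k : Fin m) : ∑ d, b e (c.symm y) a d * S.tangent c e y k d = 0 := by
  have := hB.binormal.normal e he c hc (c.symm y) (c.map_target hy.1) hy.2 a k
  rwa [c.right_inv hy.1] at this

variable [IsManifold (𝓡 (m + 2)) ∞ M] [IsManifold (𝓡 m) ∞ N]

theorem ClosedSurface.contDiffOn_param (hc : c ∈ atlas (E m) N) (he : e ∈ atlas (E (m + 2)) M) :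
    ContDiffOn ℝ ∞ (S.param c e) (S.paramDomain c e) := by
  rw [← contMDiffOn_iff_contDiffOn]
  have h1 := contMDiffOn_of_mem_maximalAtlas (I := 𝓡 (m + 2)) (n := ∞)
    (IsManifold.subset_maximalAtlas he)
  have h2 := contMDiffOn_symm_of_mem_maximalAtlas (I := 𝓡 m) (n := ∞)
    (IsManifold.subset_maximalAtlas hc)
  have h3 : ContMDiffOn (𝓡 m) (𝓡 (m + 2)) ∞ (S.ι ∘ c.symm) c.target :=
    S.smooth.comp_contMDiffOn h2
  exact h1.comp (h3.mono Set.inter_subset_left) fun y hy => hy.2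

theorem ClosedSurface.fderiv_param_injective (hc : c ∈ atlas (E m) N)
    (he : e ∈ atlas (E (m + 2)) M) {y : E m} (hy : y ∈ S.paramDomain c e) :
    Function.Injective (fderiv ℝ (S.param c e) y) := by
  have : IsManifold (𝓡 m) 1 N := .of_le (n := ∞) (by simp)
  have : IsManifold (𝓡 (m + 2)) 1 M := .of_le (n := ∞) (by simp)
  have hc' := mdifferentiable_of_mem_atlas (I := 𝓡 m) hc
  have he' := mdifferentiable_of_mem_atlas (I := 𝓡 (m + 2)) he
  have h1 : MDifferentiableAt (𝓡 m) (𝓡 m) c.symm y := hc'.mdifferentiableAt_symm hy.1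
  have h2 : MDifferentiableAt (𝓡 m) (𝓡 (m + 2)) S.ι (c.symm y) :=
    S.smooth.mdifferentiableAt (by simp)
  have h3 : MDifferentiableAt (𝓡 (m + 2)) (𝓡 (m + 2)) e (S.ι (c.symm y)) :=
    he'.mdifferentiableAt hy.2
  have h4 : HasMFDerivAt (𝓡 m) (𝓡 (m + 2)) (S.param c e) y _ :=
    h3.hasMFDerivAt.comp y (h2.hasMFDerivAt.comp y h1.hasMFDerivAt)
  have h5 : Function.Injective (mfderiv (𝓡 m) (𝓡 (m + 2)) (S.param c e) y) := by
    rw [h4.mfderiv]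
    exact (he'.mfderiv_injective hy.2).comp
      ((S.immersion _).comp (hc'.symm.mfderiv_injective hy.1))
  rwa [mfderiv_eq_fderiv] at h5

theorem ClosedSurface.linearIndependent_tangent (hc : c ∈ atlas (E m) N)
    (he : e ∈ atlas (E (m + 2)) M) {y : E m} (hy : y ∈ S.paramDomain c e) :
    LinearIndependent ℝ (S.tangent c e y) := by
  have h1 : LinearIndependent ℝ (fun k : Fin m => (basisVec k : E m)) := by
    refine Fintype.linearIndependent_iff.2 fun r hr i => ?_
    have := congrArg (fun v : E m => v i) hr
    simpa [Pi.single_apply] using this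
  exact h1.map' (fderiv ℝ (S.param c e) y).toLinearMap
    (LinearMap.ker_eq_bot.2 (S.fderiv_param_injective hc he hy))

theorem ClosedSurface.fderiv_tangent_eq_zero (hc : c ∈ atlas (E m) N)
    (he : e ∈ atlas (E (m + 2)) M) {y : E m} (hy : y ∈ S.paramDomain c e) {F : E (m + 2) → ℝ}
    (hF : DifferentiableAt ℝ F (S.param c e y))
    (h : ∀ y' ∈ S.paramDomain c e, F (S.param c e y') = 0) (k : Fin m) :
    fderiv ℝ F (S.param c e y) (S.tangent c e y k) = 0 := by
  have hW := S.isOpen_paramDomain c e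
  have h1 := differentiableAt_of_contDiffOn hW hy (S.contDiffOn_param hc he)
  have h2 : fderiv ℝ (F ∘ S.param c e) y = 0 := by
    have : F ∘ S.param c e =ᶠ[nhds y] fun _ => 0 := by
      filter_upwards [hW.mem_nhds hy] with y' hy' using h y' hy'
    rw [this.fderiv_eq]; simp
  rw [fderiv_comp y hF h1] at h2
  exact congrArg (fun L => L (basisVec k)) h2

/-! ### Killing fields that vanish on a surface -/

theorem IsBifurcationSurface.fderiv_tangent (hB : IsBifurcationSurface S φ V b κ)
    (hc : c ∈ atlas (E m) N) (he : e ∈ atlas (E (m + 2)) M) (hy : y ∈ S.paramDomain c e)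
    (d : Fin (m + 2)) (k : Fin m) :
    fderiv ℝ (fun x => V e x d) (S.param c e y) (S.tangent c e y k) = 0 :=
  S.fderiv_tangent_eq_zero hc he hy
    (differentiableAt_of_contDiffOn e.open_target (S.param_mem hy) (hB.vectorField.smooth e he d))
    (fun y' hy' => congrFun (hB.vanish e he (c.symm y') hy'.2) d) k

/-- On the surface, `∇_c V^d = κ b_c^d`. -/
theorem IsBifurcationSurface.nablaMat_eq (hB : IsBifurcationSurface S φ V b κ) (hφ : φ.IsField)
    (hc : c ∈ atlas (E m) N) (he : e ∈ atlas (E (m + 2)) M) (hy : y ∈ S.paramDomain c e) :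
    nablaMat (φ.Γ e) (V e) (S.param c e y) = κ • Matrix.of fun d c' =>
      ∑ h, b e (c.symm y) c' h * invMetric (φ.g e (S.param c e y)) h d := by
  set x := S.param c e y with hx
  set g := φ.g e x with hg
  have hxt : x ∈ e.target := S.param_mem hy
  have hV : V e x = 0 := hB.vanish e he _ hy.2
  have hL := hφ.metric.lorentzian e he x hxt
  have hdet : IsUnit (Matrix.of g).det := by
    have := hL.det_neg
    exact isUnit_iff_ne_zero.2 (by linarith)
  have hsymm : ∀ i j, invMetric g i j = invMetric g j i := by
    intro i j
    have h1 : (Matrix.of g).transpose = Matrix.of g := by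
      ext i j; exact hL.1 j i
    have h2 : ((Matrix.of g)⁻¹).transpose = (Matrix.of g)⁻¹ := by
      rw [Matrix.transpose_nonsing_inv, h1]
    exact (congrFun (congrFun h2 i) j).symm
  have hinv : ∀ i j, ∑ h, g i h * invMetric g h j = if i = j then 1 else 0 := by
    intro i j
    have := congrFun (congrFun (Matrix.mul_nonsing_inv _ hdet) i) j
    rwa [Matrix.mul_apply, Matrix.one_apply] at this
  have hnab : ∀ c' d, nablaVec (φ.Γ e) (V e) x c' d = pd c' (fun z => V e z d) x := by
    intro c' d
    simp [nablaVec, hV]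
  -- `∇V` with its index lowered; where `V = 0` the Killing equation says precisely that it is
  -- antisymmetric.
  let F : Ix2 (m + 2) := fun i j => ∑ d, pd i (fun z => V e z d) x * g d j
  have hF : ∀ i j, F i j = -F j i := by
    intro i j
    have := congrFun (congrFun (hB.killing e he x hxt) i) j
    simp only [lieMetric, hV, Pi.zero_apply, zero_mul, zero_add, Finset.sum_add_distrib] at this
    have h1 : F i j = ∑ d, g d j * pd i (fun z => V e z d) x :=
      Finset.sum_congr rfl fun _ _ => mul_comm _ _
    have h2 : F j i = ∑ d, g i d * pd j (fun z => V e z d) x :=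
      Finset.sum_congr rfl fun d _ => by rw [show g i d = g d i from hL.1 i d]; exact mul_comm _ _
    rw [h1, h2]
    linarith
  have hFt : ∀ a k, ∑ d, F a d * S.tangent c e y k d = 0 := by
    intro a k
    have h1 : ∑ d, F a d * S.tangent c e y k d =
        -∑ d, (∑ i, S.tangent c e y k i * pd i (fun z => V e z d) x) * g d a := by
      simp only [hF a, F, Finset.sum_mul, neg_mul, Finset.sum_neg_distrib]
      rw [Finset.sum_comm]
      exact congrArg _ (Finset.sum_congr rfl fun _ _ => Finset.sum_congr rfl fun _ _ => by ring)
    rw [h1, neg_eq_zero]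
    refine Finset.sum_eq_zero fun d _ => ?_
    rw [← fderiv_apply_eq_sum_pd, hx, hB.fderiv_tangent hc he hy d k, zero_mul]
  obtain ⟨i, j, hij⟩ := hB.binormal_ne_zero he hy.2
  obtain ⟨r, hr⟩ := exists_eq_mul_of_annihilate (S.linearIndependent_tangent hc he hy)
    (hB.binormal.antisymm e he _ hy.2) (hB.normal hc he hy) hF hFt hij
  have hpd : ∀ c' d, pd c' (fun z => V e z d) x =
      r * ∑ h, b e (c.symm y) c' h * invMetric g h d := by
    intro c' d
    have h1 : ∑ h, F c' h * invMetric g h d = pd c' (fun z => V e z d) x := by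
      simp only [F, Finset.sum_mul]
      rw [Finset.sum_comm]
      simp only [mul_assoc, ← Finset.mul_sum, hinv]
      simp
    rw [← h1, Finset.mul_sum]
    exact Finset.sum_congr rfl fun h _ => by rw [hr]; ring
  -- The surface gravity contracts `b` with `∇V = r b`, giving `r b·b = -2 r` by the normalization
  -- of `b`.
  have hrκ : r = κ := by
    have h1 := hB.surfaceGravity e he (c.symm y) hy.2
    have h2 := hB.binormal.normalized e he (c.symm y) hy.2
    change ∑ a, ∑ c', ∑ d, invMetric g a c' * b e (c.symm y) a d *
      nablaVec (φ.Γ e) (V e) x c' d = _ at h1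
    change ∑ a, ∑ c', ∑ d, ∑ h, invMetric g a c' * invMetric g d h *
      b e (c.symm y) a d * b e (c.symm y) c' h = _ at h2
    simp only [hnab, hpd] at h1
    have h3 : ∑ a, ∑ c', ∑ d, invMetric g a c' * b e (c.symm y) a d *
        (r * ∑ h, b e (c.symm y) c' h * invMetric g h d) = r * -2 := by
      rw [← h2]
      simp only [Finset.mul_sum]
      refine Finset.sum_congr rfl fun _ _ => Finset.sum_congr rfl fun _ _ =>
        Finset.sum_congr rfl fun d _ => Finset.sum_congr rfl fun h _ => ?_
      rw [hsymm h d]; ring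
    linarith
  ext d c'
  simp only [nablaMat, Matrix.of_apply, Matrix.smul_apply, smul_eq_mul, hnab, hpd, hrκ]

/-- The configuration `ψ` shares only the metric with `φ`, so the identity also covers the
transformed multipliers. -/
theorem IsBifurcationSurface.epsForm2_trace_eq (hB : IsBifurcationSurface S φ V b κ)
    (hφ : φ.IsField) (hc : c ∈ atlas (E m) N) (he : e ∈ atlas (E (m + 2)) M)
    (hy : y ∈ S.paramDomain c e) (ψ : Config (m + 2) M) (hψ : ψ.g = φ.g) :
    epsForm2 (fun i j => (densMat3 (ψ.lamR e) i j (S.param c e y) *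
        nablaMat (φ.Γ e) (V e) (S.param c e y)).trace) =
      κ • entropyForm S ψ b e (c.symm y) := by
  rw [hB.nablaMat_eq hφ hc he hy, entropyForm, hψ]
  simp only [← epsForm2_smul, ← epsForm2_sum]
  congr 1
  ext i j
  simp only [Matrix.mul_smul, Matrix.trace_smul, smul_eq_mul]
  congr 1
  simp only [Matrix.trace, Matrix.diag, Matrix.mul_apply, densMat3, Matrix.of_apply,
    Finset.mul_sum]
  refine Finset.sum_congr rfl fun c' _ => ?_
  rw [Finset.sum_comm]
  refine Finset.sum_congr rfl fun d _ => Finset.sum_congr rfl fun h _ => ?_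
  rw [ClosedSurface.param]
  ring

/-- On the surface a form `ε_{ab} X^{ab}` sees only `X^{ab} b_{ab}`. With `∇V = κ b` this contracts
`κ3` with `b ∧ b`, which is zero. -/
theorem IsBifurcationSurface.epsForm2_trace_totallyAntisymm (hB : IsBifurcationSurface S φ V b κ)
    (hφ : φ.IsField) (hc : c ∈ atlas (E m) N) (he : e ∈ atlas (E (m + 2)) M)
    (hy : y ∈ S.paramDomain c e) {κ3 : Comp (m + 2) M (Ix4 (m + 2))} (h3 : TotallyAntisymm3 κ3) :
    epsForm2 (fun i j => (densMat3 (κ3 e) i j (S.param c e y) *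
        nablaMat (φ.Γ e) (V e) (S.param c e y)).trace) (S.tangent c e y) = 0 := by
  obtain ⟨i, j, hij⟩ := hB.binormal_ne_zero he hy.2
  have ht := S.linearIndependent_tangent hc he hy
  have hb := hB.binormal.antisymm e he _ hy.2
  refine epsForm2_apply_eq_zero ht hb (hB.normal hc he hy) hij ?_
  rw [hB.nablaMat_eq hφ hc he hy]
  set x := S.param c e y
  have hx : x ∈ e.target := S.param_mem hy
  have key : ∀ d h, ∑ c', ∑ a, ∑ k, κ3 e x d c' a k * b e (c.symm y) c' h *
      b e (c.symm y) a k = 0 := fun d h =>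
    sum_antisymm_mul_normal_eq_zero ht hb (hB.normal hc he hy) hij
      (D := fun c' a k => κ3 e x d c' a k) (fun p q r => h3 e he x hx d p q r) h
  have h1 : ∑ a, ∑ k, (densMat3 (κ3 e) a k x * (κ • Matrix.of fun d c' =>
        ∑ h, b e (c.symm y) c' h * invMetric (φ.g e x) h d)).trace * b e (c.symm y) a k =
      κ * ∑ d, ∑ h, invMetric (φ.g e x) h d * ∑ c', ∑ a, ∑ k, κ3 e x d c' a k *
        b e (c.symm y) c' h * b e (c.symm y) a k := by
    simp only [Matrix.trace, Matrix.diag, Matrix.mul_apply, Matrix.smul_apply, smul_eq_mul,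
      densMat3, Matrix.of_apply, Finset.mul_sum, Finset.sum_mul]
    refine ((Finset.sum_congr rfl fun a _ => (Finset.sum_congr rfl fun k _ =>
      sum_rotate_left3 _).trans (sum_rotate_left4 _)).trans (sum_rotate_left4 _)).trans ?_
    refine Finset.sum_congr rfl fun d _ => Finset.sum_congr rfl fun h _ =>
      Finset.sum_congr rfl fun c' _ => Finset.sum_congr rfl fun a _ =>
      Finset.sum_congr rfl fun k _ => ?_
    ring
  rw [h1]
  simp [key]

end Surface

/-! ### Integrals over a surface -/

section Integral

variable {m : ℕ} {M N : Type*} [TopologicalSpace M] [ChartedSpace (E (m + 2)) M]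
  [TopologicalSpace N] [ChartedSpace (E m) N]
  {S : ClosedSurface m M N}

/-- Outside the support of the cut-off the surface may leave the chart of `M`, where the forms are
meaningless; the vanishing cut-off hides this. -/
theorem ClosedSurface.integral_congr
    {α β : Chart (m + 2) M → N → E (m + 2) [⋀^Fin m]→L[ℝ] ℝ}
    (h : ∀ i, ∀ y ∈ S.paramDomain (S.chartN i) (S.chartM i),
      α (S.chartM i) ((S.chartN i).symm y) (S.tangent (S.chartN i) (S.chartM i) y) =
        β (S.chartM i) ((S.chartN i).symm y) (S.tangent (S.chartN i) (S.chartM i) y)) :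
    S.integral α = S.integral β := by
  refine Finset.sum_congr rfl fun i _ => MeasureTheory.setIntegral_congr_fun
    (S.chartN i).open_target.measurableSet fun y hy => ?_
  by_cases hy' : (S.chartN i).symm y ∈ tsupport (S.ρ i)
  · exact congrArg _ (h i y ⟨hy, (S.ρ_supp i hy').2⟩)
  · simp [image_eq_zero_of_notMem_tsupport hy']

theorem ClosedSurface.integral_smul (r : ℝ)
    (α : Chart (m + 2) M → N → E (m + 2) [⋀^Fin m]→L[ℝ] ℝ) :
    S.integral (fun e p => r • α e p) = r * S.integral α := by
  simp only [ClosedSurface.integral, Finset.mul_sum, ← MeasureTheory.integral_const_mul]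
  refine Finset.sum_congr rfl fun i _ => congrArg _ ?_
  ext y
  simp only [ContinuousAlternatingMap.smul_apply, smul_eq_mul]
  ring

/-- By `IsNoetherCharge.eval_eq` the charge may be replaced by the explicit one, whose `λ_T` part
dies with `V` on the surface. -/
theorem IsNoetherCharge.integral_eq [IsManifold (𝓡 (m + 2)) ∞ M] [IsManifold (𝓡 m) ∞ N]
    (hM : OrientedAtlas (m + 2) M)
    {f : Ix2 (m + 2) → Ix3 (m + 2) → ℝ} (hf : IsScalarFunction f) {φ : Config (m + 2) M}
    (hφ : φ.IsField) (hs : φ.OnShell f) {Q : ChargeOperator m M} (hQ : IsNoetherCharge f φ Q)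
    {V : Comp (m + 2) M (Ix1 (m + 2))} {b : Chart (m + 2) M → N → Ix2 (m + 2)} {κ : ℝ}
    (hB : IsBifurcationSurface S φ V b κ) :
    S.integral (fun e p => Q.eval e (V e) (e (S.ι p))) = κ / (2 * Real.pi) * entropy S φ b := by
  have h1 : S.integral (fun e p => Q.eval e (V e) (e (S.ι p))) =
      S.integral (fun e p => κ • entropyForm S φ b e p) := by
    refine S.integral_congr fun i y hy => ?_
    have hc := S.chartN_mem i
    have he := S.chartM_mem i
    rw [← hB.epsForm2_trace_eq hφ hc he hy φ rfl]
    have hV := hB.vanish _ he _ hy.2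
    change Q.eval _ (V _) (S.param _ _ y) _ = _
    rw [hQ.eval_eq (isNoetherCharge_noetherCharge hM hf hφ hs) he (S.param_mem hy) hV
      (hB.fderiv_tangent hc he hy), noetherCharge_eval]
    refine congrArg (fun X => epsForm2 X _) ?_
    ext i' j'
    have hV' : V (S.chartM i) (S.param (S.chartN i) (S.chartM i) y) = 0 := hV
    simp [chargeTensor, hV']
  rw [h1, S.integral_smul, entropy]
  field_simp

end Integral

/-! ### The exact difference of the two boundary terms. -/

section Exact

variable {m : ℕ} {M : Type*} [TopologicalSpace M] [ChartedSpace (E (m + 2)) M]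

theorem TotallyAntisymm4.swap_outer {κ4 : Comp (m + 2) M (Ix5 (m + 2))} (h : TotallyAntisymm4 κ4)
    {e : Chart (m + 2) M} (he : e ∈ atlas (E (m + 2)) M) {x : E (m + 2)} (hx : x ∈ e.target)
    (a b c d f : Fin (m + 2)) : κ4 e x a b c d f = -κ4 e x a b f d c := by
  rw [(h e he x hx a b c d f).1, (h e he x hx a b d c f).2, (h e he x hx a b d f c).1, neg_neg]

theorem theta_gauge_eq {f : Ix2 (m + 2) → Ix3 (m + 2) → ℝ} {φ : Config (m + 2) M}
    (hs : φ.OnShell f) {κ4 : Comp (m + 2) M (Ix5 (m + 2))}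
    {κ3 : Comp (m + 2) M (Ix4 (m + 2))} (h4 : IsDensity4 κ4) (h4a : TotallyAntisymm4 κ4)
    (h3a : TotallyAntisymm3 κ3) {e : Chart (m + 2) M} (he : e ∈ atlas (E (m + 2)) M)
    {γ : E (m + 2) → Ix3 (m + 2)} (hγ : ∀ a b c, ContDiffOn ℝ ∞ (fun x => γ x a b c) e.target)
    (hγT : ∀ x ∈ e.target, torsion (γ x) = 0)
    (hγR : ∀ x ∈ e.target, linCurvature (φ.Γ e) γ x = 0) {x : E (m + 2)} (hx : x ∈ e.target) :
    epsForm1 (theta ((φ.gauge κ4 κ3).lamR e x) (γ x)) =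
      epsForm1 (theta (φ.lamR e x) (γ x)) + extDeriv (fun y => yForm (κ4 e y) (γ y)) x := by
  have hU := e.open_target
  have h1 : extDeriv (fun y => yForm (κ4 e y) (γ y)) x =
      epsForm1 (theta (divDensity4 (φ.Γ e) (κ4 e) x) (γ x)) := by
    refine (extDeriv_epsForm2 hU hx (fun a b => ContDiffOn.sum fun d _ => ContDiffOn.sum fun c _ =>
      ContDiffOn.sum fun h _ => (h4.smooth e he d c a h b).mul (hγ d h c)) fun y hy a b => ?_).trans
      (congrArg epsForm1 ?_)
    · simp only [← Finset.sum_neg_distrib, ← neg_mul]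
      exact Finset.sum_congr rfl fun d _ => Finset.sum_congr rfl fun c _ =>
        Finset.sum_congr rfl fun h _ => by rw [h4a.swap_outer he hy d c a h b]
    · ext a
      exact (theta_divDensity4 hU hx (hs.torsionFree e he x hx)
        (fun a b c d f => h4.smooth e he a b c d f) (h4a e he x hx) hγ (hγR x hx) a).symm
  have h2 : theta ((φ.gauge κ4 κ3).lamR e x) (γ x) = fun a =>
      theta (φ.lamR e x) (γ x) a + theta (divDensity4 (φ.Γ e) (κ4 e) x) (γ x) a := by
    ext a
    have h3 := congrFun (theta_eq_zero_of_antisymm (hγT x hx) (h3a e he x hx)) a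
    change theta (fun a b c d => _ + κ3 e x a b c d) (γ x) a = _
    rw [theta_add, theta_add, h3, Pi.zero_apply, add_zero]
  rw [h1, h2]
  simp only [epsForm1_def, add_smul, Finset.sum_add_distrib]

end Exact

/-! ### Compactly supported forms on coordinate space -/

section Compact

variable {m k : ℕ}

/-- The coordinate frame. -/
def frame (m : ℕ) : Fin m → E m := fun i => basisVec i

theorem contDiffOn_alternating_apply {n : ℕ} {p : WithTop ℕ∞} {W : Type*}
    [NormedAddCommGroup W] [NormedSpace ℝ W] {α : W → E n [⋀^Fin k]→L[ℝ] ℝ} {t : W → Fin k → E n} {s : Set W}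
    (hα : ContDiffOn ℝ p α s) (ht : ∀ i, ContDiffOn ℝ p (fun y => t y i) s) :
    ContDiffOn ℝ p (fun y => α y (t y)) s := by
  let B : (E n [⋀^Fin k]→L[ℝ] ℝ) →L[ℝ] ContinuousMultilinearMap ℝ (fun _ : Fin k => E n) ℝ :=
    ContinuousAlternatingMap.toContinuousMultilinearMapCLM ℝ
  have hB : ContDiff ℝ p fun q : (E n [⋀^Fin k]→L[ℝ] ℝ) × (Fin k → E n) => B q.1 q.2 :=
    contDiff_iff_contDiffAt.2 fun q => B.analyticAt_uncurry_of_multilinear.contDiffAt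
  exact hB.comp_contDiffOn (hα.prodMk (contDiffOn_pi.2 ht))

/-- The components of an alternating form. -/
def components (n k : ℕ) : (E n [⋀^Fin k]→L[ℝ] ℝ) →ₗ[ℝ] ((Fin k → Fin n) → ℝ) where
  toFun α I := α fun i => basisVec (I i)
  map_add' _ _ := rfl
  map_smul' _ _ := rfl

theorem components_injective (n k : ℕ) : Function.Injective (components n k) := by
  intro α β h
  apply ContinuousAlternatingMap.toAlternatingMap_injective
  refine Module.Basis.ext_alternating (EuclideanSpace.basisFun (Fin n) ℝ).toBasis fun v _ => ?_
  simpa using show α (fun i => basisVec (v i)) = β fun i => basisVec (v i) from congrFun h v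

theorem contDiffOn_of_components {n : ℕ} {p : WithTop ℕ∞} {W : Type*} [NormedAddCommGroup W]
    [NormedSpace ℝ W] {α : W → E n [⋀^Fin k]→L[ℝ] ℝ} {s : Set W}
    (h : ∀ I : Fin k → Fin n, ContDiffOn ℝ p (fun y => α y fun i => basisVec (I i)) s) :
    ContDiffOn ℝ p α s := by
  obtain ⟨L, hL⟩ := (components n k).exists_leftInverse_of_injective
    (LinearMap.ker_eq_bot.2 (components_injective n k))
  have h1 : α = fun y => (LinearMap.toContinuousLinearMap L) (components n k (α y)) := by
    ext1 y
    exact (congrArg (fun T => T (α y)) hL).symm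
  rw [h1]
  exact (LinearMap.toContinuousLinearMap L).contDiff.comp_contDiffOn (contDiffOn_pi.2 h)

theorem contDiffOn_pullback {n n' : ℕ} {α : E n → E n [⋀^Fin k]→L[ℝ] ℝ} {F : E n' → E n}
    {s : Set (E n')} {t : Set (E n)} (hs : IsOpen s) (hα : ContDiffOn ℝ ∞ α t)
    (hF : ContDiffOn ℝ ∞ F s) (hst : Set.MapsTo F s t) :
    ContDiffOn ℝ ∞ (fun y => (α (F y)).compContinuousLinearMap (fderiv ℝ F y)) s :=
  contDiffOn_of_components fun I =>
    contDiffOn_alternating_apply (t := fun y i => fderiv ℝ F y (basisVec (I i)))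
      (hα.comp hF hst) fun _ =>
        (hF.fderiv_of_isOpen hs (m := ∞) (by simp)).clm_apply contDiffOn_const

/-- The integral of a derivative of a compactly supported function vanishes. -/
theorem integral_fderiv_eq_zero {F : E m → ℝ} (hF : ContDiff ℝ 1 F) (hc : HasCompactSupport F)
    (v : E m) : ∫ y, fderiv ℝ F y v = 0 := by
  have h1 : Continuous fun y => fderiv ℝ F y v :=
    (hF.continuous_fderiv one_ne_zero).clm_apply continuous_const
  have h2 : HasCompactSupport fun y => fderiv ℝ F y v := hc.fderiv_apply (𝕜 := ℝ) v
  -- Integration by parts against the constant function `1`, whose derivative is zero.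
  have := integral_mul_fderiv_eq_neg_fderiv_mul_of_integrable (μ := MeasureTheory.volume)
    (f := fun _ : E m => (1 : ℝ)) (g := F) (v := v) (by simp)
    (by simpa using h1.integrable_of_hasCompactSupport h2)
    (by simpa using hF.continuous.integrable_of_hasCompactSupport hc)
    (by simp) (fun _ _ => (hF.differentiable one_ne_zero).differentiableAt)
  simpa using this

theorem integral_extDeriv_eq_zero {w : E (k + 1) → E (k + 1) [⋀^Fin k]→L[ℝ] ℝ}
    (hw : ContDiff ℝ 1 w) (hc : HasCompactSupport w) :
    ∫ y, extDeriv w y (frame (k + 1)) = 0 := by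
  have hd : ∀ y, DifferentiableAt ℝ w y := fun y => (hw.differentiable one_ne_zero).differentiableAt
  simp only [fun y => extDeriv_apply (hd y) (frame (k + 1)), zsmul_eq_mul]
  have h0 : ∀ t : Fin k → E (k + 1), ContDiff ℝ 1 fun y => w y t := fun t =>
    contDiffOn_univ.1 (contDiffOn_alternating_apply hw.contDiffOn fun _ => contDiffOn_const)
  have hc0 : ∀ t : Fin k → E (k + 1), HasCompactSupport fun y => w y t := fun t =>
    hc.comp_left (g := fun α : E (k + 1) [⋀^Fin k]→L[ℝ] ℝ => α t) rfl
  have h1 : ∀ i : Fin (k + 1), Continuous fun y =>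
      fderiv ℝ (fun y => w y (i.removeNth (frame (k + 1)))) y (frame (k + 1) i) := fun i =>
    ((h0 _).continuous_fderiv one_ne_zero).clm_apply continuous_const
  rw [MeasureTheory.integral_finsetSum]
  · refine Finset.sum_eq_zero fun i _ => ?_
    rw [MeasureTheory.integral_const_mul, integral_fderiv_eq_zero (h0 _) (hc0 _), mul_zero]
  · exact fun i _ => ((h1 i).integrable_of_hasCompactSupport
      ((hc0 _).fderiv_apply (𝕜 := ℝ) _)).const_mul _

/-- Extension by zero of a function that vanishes away from a compact set. -/
theorem contDiff_indicator {W : Type*} [NormedAddCommGroup W] [NormedSpace ℝ W] {p : WithTop ℕ∞}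
    {U K : Set (E m)} {F : E m → W} (hU : IsOpen U) (hK : IsClosed K) (hKU : K ⊆ U)
    (hF : ContDiffOn ℝ p F U) (h0 : ∀ y ∈ U, y ∉ K → F y = 0) : ContDiff ℝ p (U.indicator F) := by
  rw [contDiff_iff_contDiffAt]
  intro y
  by_cases hy : y ∈ U
  · refine (hF.contDiffAt (hU.mem_nhds hy)).congr_of_eventuallyEq ?_
    filter_upwards [hU.mem_nhds hy] with z hz using Set.indicator_of_mem hz F
  · refine contDiffAt_const (c := (0 : W)) |>.congr_of_eventuallyEq ?_
    filter_upwards [hK.isOpen_compl.mem_nhds fun h => hy (hKU h)] with z hz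
    by_cases hzU : z ∈ U
    · rw [Set.indicator_of_mem hzU, h0 z hzU hz]
    · rw [Set.indicator_of_notMem hzU]

theorem hasCompactSupport_indicator {W : Type*} [NormedAddCommGroup W]
    {U K : Set (E m)} {F : E m → W} (hK : IsCompact K)
    (h0 : ∀ y ∈ U, y ∉ K → F y = 0) : HasCompactSupport (U.indicator F) :=
  HasCompactSupport.intro hK fun y hy => by
    by_cases hyU : y ∈ U
    · rw [Set.indicator_of_mem hyU, h0 y hyU hy]
    · rw [Set.indicator_of_notMem hyU]

theorem integrableOn_of_eq_zero {U K : Set (E m)} {F : E m → ℝ} (hU : IsOpen U) (hK : IsCompact K)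
    (hKU : K ⊆ U) (hF : ContinuousOn F U) (h0 : ∀ y ∈ U, y ∉ K → F y = 0) :
    MeasureTheory.IntegrableOn F U := by
  rw [← MeasureTheory.integrable_indicator_iff hU.measurableSet]
  refine Continuous.integrable_of_hasCompactSupport ?_ (hasCompactSupport_indicator hK h0)
  rw [← contDiff_zero (𝕜 := ℝ)]
  exact contDiff_indicator hU hK.isClosed hKU (contDiffOn_zero.2 hF) h0

theorem setIntegral_extDeriv_eq_zero {U K : Set (E (k + 1))}
    {w : E (k + 1) → E (k + 1) [⋀^Fin k]→L[ℝ] ℝ} (hU : IsOpen U) (hK : IsCompact K)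
    (hKU : K ⊆ U) (hw : ContDiffOn ℝ 1 w U) (h0 : ∀ y ∈ U, y ∉ K → w y = 0) :
    ∫ y in U, extDeriv w y (frame (k + 1)) = 0 := by
  rw [← integral_extDeriv_eq_zero (contDiff_indicator hU hK.isClosed hKU hw h0)
    (hasCompactSupport_indicator hK h0), ← MeasureTheory.integral_indicator hU.measurableSet]
  congr 1
  ext1 y
  by_cases hy : y ∈ U
  · rw [Set.indicator_of_mem hy]
    have : U.indicator w =ᶠ[nhds y] w := by
      filter_upwards [hU.mem_nhds hy] with z hz using Set.indicator_of_mem hz w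
    rw [this.extDeriv_eq]
  · rw [Set.indicator_of_notMem hy]
    have : U.indicator w =ᶠ[nhds y] fun _ => 0 := by
      filter_upwards [hK.isClosed.isOpen_compl.mem_nhds fun h => hy (hKU h)] with z hz
      by_cases hzU : z ∈ U
      · rw [Set.indicator_of_mem hzU, h0 z hzU hz]
      · rw [Set.indicator_of_notMem hzU]
    rw [this.extDeriv_eq, extDeriv_apply (differentiableAt_const _)]
    simp

theorem continuousOn_extDeriv {n : ℕ} {U : Set (E n)} {w : E n → E n [⋀^Fin k]→L[ℝ] ℝ}
    (hU : IsOpen U) (hw : ContDiffOn ℝ 1 w U) : ContinuousOn (extDeriv w) U :=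
  (ContinuousAlternatingMap.alternatizeUncurryFinCLM ℝ (E n) ℝ).continuous.comp_continuousOn
    (hw.continuousOn_fderiv_of_isOpen hU le_rfl)

theorem pullback_frame (α : E m [⋀^Fin m]→L[ℝ] ℝ) (L : E m →L[ℝ] E m) :
    α.compContinuousLinearMap L (frame m) = L.det * α (frame m) := by
  have h := α.toAlternatingMap.eq_smul_basis_det (EuclideanSpace.basisFun (Fin m) ℝ).toBasis
  have hf : ⇑(EuclideanSpace.basisFun (Fin m) ℝ).toBasis = frame m := by
    ext1 i; simp [frame]
  rw [hf] at h
  have h0 : ∀ v, α v = α (frame m) * eps m v := fun v => congrArg (fun β => β v) h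
  have h1 : eps m (frame m) = 1 := by
    rw [← hf]
    exact (EuclideanSpace.basisFun (Fin m) ℝ).toBasis.det_self
  rw [ContinuousAlternatingMap.compContinuousLinearMap_apply, h0]
  change _ * eps m (fun i => L (frame m i)) = _
  rw [eps_comp, h1, mul_one, mul_comm]

end Compact

/-! ### Stokes' theorem on a closed surface -/

section Partition

variable {m : ℕ} {M N : Type*} [TopologicalSpace M] [ChartedSpace (E (m + 2)) M]
  [TopologicalSpace N] [ChartedSpace (E m) N] (S : ClosedSurface m M N)

/-- The coordinate domain of the `i`-th piece of the surface. -/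
def ClosedSurface.piece (i : Fin S.k) : Set (E m) := S.paramDomain (S.chartN i) (S.chartM i)

/-- The `j`-th cut-off function in the coordinates of the `i`-th piece. -/
def ClosedSurface.cutoff (i j : Fin S.k) (y : E m) : ℝ := S.ρ j ((S.chartN i).symm y)

/-- The coordinates of the support of the `i`-th cut-off function. -/
def ClosedSurface.supp (i : Fin S.k) : Set (E m) := S.chartN i '' tsupport (S.ρ i)

variable {S} {i j : Fin S.k} {y : E m}

theorem ClosedSurface.isOpen_piece : IsOpen (S.piece i) := S.isOpen_paramDomain _ _

theorem ClosedSurface.isCompact_supp [CompactSpace N] : IsCompact (S.supp i) :=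
  (isClosed_tsupport (S.ρ i)).isCompact.image_of_continuousOn
    ((S.chartN i).continuousOn.mono fun _ hp => (S.ρ_supp i hp).1)

theorem ClosedSurface.supp_subset : S.supp i ⊆ S.piece i := by
  rintro _ ⟨p, hp, rfl⟩
  have h := S.ρ_supp i hp
  refine ⟨(S.chartN i).map_source h.1, ?_⟩
  rw [Set.mem_preimage, (S.chartN i).left_inv h.1]
  exact h.2

theorem ClosedSurface.notMem_tsupport (hy : y ∈ S.piece i) (h : y ∉ S.supp i) :
    (S.chartN i).symm y ∉ tsupport (S.ρ i) := fun h' =>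
  h ⟨_, h', (S.chartN i).right_inv hy.1⟩

theorem ClosedSurface.cutoff_eq_zero (h : (S.chartN i).symm y ∉ tsupport (S.ρ j)) :
    S.cutoff i j y = 0 :=
  image_eq_zero_of_notMem_tsupport (f := S.ρ j) h

theorem ClosedSurface.cutoff_eventually_zero (hy : y ∈ S.piece i)
    (h : (S.chartN i).symm y ∉ tsupport (S.ρ j)) : ∀ᶠ z in nhds y, S.cutoff i j z = 0 := by
  have h1 : ContinuousAt (S.chartN i).symm y := (S.chartN i).continuousAt_symm hy.1
  filter_upwards [h1.eventually ((isClosed_tsupport (S.ρ j)).isOpen_compl.mem_nhds h)] with z hz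
  exact S.cutoff_eq_zero hz

theorem ClosedSurface.sum_cutoff (i : Fin S.k) (y : E m) : ∑ j, S.cutoff i j y = 1 := S.ρ_sum _

/-- Restricting to `piece`, where the surface is inside the chart of `M`, makes the integrand smooth
on an open domain without changing the integral. -/
theorem ClosedSurface.integral_eq (α : Chart (m + 2) M → N → E (m + 2) [⋀^Fin m]→L[ℝ] ℝ) :
    S.integral α = ∑ i, ∫ y in S.piece i, S.cutoff i i y *
      α (S.chartM i) ((S.chartN i).symm y) (S.tangent (S.chartN i) (S.chartM i) y) := by
  refine Finset.sum_congr rfl fun i _ => ?_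
  refine (MeasureTheory.setIntegral_eq_of_subset_of_forall_sdiff_eq_zero
    (S.chartN i).open_target.measurableSet Set.inter_subset_left fun y hy => ?_).trans rfl
  have : (S.chartN i).symm y ∉ tsupport (S.ρ i) := fun h => hy.2 ⟨hy.1, (S.ρ_supp i h).2⟩
  exact mul_eq_zero_of_left (image_eq_zero_of_notMem_tsupport this) _

variable [IsManifold (𝓡 m) ∞ N]

theorem ClosedSurface.contDiffOn_cutoff : ContDiffOn ℝ ∞ (S.cutoff i j) (S.piece i) := by
  rw [← contMDiffOn_iff_contDiffOn]
  have h2 := contMDiffOn_symm_of_mem_maximalAtlas (I := 𝓡 m) (n := ∞)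
    (IsManifold.subset_maximalAtlas (S.chartN_mem i))
  exact ((S.ρ_smooth j).comp_contMDiffOn h2).mono Set.inter_subset_left

theorem ClosedSurface.integrableOn [CompactSpace N] {F : E m → ℝ}
    (hF : ContinuousOn F (S.piece i)) :
    MeasureTheory.IntegrableOn (fun y => S.cutoff i i y * F y) (S.piece i) :=
  integrableOn_of_eq_zero S.isOpen_piece S.isCompact_supp S.supp_subset
    (S.contDiffOn_cutoff.continuousOn.mul hF) fun _ hy h =>
      mul_eq_zero_of_left (S.cutoff_eq_zero (S.notMem_tsupport hy h)) _

theorem ClosedSurface.continuousOn_form [IsManifold (𝓡 (m + 2)) ∞ M]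
    {α : Comp (m + 2) M (E (m + 2) [⋀^Fin m]→L[ℝ] ℝ)}
    (hα : ∀ e ∈ atlas (E (m + 2)) M, ContDiffOn ℝ ∞ (α e) e.target) (i : Fin S.k) :
    ContinuousOn (fun y => α (S.chartM i) (S.param (S.chartN i) (S.chartM i) y)
      (S.tangent (S.chartN i) (S.chartM i) y)) (S.piece i) := by
  have h := S.contDiffOn_param (S.chartN_mem i) (S.chartM_mem i)
  refine (contDiffOn_alternating_apply (p := ∞)
    ((hα _ (S.chartM_mem i)).comp h fun y hy => S.param_mem hy) fun k => ?_).continuousOn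
  exact (h.fderiv_of_isOpen S.isOpen_piece (m := ∞) (by simp)).clm_apply contDiffOn_const

theorem ClosedSurface.integral_add [CompactSpace N] [IsManifold (𝓡 (m + 2)) ∞ M]
    {α β : Comp (m + 2) M (E (m + 2) [⋀^Fin m]→L[ℝ] ℝ)}
    (hα : ∀ e ∈ atlas (E (m + 2)) M, ContDiffOn ℝ ∞ (α e) e.target)
    (hβ : ∀ e ∈ atlas (E (m + 2)) M, ContDiffOn ℝ ∞ (β e) e.target) :
    S.integral (fun e p => α e (e (S.ι p)) + β e (e (S.ι p))) =
      S.integral (fun e p => α e (e (S.ι p))) + S.integral (fun e p => β e (e (S.ι p))) := by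
  rw [S.integral_eq, S.integral_eq, S.integral_eq, ← Finset.sum_add_distrib]
  refine Finset.sum_congr rfl fun i _ => ?_
  have hα' := S.integrableOn (S.continuousOn_form hα i)
  have hβ' := S.integrableOn (S.continuousOn_form hβ i)
  refine Eq.trans ?_ (MeasureTheory.integral_add hα' hβ')
  congr 1
  ext y
  rw [ContinuousAlternatingMap.add_apply, mul_add]

end Partition

/-! ### Comparison of the local pieces and gluing. -/

section Stokes

variable {k : ℕ} {M N : Type*} [TopologicalSpace M] [ChartedSpace (E (k + 1 + 2)) M]
  [TopologicalSpace N] [ChartedSpace (E (k + 1)) N] {S : ClosedSurface (k + 1) M N}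

/-- The pullback of a form to the `i`-th piece of the surface. -/
def ClosedSurface.pull (S : ClosedSurface (k + 1) M N)
    (ζ : Comp (k + 1 + 2) M (E (k + 1 + 2) [⋀^Fin k]→L[ℝ] ℝ)) (i : Fin S.k) (y : E (k + 1)) :
    E (k + 1) [⋀^Fin k]→L[ℝ] ℝ :=
  (ζ (S.chartM i) (S.param (S.chartN i) (S.chartM i) y)).compContinuousLinearMap
    (fderiv ℝ (S.param (S.chartN i) (S.chartM i)) y)

/-- The coordinates of the points that the `i`-th and `j`-th pieces have in common. -/
def ClosedSurface.common (S : ClosedSurface (k + 1) M N) (i j : Fin S.k) : Set (E (k + 1)) :=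
  S.piece i ∩ S.paramDomain (S.chartN i) (S.chartM j) ∩ overlap (S.chartN i) (S.chartN j)

theorem ClosedSurface.isOpen_common (i j : Fin S.k) : IsOpen (S.common i j) :=
  (S.isOpen_piece.inter (S.isOpen_paramDomain _ _)).inter (isOpen_overlap _ _)

variable {i j l : Fin S.k} {y : E (k + 1)}

theorem ClosedSurface.symm_trans (hy : y ∈ overlap (S.chartN i) (S.chartN j)) :
    (S.chartN j).symm (trans (S.chartN i) (S.chartN j) y) = (S.chartN i).symm y :=
  (S.chartN j).left_inv hy.2

theorem ClosedSurface.trans_mem_common (hy : y ∈ S.common i j) :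
    trans (S.chartN i) (S.chartN j) y ∈ S.common j i := by
  have h := trans_mem_overlap hy.2
  refine ⟨⟨⟨h.1, ?_⟩, ⟨h.1, ?_⟩⟩, h⟩
  · rw [Set.mem_preimage, S.symm_trans hy.2]; exact hy.1.2.2
  · rw [Set.mem_preimage, S.symm_trans hy.2]; exact hy.1.1.2

theorem ClosedSurface.image_common :
    trans (S.chartN i) (S.chartN j) '' S.common i j = S.common j i := by
  refine Set.Subset.antisymm (Set.image_subset_iff.2 fun y hy => S.trans_mem_common hy)
    fun y hy => ⟨_, S.trans_mem_common hy, trans_trans hy.2⟩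

theorem ClosedSurface.cutoff_trans (hy : y ∈ overlap (S.chartN i) (S.chartN j)) :
    S.cutoff j l (trans (S.chartN i) (S.chartN j) y) = S.cutoff i l y := by
  rw [ClosedSurface.cutoff, S.symm_trans hy, ClosedSurface.cutoff]

theorem ClosedSurface.param_trans (hy : y ∈ S.common i j) :
    S.param (S.chartN j) (S.chartM j) (trans (S.chartN i) (S.chartN j) y) =
      trans (S.chartM i) (S.chartM j) (S.param (S.chartN i) (S.chartM i) y) := by
  have : (S.chartM i).symm (S.chartM i (S.ι ((S.chartN i).symm y))) = S.ι ((S.chartN i).symm y) :=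
    (S.chartM i).left_inv hy.1.1.2
  rw [ClosedSurface.param, S.symm_trans hy.2, trans, ClosedSurface.param, this]

theorem ClosedSurface.param_mem_overlap (hy : y ∈ S.common i j) :
    S.param (S.chartN i) (S.chartM i) y ∈ overlap (S.chartM i) (S.chartM j) := by
  refine ⟨S.param_mem hy.1.1, ?_⟩
  have : (S.chartM i).symm (S.chartM i (S.ι ((S.chartN i).symm y))) = S.ι ((S.chartN i).symm y) :=
    (S.chartM i).left_inv hy.1.1.2
  rw [Set.mem_preimage, ClosedSurface.param, this]
  exact hy.1.2.2

variable {ζ : Comp (k + 1 + 2) M (E (k + 1 + 2) [⋀^Fin k]→L[ℝ] ℝ)}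

theorem ClosedSurface.extDeriv_cutoff_pull_eq_zero (hy : y ∈ S.piece i)
    (h : (S.chartN i).symm y ∉ tsupport (S.ρ j)) :
    extDeriv (fun z => S.cutoff i j z • S.pull ζ i z) y = 0 := by
  have : (fun z => S.cutoff i j z • S.pull ζ i z) =ᶠ[nhds y] fun _ => 0 := by
    filter_upwards [S.cutoff_eventually_zero hy h] with z hz
    rw [hz, zero_smul]
  rw [this.extDeriv_eq]
  ext v
  rw [extDeriv_apply (differentiableAt_const _)]
  simp

variable [IsManifold (𝓡 (k + 1 + 2)) ∞ M] [IsManifold (𝓡 (k + 1)) ∞ N]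

theorem ClosedSurface.contDiffOn_pull
    (hζ : ∀ e ∈ atlas (E (k + 1 + 2)) M, ContDiffOn ℝ ∞ (ζ e) e.target) :
    ContDiffOn ℝ ∞ (S.pull ζ i) (S.piece i) :=
  contDiffOn_pullback S.isOpen_piece (hζ _ (S.chartM_mem i))
    (S.contDiffOn_param (S.chartN_mem i) (S.chartM_mem i)) fun _ hy => S.param_mem hy

theorem ClosedSurface.pull_trans
    (hlaw : ∀ e ∈ atlas (E (k + 1 + 2)) M, ∀ e' ∈ atlas (E (k + 1 + 2)) M, ∀ x ∈ overlap e e',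
      (ζ e' (trans e e' x)).compContinuousLinearMap (fderiv ℝ (trans e e') x) = ζ e x)
    (hy : y ∈ S.common i j) :
    (S.pull ζ j (trans (S.chartN i) (S.chartN j) y)).compContinuousLinearMap
      (fderiv ℝ (trans (S.chartN i) (S.chartN j)) y) = S.pull ζ i y := by
  have hci := S.chartN_mem i
  have hcj := S.chartN_mem j
  have hei := S.chartM_mem i
  have hej := S.chartM_mem j
  have ht := S.trans_mem_common hy
  have d1 := differentiableAt_trans hci hcj hy.2
  have d2 := differentiableAt_of_contDiffOn S.isOpen_piece ht.1.1 (S.contDiffOn_param hcj hej)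
  have d3 := differentiableAt_of_contDiffOn S.isOpen_piece hy.1.1 (S.contDiffOn_param hci hei)
  have d4 := differentiableAt_trans hei hej (S.param_mem_overlap hy)
  have h1 : (fderiv ℝ (S.param (S.chartN j) (S.chartM j)) (trans (S.chartN i) (S.chartN j) y)).comp
      (fderiv ℝ (trans (S.chartN i) (S.chartN j)) y) =
      (fderiv ℝ (trans (S.chartM i) (S.chartM j)) (S.param (S.chartN i) (S.chartM i) y)).comp
        (fderiv ℝ (S.param (S.chartN i) (S.chartM i)) y) := by
    rw [← fderiv_comp y d2 d1, ← fderiv_comp y d4 d3]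
    refine Filter.EventuallyEq.fderiv_eq ?_
    filter_upwards [(S.isOpen_common i j).mem_nhds hy] with z hz using S.param_trans hz
  ext v
  have h2 := fun v => congrArg (fun L => L v) h1
  have h3 := congrArg (fun α => α fun q => fderiv ℝ (S.param (S.chartN i) (S.chartM i)) y (v q))
    (hlaw _ hei _ hej _ (S.param_mem_overlap hy))
  simp only [ContinuousLinearMap.comp_apply] at h2
  simp only [ContinuousAlternatingMap.compContinuousLinearMap_apply, ClosedSurface.pull,
    Function.comp_def, h2, S.param_trans hy] at h3 ⊢
  exact h3

theorem ClosedSurface.extDeriv_cutoff_pull_trans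
    (hζ : ∀ e ∈ atlas (E (k + 1 + 2)) M, ContDiffOn ℝ ∞ (ζ e) e.target)
    (hlaw : ∀ e ∈ atlas (E (k + 1 + 2)) M, ∀ e' ∈ atlas (E (k + 1 + 2)) M, ∀ x ∈ overlap e e',
      (ζ e' (trans e e' x)).compContinuousLinearMap (fderiv ℝ (trans e e') x) = ζ e x)
    (hy : y ∈ S.common i j) :
    extDeriv (fun z => S.cutoff i l z • S.pull ζ i z) y =
      (extDeriv (fun z => S.cutoff j l z • S.pull ζ j z)
        (trans (S.chartN i) (S.chartN j) y)).compContinuousLinearMap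
        (fderiv ℝ (trans (S.chartN i) (S.chartN j)) y) := by
  have hci := S.chartN_mem i
  have hcj := S.chartN_mem j
  have ht := S.trans_mem_common hy
  have d1 : DifferentiableAt ℝ (fun z => S.cutoff j l z • S.pull ζ j z)
      (trans (S.chartN i) (S.chartN j) y) :=
    differentiableAt_of_contDiffOn S.isOpen_piece ht.1.1
      (S.contDiffOn_cutoff.smul (S.contDiffOn_pull hζ))
  have d2 : ContDiffAt ℝ ∞ (trans (S.chartN i) (S.chartN j)) y :=
    (contDiffOn_trans hci hcj).contDiffAt ((isOpen_overlap _ _).mem_nhds hy.2)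
  rw [← extDeriv_pullback d1 d2 (by simpa using WithTop.coe_le_coe.2 (le_top (a := (2 : ℕ∞))))]
  refine Filter.EventuallyEq.extDeriv_eq ?_
  filter_upwards [(S.isOpen_common i j).mem_nhds hy] with z hz
  rw [← S.pull_trans hlaw hz, ← S.cutoff_trans hz.2]
  rfl

/-- Both integrals localize to the common region: on the left because `d(ρ_j ζ)` vanishes off the
support of `ρ_j`, on the right because of the factor `ρ_i`. There they are related by a change of
variables. -/
theorem ClosedSurface.setIntegral_cutoff_extDeriv (hN : OrientedAtlas (k + 1) N)
    (hζ : ∀ e ∈ atlas (E (k + 1 + 2)) M, ContDiffOn ℝ ∞ (ζ e) e.target)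
    (hlaw : ∀ e ∈ atlas (E (k + 1 + 2)) M, ∀ e' ∈ atlas (E (k + 1 + 2)) M, ∀ x ∈ overlap e e',
      (ζ e' (trans e e' x)).compContinuousLinearMap (fderiv ℝ (trans e e') x) = ζ e x) :
    ∫ y in S.piece i, S.cutoff i i y *
        extDeriv (fun z => S.cutoff i j z • S.pull ζ i z) y (frame (k + 1)) =
      ∫ y in S.piece j, S.cutoff j i y *
        extDeriv (fun z => S.cutoff j j z • S.pull ζ j z) y (frame (k + 1)) := by
  have hsub : ∀ i j, S.common i j ⊆ S.piece i := fun i j y hy => hy.1.1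
  have hmem : ∀ {i j : Fin S.k} {y}, y ∈ S.piece i → (S.chartN i).symm y ∈ tsupport (S.ρ j) →
      y ∈ S.common i j := fun hy h =>
    ⟨⟨hy, hy.1, (S.ρ_supp _ h).2⟩, hy.1, (S.ρ_supp _ h).1⟩
  have hci := S.chartN_mem i
  have hcj := S.chartN_mem j
  rw [MeasureTheory.setIntegral_eq_of_subset_of_forall_sdiff_eq_zero
      S.isOpen_piece.measurableSet (hsub i j) fun y hy => ?_,
    MeasureTheory.setIntegral_eq_of_subset_of_forall_sdiff_eq_zero
      S.isOpen_piece.measurableSet (hsub j i) fun y hy => ?_]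
  · rw [← S.image_common (i := i) (j := j),
      MeasureTheory.integral_image_eq_integral_abs_det_fderiv_smul MeasureTheory.volume
        (S.isOpen_common i j).measurableSet
        (fun y hy => (differentiableAt_trans hci hcj hy.2).hasFDerivAt.hasFDerivWithinAt)
        (fun y hy y' hy' h => by rw [← trans_trans hy.2, h, trans_trans hy'.2])]
    refine MeasureTheory.setIntegral_congr_fun (S.isOpen_common i j).measurableSet fun y hy => ?_
    have hdet : (fderiv ℝ (trans (S.chartN i) (S.chartN j)) y).det =
        jacDet (S.chartN i) (S.chartN j) y :=
      det_eq_of_entries _ (fderiv_trans_basisVec (differentiableAt_trans hci hcj hy.2))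
    beta_reduce
    -- The pullback yields the Jacobian with its sign, the change of variables its absolute value;
    -- orientation identifies them.
    rw [S.extDeriv_cutoff_pull_trans hζ hlaw hy, pullback_frame, S.cutoff_trans hy.2, hdet,
      abs_of_pos (hN _ hci _ hcj y hy.2), smul_eq_mul]
    ring
  · rw [S.cutoff_eq_zero fun h => hy.2 (hmem hy.1 h), zero_mul]
  · rw [S.extDeriv_cutoff_pull_eq_zero hy.1 fun h => hy.2 (hmem hy.1 h)]
    exact mul_zero _

/-- Stokes' theorem. -/
theorem ClosedSurface.integral_extDeriv [CompactSpace N] (hN : OrientedAtlas (k + 1) N)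
    (hζ : ∀ e ∈ atlas (E (k + 1 + 2)) M, ContDiffOn ℝ ∞ (ζ e) e.target)
    (hlaw : ∀ e ∈ atlas (E (k + 1 + 2)) M, ∀ e' ∈ atlas (E (k + 1 + 2)) M, ∀ x ∈ overlap e e',
      (ζ e' (trans e e' x)).compContinuousLinearMap (fderiv ℝ (trans e e') x) = ζ e x) :
    S.integral (fun e p => extDeriv (ζ e) (e (S.ι p))) = 0 := by
  have hsm : ∀ i j, ContDiffOn ℝ ∞ (fun z => S.cutoff i j z • S.pull ζ i z) (S.piece i) :=
    fun i j => S.contDiffOn_cutoff.smul (S.contDiffOn_pull hζ)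
  have hcont : ∀ i j, ContinuousOn
      (fun y => extDeriv (fun z => S.cutoff i j z • S.pull ζ i z) y (frame (k + 1))) (S.piece i) :=
    fun i j => contDiffOn_zero.1 (contDiffOn_alternating_apply
      (contDiffOn_zero.2 (continuousOn_extDeriv S.isOpen_piece ((hsm i j).of_le (by simp))))
      fun _ => contDiffOn_const)
  have h1 : ∀ i, ∀ y ∈ S.piece i,
      extDeriv (ζ (S.chartM i)) (S.chartM i (S.ι ((S.chartN i).symm y)))
        (S.tangent (S.chartN i) (S.chartM i) y) =
      ∑ j, extDeriv (fun z => S.cutoff i j z • S.pull ζ i z) y (frame (k + 1)) := by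
    intro i y hy
    have d1 : DifferentiableAt ℝ (ζ (S.chartM i)) (S.param (S.chartN i) (S.chartM i) y) :=
      differentiableAt_of_contDiffOn (S.chartM i).open_target (S.param_mem hy)
        (hζ _ (S.chartM_mem i))
    have d2 : ContDiffAt ℝ ∞ (S.param (S.chartN i) (S.chartM i)) y :=
      (S.contDiffOn_param (S.chartN_mem i) (S.chartM_mem i)).contDiffAt (S.isOpen_piece.mem_nhds hy)
    have h2 : extDeriv (S.pull ζ i) y = (extDeriv (ζ (S.chartM i))
        (S.param (S.chartN i) (S.chartM i) y)).compContinuousLinearMap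
        (fderiv ℝ (S.param (S.chartN i) (S.chartM i)) y) := extDeriv_pullback d1 d2 (by simpa using WithTop.coe_le_coe.2 (le_top (a := (2 : ℕ∞))))
    -- The partition of unity is inserted a second time, under the exterior derivative.
    have h3 : S.pull ζ i = fun z => ∑ j, S.cutoff i j z • S.pull ζ i z := by
      ext1 z
      rw [← Finset.sum_smul, S.sum_cutoff, one_smul]
    have h4 : fderiv ℝ (S.pull ζ i) y =
        ∑ j, fderiv ℝ (fun z => S.cutoff i j z • S.pull ζ i z) y := by
      conv_lhs => rw [h3]
      exact fderiv_fun_sum fun j _ => differentiableAt_of_contDiffOn S.isOpen_piece hy (hsm i j)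
    have h5 : extDeriv (S.pull ζ i) y =
        ∑ j, extDeriv (fun z => S.cutoff i j z • S.pull ζ i z) y := by
      rw [extDeriv, h4]
      exact map_sum (ContinuousAlternatingMap.alternatizeUncurryFinCLM ℝ (E (k + 1)) ℝ) _ _
    have h6 := congrArg (fun α => α (frame (k + 1))) (h2.symm.trans h5)
    rw [ContinuousAlternatingMap.sum_apply] at h6
    exact h6
  have h2 : S.integral (fun e p => extDeriv (ζ e) (e (S.ι p))) =
      ∑ i, ∑ j, ∫ y in S.piece i, S.cutoff i i y *
        extDeriv (fun z => S.cutoff i j z • S.pull ζ i z) y (frame (k + 1)) := by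
    rw [S.integral_eq]
    refine Finset.sum_congr rfl fun i _ => ?_
    rw [← MeasureTheory.integral_finsetSum _ fun j _ => S.integrableOn (hcont i j)]
    refine MeasureTheory.setIntegral_congr_fun S.isOpen_piece.measurableSet fun y hy => ?_
    beta_reduce
    rw [h1 i y hy, Finset.mul_sum]
  -- For fixed `j` all terms are moved to the `j`-th chart. The outer cut-offs then sum to `1`,
  -- leaving the integral of the derivative of a compactly supported form.
  rw [h2, Finset.sum_comm]
  refine Finset.sum_eq_zero fun j _ => ?_
  simp only [S.setIntegral_cutoff_extDeriv hN hζ hlaw]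
  rw [← MeasureTheory.integral_finsetSum]
  · simp only [← Finset.sum_mul, S.sum_cutoff, one_mul]
    refine setIntegral_extDeriv_eq_zero S.isOpen_piece S.isCompact_supp S.supp_subset
      ((hsm j j).of_le (by simp)) fun y hy h => ?_
    rw [S.cutoff_eq_zero (S.notMem_tsupport hy h), zero_smul]
  · intro i _
    refine integrableOn_of_eq_zero S.isOpen_piece S.isCompact_supp S.supp_subset
      (S.contDiffOn_cutoff.continuousOn.mul (hcont j j)) fun y hy h => ?_
    rw [S.extDeriv_cutoff_pull_eq_zero hy (S.notMem_tsupport hy h)]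
    exact mul_zero _

end Stokes

/-! ### Change of the entropy under the transformation of the multipliers -/

section EntropyChange

variable {m : ℕ} {M N : Type*} [TopologicalSpace M] [ChartedSpace (E (m + 2)) M]
  {f : Ix2 (m + 2) → Ix3 (m + 2) → ℝ} {φ : Config (m + 2) M}
  {κ4 : Comp (m + 2) M (Ix5 (m + 2))} {κ3 : Comp (m + 2) M (Ix4 (m + 2))}
  {V : Comp (m + 2) M (Ix1 (m + 2))} {e : Chart (m + 2) M} {x : E (m + 2)}

/-- The tensor density `κ_d^{cabe} ∇_c V^d`. -/
def potential (φ : Config (m + 2) M) (κ4 : Comp (m + 2) M (Ix5 (m + 2)))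
    (V : Comp (m + 2) M (Ix1 (m + 2))) : Comp (m + 2) M (Ix3 (m + 2)) := fun e x a b c =>
  (densMat4 (κ4 e) a b c x * nablaMat (φ.Γ e) (V e) x).trace

/-- The divergence of `potential`, as a form. -/
def potentialDiv (φ : Config (m + 2) M) (κ4 : Comp (m + 2) M (Ix5 (m + 2)))
    (V : Comp (m + 2) M (Ix1 (m + 2))) : Comp (m + 2) M (E (m + 2) [⋀^Fin m]→L[ℝ] ℝ) := fun e x =>
  epsForm2 fun a b => ∑ c, pd c (fun y => potential φ κ4 V e y a b c) x

theorem contDiffOn_potential (hφ : φ.IsField) (h4 : IsDensity4 κ4) (hV : IsVectorField V)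
    (he : e ∈ atlas (E (m + 2)) M) (a b c : Fin (m + 2)) :
    ContDiffOn ℝ ∞ (fun y => potential φ κ4 V e y a b c) e.target :=
  ((msmooth_densMat4 (h4.smooth e he) a b c).mul
    (msmooth_nablaMat e.open_target (hφ.connection.smooth e he) (hV.smooth e he))).trace

theorem contDiffOn_potentialDiv (hφ : φ.IsField) (h4 : IsDensity4 κ4) (hV : IsVectorField V)
    (he : e ∈ atlas (E (m + 2)) M) : ContDiffOn ℝ ∞ (potentialDiv φ κ4 V e) e.target :=
  contDiffOn_epsForm2 fun a b => ContDiffOn.sum fun c _ =>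
    contDiffOn_pd e.open_target (contDiffOn_potential hφ h4 hV he a b c) c

theorem potential_antisymm (h4a : TotallyAntisymm4 κ4) (he : e ∈ atlas (E (m + 2)) M)
    (hx : x ∈ e.target) (a b c : Fin (m + 2)) :
    potential φ κ4 V e x a b c = -potential φ κ4 V e x b a c ∧
      potential φ κ4 V e x a b c = -potential φ κ4 V e x a c b := by
  constructor
  · rw [potential, densMat4_antisymm_first (fun a b c d f => (h4a e he x hx a b c d f).1),
      neg_mul, Matrix.trace_neg]; rfl
  · rw [potential, densMat4_antisymm_last (fun a b c d f => (h4a e he x hx a b c d f).2),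
      neg_mul, Matrix.trace_neg]; rfl

theorem connMat_lieConnection (hφ : φ.IsField) (hs : φ.OnShell f) (hV : IsVectorField V)
    (he : e ∈ atlas (E (m + 2)) M) (hx : x ∈ e.target) (d : Fin (m + 2)) :
    connMat (lieConnection (V e) (φ.Γ e)) d x =
      covD (connMat (φ.Γ e)) d (nablaMat (φ.Γ e) (V e)) x := by
  ext a c
  exact lieConnection_eq e.open_target hx (hφ.connection.smooth e he) (hV.smooth e he)
    (hs.torsionFree e he) (hs.flat e he x hx) a d c

theorem yForm_lieConnection (hφ : φ.IsField) (hs : φ.OnShell f) (hV : IsVectorField V)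
    (he : e ∈ atlas (E (m + 2)) M) (hx : x ∈ e.target) :
    yForm (κ4 e x) (lieConnection (V e) (φ.Γ e) x) = epsForm2 fun a b =>
      ∑ h, (densMat4 (κ4 e) a h b x *
        covD (connMat (φ.Γ e)) h (nablaMat (φ.Γ e) (V e)) x).trace := by
  refine congrArg epsForm2 ?_
  ext a b
  refine (yTensor_eq (κ4 e) (lieConnection (V e) (φ.Γ e)) x a b).trans ?_
  simp only [connMat_lieConnection hφ hs hV he hx]

theorem contDiffOn_yForm_lieConnection (hφ : φ.IsField) (hs : φ.OnShell f) (h4 : IsDensity4 κ4)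
    (hV : IsVectorField V) (he : e ∈ atlas (E (m + 2)) M) :
    ContDiffOn ℝ ∞ (fun y => yForm (κ4 e y) (lieConnection (V e) (φ.Γ e) y)) e.target := by
  have hΓ := msmooth_connMat (hφ.connection.smooth e he)
  have hN := msmooth_nablaMat e.open_target (hφ.connection.smooth e he) (hV.smooth e he)
  refine ContDiffOn.congr (contDiffOn_epsForm2 fun a b => ContDiffOn.sum fun h _ => ?_)
    fun y hy => yForm_lieConnection hφ hs hV he hy
  exact ((msmooth_densMat4 (h4.smooth e he) a h b).mul
    (MSmooth.covD e.open_target hΓ hN h)).trace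

/-- The change of the multiplier `λ_R`, contracted with `∇V`. -/
theorem trace_gauge_eq (hφ : φ.IsField) (hs : φ.OnShell f) (h4 : IsDensity4 κ4)
    (h4a : TotallyAntisymm4 κ4) (hV : IsVectorField V)
    (he : e ∈ atlas (E (m + 2)) M) (hx : x ∈ e.target) :
    epsForm2 (fun a b => (densMat3 ((φ.gauge κ4 κ3).lamR e) a b x *
        nablaMat (φ.Γ e) (V e) x).trace) =
      epsForm2 (fun a b => (densMat3 (φ.lamR e) a b x * nablaMat (φ.Γ e) (V e) x).trace)
        + yForm (κ4 e x) (lieConnection (V e) (φ.Γ e) x) + potentialDiv φ κ4 V e x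
        + epsForm2 fun a b => (densMat3 (κ3 e) a b x * nablaMat (φ.Γ e) (V e) x).trace := by
  have hU := e.open_target
  have hN := msmooth_nablaMat hU (hφ.connection.smooth e he) (hV.smooth e he)
  have hK := msmooth_densMat4 (h4.smooth e he)
  rw [yForm_lieConnection hφ hs hV he hx, potentialDiv, ← epsForm2_add, ← epsForm2_add,
    ← epsForm2_add]
  refine congrArg epsForm2 ?_
  ext a b
  have h1 : densMat3 ((φ.gauge κ4 κ3).lamR e) a b x = densMat3 (φ.lamR e) a b x
      + ∑ c, covD (connMat (φ.Γ e)) c (densMat4 (κ4 e) a b c) x + densMat3 (κ3 e) a b x := by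
    rw [← densMat3_divDensity4 (hs.torsionFree e he x hx) (h4a e he x hx)]
    rfl
  -- In `Y` the middle upper index of `κ4` is contracted with `L_V Γ`; exchanging it with the last
  -- one gives the minus sign.
  have h2 : ∀ c, pd c (fun y => potential φ κ4 V e y a b c) x =
      (covD (connMat (φ.Γ e)) c (densMat4 (κ4 e) a b c) x * nablaMat (φ.Γ e) (V e) x).trace
      - (densMat4 (κ4 e) a c b x *
        covD (connMat (φ.Γ e)) c (nablaMat (φ.Γ e) (V e)) x).trace := by
    intro c
    rw [densMat4_antisymm_last (fun a b c d f => (h4a e he x hx a b c d f).2) a c b, neg_mul,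
      Matrix.trace_neg, sub_neg_eq_add]
    exact pd_trace_mul hU hx (hK a b c) hN c
  simp only [h1, h2, add_mul, Matrix.trace_add, Finset.sum_mul, Matrix.trace_sum,
    Finset.sum_sub_distrib]
  ring

variable [TopologicalSpace N] [ChartedSpace (E m) N]

/-- The integrand is one third of the exterior derivative of `ε_{abc} κ_d^{h abc} ∇_h V^d`, a
globally defined form because `κ4` is a density and `∇V` a tensor. Stokes' theorem applies. -/
theorem integral_potentialDiv_eq_zero [IsManifold (𝓡 (m + 2)) ∞ M] [CompactSpace N]
    [IsManifold (𝓡 m) ∞ N] (hM : OrientedAtlas (m + 2) M) (hN : OrientedAtlas m N)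
    (S : ClosedSurface m M N) (hφ : φ.IsField) (h4 : IsDensity4 κ4) (h4a : TotallyAntisymm4 κ4)
    (hV : IsVectorField V) :
    S.integral (fun e p => potentialDiv φ κ4 V e (e (S.ι p))) = 0 := by
  cases m with
  -- For a surface of dimension zero there is no potential form; instead a totally antisymmetric
  -- object with three indices vanishes in dimension two.
  | zero =>
    have hz : ∀ e ∈ atlas (E 2) M, ∀ x ∈ e.target, ∀ a b c, potential φ κ4 V e x a b c = 0 := by
      intro e he x hx a b c
      obtain ⟨h1, h2⟩ := potential_antisymm (φ := φ) (V := V) h4a he hx a b c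
      have h3 := (potential_antisymm (φ := φ) (V := V) h4a he hx b a c).2
      have hcase : a = b ∨ b = c ∨ a = c := by omega
      rcases hcase with rfl | rfl | rfl
      · linarith
      · linarith
      · linarith
    have h0 : S.integral (fun e p => potentialDiv φ κ4 V e (e (S.ι p))) =
        S.integral (fun e p => (0 : ℝ) • potentialDiv φ κ4 V e (e (S.ι p))) := by
      refine S.integral_congr fun i y hy => ?_
      have he := S.chartM_mem i
      have : potentialDiv φ κ4 V (S.chartM i) (S.chartM i (S.ι ((S.chartN i).symm y))) = 0 := by
        have hp : ∀ a b c, pd c (fun y => potential φ κ4 V (S.chartM i) y a b c)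
            (S.param (S.chartN i) (S.chartM i) y) = 0 := fun a b c =>
          (pd_congr (S.chartM i).open_target (S.param_mem hy) c fun z hz' =>
            hz _ he z hz' a b c).trans (pd_const c 0)
        change epsForm2 (fun a b => ∑ c, pd c (fun y => potential φ κ4 V (S.chartM i) y a b c)
            (S.param (S.chartN i) (S.chartM i) y)) = 0
        simp [hp, epsForm2_def]
      rw [this, smul_zero]
    rw [h0, S.integral_smul, zero_mul]
  | succ k =>
    have h1 : S.integral (fun e p => extDeriv (fun y => epsForm3 (potential φ κ4 V e y))
        (e (S.ι p))) = 0 := by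
      refine S.integral_extDeriv (ζ := fun e y => epsForm3 (potential φ κ4 V e y)) hN
        (fun e he => ?_) fun e he e' he' x hx => ?_
      · exact ContDiffOn.sum fun a _ => ContDiffOn.sum fun b _ => ContDiffOn.sum fun c _ =>
          (contDiffOn_potential hφ h4 hV he a b c).smul contDiffOn_const
      · refine epsForm3_pullback _ (J := jac e e' x)
          (fderiv_trans_basisVec (differentiableAt_trans he he' hx)) (hM e he e' he' x hx)
          fun A B C => ?_
        exact trace_densMat4_law hM h4 hφ.connection he he' (hV.smooth e he) (hV.smooth e' he')
          (hV.law e he e' he') hx A B C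
    have h2 : S.integral (fun e p => extDeriv (fun y => epsForm3 (potential φ κ4 V e y))
        (e (S.ι p))) = S.integral (fun e p => (3 : ℝ) • potentialDiv φ κ4 V e (e (S.ι p))) := by
      refine S.integral_congr fun i y hy => ?_
      have he := S.chartM_mem i
      have := extDeriv_epsForm3 (S.chartM i).open_target (S.param_mem hy)
        (contDiffOn_potential (φ := φ) (V := V) hφ h4 hV he)
        fun z hz => potential_antisymm h4a he hz
      exact congrArg (fun α => α (S.tangent (S.chartN i) (S.chartM i) y)) this
    rw [h1, S.integral_smul] at h2
    linarith

/-- Both entropies become integrals of `tr(λ_R ∇V)` with the same `∇V`. Their difference is `Y(L_V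
Γ)`, an exact form that integrates to zero, and the `κ3` term that vanishes on the surface. -/
theorem entropy_gauge_sub [IsManifold (𝓡 (m + 2)) ∞ M] [CompactSpace N]
    [IsManifold (𝓡 m) ∞ N] (hM : OrientedAtlas (m + 2) M) (hN : OrientedAtlas m N)
    {S : ClosedSurface m M N} (hφ : φ.IsField) (hs : φ.OnShell f) (h4 : IsDensity4 κ4)
    (h4a : TotallyAntisymm4 κ4) (h3a : TotallyAntisymm3 κ3)
    {b : Chart (m + 2) M → N → Ix2 (m + 2)} {κ : ℝ} (hB : IsBifurcationSurface S φ V b κ) :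
    κ / (2 * Real.pi) * (entropy S (φ.gauge κ4 κ3) b - entropy S φ b) =
      S.integral (fun e p => yForm (κ4 e (e (S.ι p)))
        (lieConnection (V e) (φ.Γ e) (e (S.ι p)))) := by
  have hV := hB.vectorField
  have hα : ∀ e ∈ atlas (E (m + 2)) M, ContDiffOn ℝ ∞ (fun x => epsForm2 fun a b =>
      (densMat3 (φ.lamR e) a b x * nablaMat (φ.Γ e) (V e) x).trace) e.target := fun e he =>
    contDiffOn_epsForm2 fun a b => ((msmooth_densMat3 (hφ.densityR.smooth e he) a b).mul
      (msmooth_nablaMat e.open_target (hφ.connection.smooth e he) (hV.smooth e he))).trace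
  have hY : ∀ e ∈ atlas (E (m + 2)) M, ContDiffOn ℝ ∞
      (fun y => yForm (κ4 e y) (lieConnection (V e) (φ.Γ e) y)) e.target := fun e he =>
    contDiffOn_yForm_lieConnection hφ hs h4 hV he
  have hI : ∀ ψ : Config (m + 2) M, ψ.g = φ.g → S.integral (fun e p => epsForm2 fun a b =>
      (densMat3 (ψ.lamR e) a b (e (S.ι p)) * nablaMat (φ.Γ e) (V e) (e (S.ι p))).trace) =
      κ * S.integral (entropyForm S ψ b) := by
    intro ψ hψ
    rw [← S.integral_smul]
    refine S.integral_congr fun i y hy => ?_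
    exact congrArg (fun α => α (S.tangent (S.chartN i) (S.chartM i) y))
      (hB.epsForm2_trace_eq hφ (S.chartN_mem i) (S.chartM_mem i) hy ψ hψ)
  have h1 : S.integral (fun e p => epsForm2 fun a b =>
      (densMat3 ((φ.gauge κ4 κ3).lamR e) a b (e (S.ι p)) *
        nablaMat (φ.Γ e) (V e) (e (S.ι p))).trace) =
      S.integral (fun e p => (fun e x => (epsForm2 (fun a b =>
        (densMat3 (φ.lamR e) a b x * nablaMat (φ.Γ e) (V e) x).trace)
        + yForm (κ4 e x) (lieConnection (V e) (φ.Γ e) x))) e (e (S.ι p)) +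
        potentialDiv φ κ4 V e (e (S.ι p))) := by
    refine S.integral_congr fun i y hy => ?_
    have h := congrArg (fun α => α (S.tangent (S.chartN i) (S.chartM i) y))
      (trace_gauge_eq (κ3 := κ3) hφ hs h4 h4a hV (S.chartM_mem i) (S.param_mem hy))
    have h0 := hB.epsForm2_trace_totallyAntisymm hφ (S.chartN_mem i) (S.chartM_mem i) hy h3a
    refine h.trans ?_
    rw [ContinuousAlternatingMap.add_apply, h0, add_zero]
    rfl
  rw [hI (φ.gauge κ4 κ3) rfl, S.integral_add (fun e he => (hα e he).add (hY e he))
      fun e he => contDiffOn_potentialDiv hφ h4 hV he,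
    integral_potentialDiv_eq_zero hM hN S hφ h4 h4a hV, add_zero, S.integral_add hα hY,
    hI φ rfl] at h1
  rw [entropy, entropy]
  have hπ := Real.pi_ne_zero
  field_simp
  linarith

theorem entropy_gauge_eq [IsManifold (𝓡 (m + 2)) ∞ M] [CompactSpace N]
    [IsManifold (𝓡 m) ∞ N] (hM : OrientedAtlas (m + 2) M) (hN : OrientedAtlas m N)
    {S : ClosedSurface m M N} (hφ : φ.IsField) (hs : φ.OnShell f) (h4 : IsDensity4 κ4)
    (h4a : TotallyAntisymm4 κ4) (h3a : TotallyAntisymm3 κ3)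
    {b : Chart (m + 2) M → N → Ix2 (m + 2)} {κ : ℝ} (hB : IsBifurcationSurface S φ V b κ)
    (h0 : ∀ e ∈ atlas (E (m + 2)) M, ∀ p, S.ι p ∈ e.source →
      lieConnection (V e) (φ.Γ e) (e (S.ι p)) = 0) :
    entropy S (φ.gauge κ4 κ3) b = entropy S φ b := by
  have h1 := entropy_gauge_sub hM hN hφ hs h4 h4a h3a hB
  have h2 : S.integral (fun e p => yForm (κ4 e (e (S.ι p)))
      (lieConnection (V e) (φ.Γ e) (e (S.ι p)))) = S.integral (fun e p => (0 : ℝ) •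
        yForm (κ4 e (e (S.ι p))) (lieConnection (V e) (φ.Γ e) (e (S.ι p)))) := by
    refine S.integral_congr fun i y hy => ?_
    rw [h0 _ (S.chartM_mem i) _ hy.2]
    simp [yForm, epsForm2_def]
  rw [h2, S.integral_smul, zero_mul] at h1
  exact sub_eq_zero.mp ((mul_eq_zero.mp h1).resolve_left
    (div_ne_zero hB.ne_zero (by positivity)))

end EntropyChange

end STG

end

/-! ### Assembly of the results. -/

theorem mainTheorem4
    {m : ℕ}
    {M : Type*} [TopologicalSpace M] [T2Space M] [ChartedSpace (STG.E (m + 2)) M]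
    [IsManifold (𝓡 (m + 2)) ∞ M] (hM : OrientedAtlas (m + 2) M)
    {N : Type*} [TopologicalSpace N] [T2Space N] [CompactSpace N] [ChartedSpace (STG.E m) N]
    [IsManifold (𝓡 m) ∞ N] (hN : OrientedAtlas m N)
    (S : ClosedSurface m M N)
    (f : Ix2 (m + 2) → Ix3 (m + 2) → ℝ) (hf : IsScalarFunction f)
    (φ : Config (m + 2) M) (hφ : φ.IsField) :
    -- the boundary term
    (∀ Φ : ℝ → Config (m + 2) M, IsSmoothFamily Φ → Φ 0 = φ →
      ∀ e ∈ atlas (STG.E (m + 2)) M, ∀ x ∈ e.target,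
        HasDerivAt (fun s => (Φ s).lagrangian f e x)
          (φ.eomTerm f (variation Φ) e x
            + ∑ a, pd a (fun y => theta (φ.lamR e y) ((variation Φ).Γ e y) a
                + thetaMetric (φ.conj f e y) ((variation Φ).g e y) a) x) 0) ∧
    (φ.OnShell f →
      -- the entropy from the Noether charge
      (∃ Q : ChargeOperator m M, IsNoetherCharge f φ Q) ∧
      (∀ Q : ChargeOperator m M, IsNoetherCharge f φ Q →
        ∀ V b κ, IsBifurcationSurface S φ V b κ →
          S.integral (fun e p => Q.eval e (V e) (e (S.ι p))) =
            κ / (2 * Real.pi) * entropy S φ b) ∧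
      -- gauge invariance
      (∀ (κ4 : Comp (m + 2) M (Ix5 (m + 2))) (κ3 : Comp (m + 2) M (Ix4 (m + 2))),
        IsDensity4 κ4 → TotallyAntisymm4 κ4 → IsDensity3 κ3 → TotallyAntisymm3 κ3 →
        (φ.gauge κ4 κ3).OnShell f ∧
        -- the original boundary term, up to a term `δμ`, is one of the transformed Lagrangian
        (∀ Φ : ℝ → Config (m + 2) M, IsSmoothFamily Φ → Φ 0 = φ →
          (∀ s, ∀ e ∈ atlas (STG.E (m + 2)) M, ∀ x ∈ e.target, torsion ((Φ s).Γ e x) = 0) →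
          ∀ e ∈ atlas (STG.E (m + 2)) M, ∀ x ∈ e.target,
            HasDerivAt (fun s => ((Φ s).gauge κ4 κ3).lagrangian f e x)
              (∑ a, pd a (fun y => theta (φ.lamR e y) ((variation Φ).Γ e y) a
                  + thetaMetric (φ.conj f e y) ((variation Φ).g e y) a
                  + deltaMu (κ4 e y) (φ.Γ e) ((variation Φ).Γ e) y a) x) 0) ∧
        -- and it gives the original Noether current
        (∀ e ∈ atlas (STG.E (m + 2)) M, ∀ V : STG.E (m + 2) → Ix1 (m + 2),
          (∀ a, ContDiffOn ℝ ∞ (fun x => V x a) e.target) → ∀ x ∈ e.target, ∀ a,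
            theta (φ.lamR e x) (lieConnection V (φ.Γ e) x) a
                + thetaMetric (φ.conj f e x) (lieMetric V (φ.g e) x) a
                + deltaMu (κ4 e x) (φ.Γ e) (lieConnection V (φ.Γ e)) x a
                - V x a * (φ.gauge κ4 κ3).lagrangian f e x =
              φ.noetherCurrent f e V x a) ∧
        -- the transformed boundary term `2 λ δΓ` differs by an exact form
        (∀ e ∈ atlas (STG.E (m + 2)) M, ∀ γ : STG.E (m + 2) → Ix3 (m + 2),
          (∀ a b c, ContDiffOn ℝ ∞ (fun x => γ x a b c) e.target) →
          (∀ x ∈ e.target, torsion (γ x) = 0) →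
          (∀ x ∈ e.target, linCurvature (φ.Γ e) γ x = 0) →
          ∀ x ∈ e.target,
            epsForm1 (theta ((φ.gauge κ4 κ3).lamR e x) (γ x)) =
              epsForm1 (theta (φ.lamR e x) (γ x)) +
                extDeriv (fun y => yForm (κ4 e y) (γ y)) x) ∧
        -- the entropy changes at most by the corresponding ambiguity, and not if `L_V Γ = 0`
        (∀ V b κ, IsBifurcationSurface S φ V b κ →
          κ / (2 * Real.pi) * (entropy S (φ.gauge κ4 κ3) b - entropy S φ b) =
            S.integral (fun e p => yForm (κ4 e (e (S.ι p)))
              (lieConnection (V e) (φ.Γ e) (e (S.ι p)))) ∧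
          ((∀ e ∈ atlas (STG.E (m + 2)) M, ∀ p, S.ι p ∈ e.source →
              lieConnection (V e) (φ.Γ e) (e (S.ι p)) = 0) →
            entropy S (φ.gauge κ4 κ3) b = entropy S φ b)))) := by
  refine ⟨fun Φ hΦ h0 e he x hx => ?_, fun hs => ⟨⟨noetherCharge φ,
    isNoetherCharge_noetherCharge hM hf hφ hs⟩,
    fun Q hQ V b κ hB => hQ.integral_eq hM hf hφ hs hB, fun κ4 κ3 h4 h4a h3 h3a =>
    ⟨gauge_onShell hφ hs h4 h4a h3 h3a,
      fun Φ hΦ h0 hΦT e he x hx =>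
        hasDerivAt_gauge_lagrangian hφ hs hf h4 h4a h3 h3a hΦ h0 hΦT he hx,
      fun e he V hV x hx a => gauge_noetherCurrent hφ hs he hV hx a,
      fun e he γ hγ hγT hγR x hx => theta_gauge_eq hs h4 h4a h3a he hγ hγT hγR hx,
      fun V b κ hB => ⟨entropy_gauge_sub hM hN hφ hs h4 h4a h3a hB,
        entropy_gauge_eq hM hN hφ hs h4 h4a h3a hB⟩⟩⟩⟩
  subst h0
  exact hasDerivAt_lagrangian hΦ hf he hx
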